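/- **Setting.** Let $\Gamma$ be a finite commutative group and $\mathbf k$ a (commutative) $\mathbb Q$-algebra. Let $X$ be the alphabet of the letters $x_\sigma$, $\sigma\in\Gamma\cup\{0\}$, and $Y$ that of the $y_{n,\nu}=x_0^{n-1}x_\nu$, $n\ge 1$, $\nu\in\Gamma$. Let $\mathbf k\langle\langle X\rangle\rangle$, $\mathbf k\langle\langle Y\rangle\rangle$ be the algebras of noncommutative formal series and $(f|w)$ the coefficient of $w$ in $f$. Let $\Delta$ and $\Delta_*$ be the continuous algebra morphisms to the completed tensor squares with $\Delta x_\sigma=1\otimes x_\sigma+x_\sigma\otimes 1$ and $\Delta_*y_{n,\nu}=\sum_{i+j=n,\ \kappa\lambda=\nu}y_{i,\kappa}\otimes y_{j,\lambda}$, where $y_{0,1}=1$ and $y_{0,\nu}=0$ for $\nu\ne1$. Let $\pi_Y:\mathbf k\langle\langle X\rangle\rangle\to\mathbf k\langle\langle Y\rangle\rangle$ be the linear projection killing the words that end in $x_0$, and $\mathbf q$ the continuous linear map $y_{s_1,\sigma_1}y_{s_2,\sigma_2}\cdots y_{s_r,\sigma_r}\mapsto y_{s_1,\sigma_1}y_{s_2,\sigma_2\sigma_1^{-1}}\cdots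 y_{s_r,\sigma_r\sigma_{r-1}^{-1}}$. For $f\in\mathbf k\langle\langle X\rangle\rangle$ put $c(f)=\sum_{n\ge2}\frac{(-1)^{n-1}}n(f|y_{n,1})\,y_{1,1}^n$. For $d$ dividing $|\Gamma|$ let $\Gamma^d$ be the group of $d$-th powers, and let $p^d_*,i_d^*$ be the continuous algebra morphisms from the series on $\Gamma$ to those on $\Gamma^d$ with $p^d_*(x_0)=|\{\sigma:\sigma^d=1\}|\,x_0$, $p^d_*(x_\sigma)=x_{\sigma^d}$; $i_d^*(x_0)=x_0$, $i_d^*(x_\sigma)=x_\sigma$ if $\sigma\in\Gamma^d$ and $0$ if $\sigma\in\Gamma\setminus\Gamma^d$. * $\mathsf{DMR}(\mathbf k)$ is the set of $\Phi\in\mathbf k\langle\langle X\rangle\rangle$ with $(\Phi|1)=1$, $(\Phi|x_0)=(\Phi|x_1)=0$, $\Delta\Phi=\Phi\otimes\Phi$ and $\Delta_*\Phi_*=\Phi_*\otimes\Phi_*$, where $\Phi_*=\exp(c(\Phi))\cdot\mathbf q\pi_Y(\Phi)$. $\mathsf{DMRD}(\mathbf k)$ is the set of $\Phi\in\mathsf{DMR}(\mathbf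 k)$ such that $p^d_*(\Phi)=\exp\big(\sum_{\sigma^d=1}(\Phi|x_\sigma)\,x_1\big)\,i_d^*(\Phi)$ for all $d$ dividing $|\Gamma|$. * $\mathfrak{dmr}(\mathbf k)$ is the set of $\psi\in\mathbf k\langle\langle X\rangle\rangle$ with $(\psi|x_0)=(\psi|x_1)=0$, $\psi$ primitive for $\Delta$, and $\psi_*=\mathbf q\pi_Y(\psi)+c(\psi)$ primitive for $\Delta_*$. $\mathfrak{dmrd}(\mathbf k)$ is the set of $\psi\in\mathfrak{dmr}(\mathbf k)$ such that $p^d_*(\psi)=i_d^*(\psi)+\sum_{\sigma^d=1}(\psi|x_\sigma)\,x_1$ for all $d$ dividing $|\Gamma|$. * $\mathfrak{dmr}_0(\mathbf k)$ and $\mathfrak{dmrd}_0(\mathbf k)$ are the sets of elements $\psi$ of $\mathfrak{dmr}(\mathbf k)$, resp. $\mathfrak{dmrd}(\mathbf k)$, such that $(\psi_*|y_{n,\nu})+(-1)^n(\psi_*|y_{n,\nu^{-1}})=0$ for all $n\ge1$, $\nu\in\Gamma$. Let $\mathfrak{mt}(\mathbf k)$ be the module of series $\psi\in\mathbf k\langle\langle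 X\rangle\rangle$ without constant term. For such $\psi$ put $s_\psi(v)=\psi v+d_\psi(v)$, where $d_\psi$ is the continuous derivation with $d_\psi(x_0)=0$ and $d_\psi(x_\sigma)=[x_\sigma,t_\sigma(\psi)]$ for $\sigma\in\Gamma$, $t_\sigma$ being the substitution $x_0\mapsto x_0$, $x_\nu\mapsto x_{\sigma\nu}$. Then $\mathfrak{mt}(\mathbf k)$ is a Lie algebra for the Ihara bracket $\langle\psi_1,\psi_2\rangle=s_{\psi_1}(\psi_2)-s_{\psi_2}(\psi_1)$. For an embedding $\iota:\Gamma\to\mathbb C^*$, with $n=|\Gamma|$ and $\xi=\iota^{-1}(e^{2i\pi/n})$, put $\alpha_\iota=x_0x_1$ if $n\le2$ and $\alpha_\iota=\frac{2n}{n-2}(x_\xi-x_{\xi^{-1}})$ if $n\ge3$. **Proposition.** 1. $\mathfrak{dmr}_0(\mathbf k)$ and $\mathfrak{dmrd}_0(\mathbf k)$ are Lie subalgebras of $\mathfrak{mt}(\mathbf k)$ for the Ihara bracket. 2. $\mathsf{DMR}(\mathbf k)$ is stable under $\exp(s_\psi)$ for every $\psi\in\mathfrak{dmr}_0(\mathbf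 k)$, and $\mathsf{DMRD}(\mathbf k)$ is stable under $\exp(s_\psi)$ for every $\psi\in\mathfrak{dmrd}_0(\mathbf k)$. 3. For every embedding $\iota:\Gamma\to\mathbb C^*$, every $\psi\in\mathfrak{dmr}_0(\mathbf k)$ and every $\Phi\in\mathsf{DMR}(\mathbf k)$, one has $(\exp(s_\psi)(\Phi)\,|\,\alpha_\iota)=(\Phi|\alpha_\iota)$. -/

import Mathlib

/-! ### Noncommutative formal power series -/

/-- `R⟨⟨A⟩⟩`: noncommutative formal series in the letters of `A`, given by their coefficients on
words. When `A` carries a positive weight with finitely many letters of each weight, this is also the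
completion of the free associative algebra for the weight. -/
def NCSeries (A R : Type*) : Type _ := List A → R

namespace NCSeries

variable {A R k : Type*}

@[ext] theorem ext {f g : NCSeries A R} (h : ∀ w : List A, f w = g w) : f = g := funext h

instance [Ring R] : AddCommGroup (NCSeries A R) := inferInstanceAs (AddCommGroup (List A → R))

instance [CommRing k] : Module k (NCSeries A k) := inferInstanceAs (Module k (List A → k))

/-- `(f g | w)` is the sum of `(f | u) (g | v)` over the factorizations `w = u v`. -/
instance [Ring R] : Mul (NCSeries A R) :=
  ⟨fun f g w => ∑ i ∈ Finset.range (w.length + 1), f (w.take i) * g (w.drop i)⟩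

instance [Ring R] : One (NCSeries A R) :=
  ⟨fun w => match w with
    | [] => 1
    | _ :: _ => 0⟩

/-- The series `f_a` in the decomposition `f = (f | 1) + ∑ a, a f_a`. -/
def shift (a : A) (f : NCSeries A R) : NCSeries A R := fun w => f (a :: w)

@[simp] theorem shift_apply (a : A) (f : NCSeries A R) (w : List A) : shift a f w = f (a :: w) := rfl

section RingFacts
variable [Ring R]

@[simp] theorem zero_apply (w : List A) : (0 : NCSeries A R) w = 0 := rfl
@[simp] theorem add_apply (f g : NCSeries A R) (w : List A) : (f + g) w = f w + g w := rfl
@[simp] theorem sub_apply (f g : NCSeries A R) (w : List A) : (f - g) w = f w - g w := rfl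
@[simp] theorem neg_apply (f : NCSeries A R) (w : List A) : (-f) w = -f w := rfl
@[simp] theorem one_nil : (1 : NCSeries A R) [] = 1 := rfl
@[simp] theorem one_cons (a : A) (w : List A) : (1 : NCSeries A R) (a :: w) = 0 := rfl

theorem mul_apply (f g : NCSeries A R) (w : List A) :
    (f * g) w = ∑ i ∈ Finset.range (w.length + 1), f (w.take i) * g (w.drop i) := rfl

@[simp] theorem mul_nil (f g : NCSeries A R) : (f * g) [] = f [] * g [] := by
  simp [mul_apply]

theorem mul_cons (f g : NCSeries A R) (a : A) (w : List A) :
    (f * g) (a :: w) = f [] * g (a :: w) + (shift a f * g) w := by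
  rw [mul_apply, Finset.sum_range_succ', add_comm, mul_apply]
  simp [shift]

theorem shift_add (a : A) (f g : NCSeries A R) : shift a (f + g) = shift a f + shift a g := rfl
theorem shift_sub (a : A) (f g : NCSeries A R) : shift a (f - g) = shift a f - shift a g := rfl

theorem add_mul' (f g h : NCSeries A R) : (f + g) * h = f * h + g * h := by
  ext w; simp [mul_apply, add_mul, Finset.sum_add_distrib]

theorem mul_add' (f g h : NCSeries A R) : f * (g + h) = f * g + f * h := by
  ext w; simp [mul_apply, mul_add, Finset.sum_add_distrib]

def lmul (c : R) (f : NCSeries A R) : NCSeries A R := fun v => c * f v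

theorem lmul_mul (c : R) (f g : NCSeries A R) (w : List A) :
    (lmul c f * g) w = c * (f * g) w := by
  simp [lmul, mul_apply, Finset.mul_sum, mul_assoc]

theorem shift_mul' (a : A) (f g : NCSeries A R) :
    shift a (f * g) = lmul (f []) (shift a g) + shift a f * g := by
  ext w; simp [mul_cons, lmul]

theorem mul_assoc' (f g h : NCSeries A R) : f * g * h = f * (g * h) := by
  ext w
  induction w generalizing f g with
  | nil => simp [mul_assoc]
  | cons a w ih =>
    rw [mul_cons, mul_cons f, mul_cons g, shift_mul', add_mul', add_apply, lmul_mul, ih]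
    simp only [mul_nil]
    noncomm_ring

theorem one_mul' (f : NCSeries A R) : 1 * f = f := by
  ext w
  cases w with
  | nil => simp
  | cons a w =>
    have : shift a (1 : NCSeries A R) = 0 := by ext; simp
    rw [mul_cons, this]
    simp [mul_apply]

theorem mul_one' (f : NCSeries A R) : f * 1 = f := by
  ext w
  induction w generalizing f with
  | nil => simp
  | cons a w ih => rw [mul_cons, ih]; simp

end RingFacts

instance [Ring R] : Ring (NCSeries A R) :=
  { (inferInstance : AddCommGroup (NCSeries A R)), (inferInstance : Mul (NCSeries A R)),
    (inferInstance : One (NCSeries A R)) with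
    left_distrib := mul_add'
    right_distrib := add_mul'
    zero_mul := fun f => by ext w; simp [mul_apply]
    mul_zero := fun f => by ext w; simp [mul_apply]
    mul_assoc := mul_assoc'
    one_mul := one_mul'
    mul_one := mul_one' }

open Classical in
/-- A letter, as a series. -/
noncomputable def letter [Ring R] (a : A) : NCSeries A R := fun w => if w = [a] then 1 else 0

/-- The exponential of a series without constant term. As `fⁿ` has no term of length `< n`,
only the terms with `n ≤ length w` contribute to the coefficient of `w`. -/
noncomputable def exp [CommRing k] [Algebra ℚ k] (f : NCSeries A k) : NCSeries A k := fun w =>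
  ∑ n ∈ Finset.range (w.length + 1), ((n.factorial : ℚ)⁻¹) • (f ^ n) w

/-- The continuous algebra morphism `a ↦ θ a`, i.e. `f ↦ ∑ w, (f | w) θ(w)`. It is used for a finite
alphabet `A` and series `θ a` without constant term, so that the sum giving a coefficient is
finite. -/
noncomputable def subst {B : Type*} [CommRing k] (θ : A → NCSeries B k) (f : NCSeries A k) :
    NCSeries B k := fun v => ∑ᶠ w : List A, f w * (w.map θ).prod v

/-! The completed tensor square of `k⟨⟨A⟩⟩` consists of the families of coefficients on pairs of
words, i.e. it is `k⟨⟨A⟩⟩⟨⟨A⟩⟩`; the product of the latter is that of the tensor square. -/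

/-- `f ⊗ g` in the completed tensor square. -/
def tmul [CommRing k] (f g : NCSeries A k) : NCSeries A (NCSeries A k) := fun u v => f u * g v

/-- The continuous algebra morphism from `k⟨⟨A⟩⟩` to its completed tensor square given by `c` on
letters. It is used when `c` is homogeneous for a positive weight with finitely many letters
of each weight, so that the sum giving a coefficient is finite. -/
noncomputable def coprod [CommRing k] (c : A → NCSeries A (NCSeries A k)) (f : NCSeries A k) :
    NCSeries A (NCSeries A k) := fun u v => ∑ᶠ w : List A, f w * (w.map c).prod u v

section SmulFacts
variable [CommRing k]

theorem smul_apply (c : k) (f : NCSeries A k) (w : List A) : (c • f) w = c * f w := rfl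

theorem smul_mul (c : k) (f g : NCSeries A k) : (c • f) * g = c • (f * g) := by
  ext w; simp [mul_apply, smul_apply, Finset.mul_sum, mul_assoc]

theorem mul_smul' (c : k) (f g : NCSeries A k) : f * (c • g) = c • (f * g) := by
  ext w; simp [mul_apply, smul_apply, Finset.mul_sum, mul_left_comm]

theorem shift_smul (c : k) (a : A) (f : NCSeries A k) : shift a (c • f) = c • shift a f := rfl

theorem shift_mul (a : A) (f g : NCSeries A k) :
    shift a (f * g) = f [] • shift a g + shift a f * g := by
  ext w; simp [mul_cons, smul_apply]

end SmulFacts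

/-! ### Continuous derivations -/

section Derivation
variable [CommRing k] [Fintype A]

/-- The continuous derivation of `k⟨⟨A⟩⟩` with values `δ a` on the letters: for
`f = (f | 1) + ∑ a, a f_a`, it gives `∑ a, (δ a) f_a + ∑ a, a (der δ f_a)`. -/
def der (δ : A → NCSeries A k) : NCSeries A k → NCSeries A k
  | f, [] => (∑ a, δ a * shift a f) []
  | f, b :: w => (∑ a, δ a * shift a f) (b :: w) + der δ (shift b f) w

variable (δ : A → NCSeries A k)

theorem der_nil (f : NCSeries A k) : der δ f [] = (∑ a, δ a * shift a f) [] := by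
  rw [der]

theorem der_cons (f : NCSeries A k) (b : A) (w : List A) :
    der δ f (b :: w) = (∑ a, δ a * shift a f) (b :: w) + der δ (shift b f) w := by
  rw [der]

theorem shift_der (b : A) (f : NCSeries A k) :
    shift b (der δ f) = shift b (∑ a, δ a * shift a f) + der δ (shift b f) := by
  ext w; simp [der_cons]

theorem der_add (f g : NCSeries A k) : der δ (f + g) = der δ f + der δ g := by
  ext w
  induction w generalizing f g with
  | nil => simp [der_nil, shift_add, mul_add, Finset.sum_add_distrib]
  | cons b w ih =>
    simp only [der_cons, shift_add, mul_add, Finset.sum_add_distrib, add_apply, ih]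
    ring

theorem der_smul (c : k) (f : NCSeries A k) : der δ (c • f) = c • der δ f := by
  ext w
  induction w generalizing f with
  | nil => simp [der_nil, shift_smul, mul_smul', ← Finset.smul_sum, smul_apply]
  | cons b w ih =>
    simp only [der_cons, shift_smul, mul_smul', ← Finset.smul_sum, smul_apply, ih]
    ring

theorem der_sub (f g : NCSeries A k) : der δ (f - g) = der δ f - der δ g := by
  rw [eq_sub_iff_add_eq, ← der_add, sub_add_cancel]

theorem der_sum {ι : Type*} (s : Finset ι) (f : ι → NCSeries A k) :
    der δ (∑ i ∈ s, f i) = ∑ i ∈ s, der δ (f i) := by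
  classical
  induction s using Finset.induction_on with
  | empty => simpa using der_smul δ 0 0
  | insert a s ha ih => rw [Finset.sum_insert ha, Finset.sum_insert ha, der_add, ih]

theorem der_mul (f g : NCSeries A k) : der δ (f * g) = der δ f * g + f * der δ g := by
  have key : ∀ f : NCSeries A k, (∑ a, δ a * shift a (f * g)) =
      f [] • (∑ a, δ a * shift a g) + (∑ a, δ a * shift a f) * g := by
    intro f
    simp only [shift_mul, mul_add, mul_smul', Finset.sum_add_distrib, Finset.smul_sum,
      Finset.sum_mul, mul_assoc]
  ext w
  induction w generalizing f with
  | nil =>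
    rw [der_nil, key]
    simp only [add_apply, smul_apply, mul_nil, der_nil]
    ring
  | cons b w ih =>
    rw [der_cons, key, shift_mul, der_add, der_smul]
    simp only [add_apply, smul_apply, ih, mul_cons (der δ f), mul_cons f, shift_der,
      mul_cons (∑ a, δ a * shift a f), der_cons δ g, der_nil, add_mul]
    ring

theorem der_commutator (δ₁ δ₂ : A → NCSeries A k) (f : NCSeries A k) :
    der δ₁ (der δ₂ f) - der δ₂ (der δ₁ f) =
      der (fun a => der δ₁ (δ₂ a) - der δ₂ (δ₁ a)) f := by
  have key : ∀ (δ₁ δ₂ : A → NCSeries A k) (f : NCSeries A k),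
      (∑ a, δ₁ a * shift a (der δ₂ f)) = (∑ a, δ₁ a * shift a (∑ c, δ₂ c * shift c f)) +
        ∑ a, δ₁ a * der δ₂ (shift a f) := by
    intro δ₁ δ₂ f
    simp only [shift_der, mul_add, Finset.sum_add_distrib]
  have key2 : ∀ (δ₁ δ₂ : A → NCSeries A k) (f : NCSeries A k),
      der δ₁ (∑ c, δ₂ c * shift c f) =
        (∑ c, der δ₁ (δ₂ c) * shift c f) + ∑ c, δ₂ c * der δ₁ (shift c f) := by
    intro δ₁ δ₂ f
    simp only [der_sum, der_mul, Finset.sum_add_distrib]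
  ext w
  induction w generalizing f with
  | nil =>
    have h1 := congrFun (key2 δ₁ δ₂ f) []
    have h2 := congrFun (key2 δ₂ δ₁ f) []
    rw [der_nil, add_apply] at h1 h2
    simp only [sub_apply, der_nil, key, add_apply, sub_mul, Finset.sum_sub_distrib]
    rw [h1, h2]
    ring
  | cons b w ih =>
    have h1 := congrFun (key2 δ₁ δ₂ f) (b :: w)
    have h2 := congrFun (key2 δ₂ δ₁ f) (b :: w)
    rw [der_cons, add_apply] at h1 h2
    have h3 := ih (shift b f)
    rw [sub_apply] at h3
    rw [sub_apply, der_cons, der_cons δ₂, der_cons _ f, ← h3, key, key, shift_der, shift_der,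
      der_add, der_add]
    simp only [add_apply, sub_mul, Finset.sum_sub_distrib, sub_apply]
    linear_combination h1 - h2

end Derivation

end NCSeries

/-! ### The alphabets -/

/-- The letters `x_σ` for `σ ∈ Γ ∪ {0}`; `none` stands for the index `0`. -/
abbrev XLetter (Γ : Type*) : Type _ := Option Γ

/-- The letters `y_{n,ν}`, for `n ≥ 1` and `ν ∈ Γ`. -/
abbrev YLetter (Γ : Type*) : Type _ := ℕ+ × Γ

section Ihara

open NCSeries

variable {Γ k : Type*} [CommGroup Γ]

/-- The substitution `t_σ : x_ν ↦ x_{σν}`, which fixes `x_0`. -/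
def tSubst (σ : Γ) (f : NCSeries (XLetter Γ) k) : NCSeries (XLetter Γ) k :=
  fun w => f (w.map (Option.map (σ⁻¹ * ·)))

theorem tSubst_tSubst (σ τ : Γ) (f : NCSeries (XLetter Γ) k) :
    tSubst σ (tSubst τ f) = tSubst (σ * τ) f := by
  ext w
  simp only [tSubst, List.map_map]
  congr 2
  funext x
  cases x <;> simp [mul_assoc, mul_comm]

variable [CommRing k]

/-- The values `[x_σ, t_σ(ψ)]` at `x_σ` and `0` at `x_0` of the derivation `d_ψ`. -/
noncomputable def dLetter (ψ : NCSeries (XLetter Γ) k) : XLetter Γ → NCSeries (XLetter Γ) k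
  | none => 0
  | some σ => letter (some σ) * tSubst σ ψ - tSubst σ ψ * letter (some σ)

/-- The continuous derivation `d_ψ`. -/
noncomputable def dOp [Fintype Γ] (ψ v : NCSeries (XLetter Γ) k) : NCSeries (XLetter Γ) k :=
  der (dLetter ψ) v

/-- The operator `s_ψ(v) = ψ v + d_ψ(v)`. -/
noncomputable def sOp [Fintype Γ] (ψ v : NCSeries (XLetter Γ) k) : NCSeries (XLetter Γ) k :=
  ψ * v + dOp ψ v

/-- The operator `exp(s_ψ)`, for `ψ` without constant term. As `s_ψ` then increases the weight,
only the terms with `n ≤ length w` contribute to the coefficient of `w`. -/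
noncomputable def expS [Fintype Γ] [Algebra ℚ k] (ψ v : NCSeries (XLetter Γ) k) :
    NCSeries (XLetter Γ) k := fun w =>
  ∑ n ∈ Finset.range (w.length + 1), ((n.factorial : ℚ)⁻¹) • ((sOp ψ)^[n] v) w

theorem tSubst_mul (σ : Γ) (f g : NCSeries (XLetter Γ) k) :
    tSubst σ (f * g) = tSubst σ f * tSubst σ g := by
  ext w; simp [tSubst, mul_apply, List.map_take, List.map_drop]

theorem tSubst_add (σ : Γ) (f g : NCSeries (XLetter Γ) k) :
    tSubst σ (f + g) = tSubst σ f + tSubst σ g := rfl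

theorem tSubst_sub (σ : Γ) (f g : NCSeries (XLetter Γ) k) :
    tSubst σ (f - g) = tSubst σ f - tSubst σ g := rfl

theorem tSubst_sum {ι : Type*} (σ : Γ) (s : Finset ι) (f : ι → NCSeries (XLetter Γ) k) :
    tSubst σ (∑ i ∈ s, f i) = ∑ i ∈ s, tSubst σ (f i) := by
  classical
  induction s using Finset.induction_on with
  | empty => rfl
  | insert a s ha ih => rw [Finset.sum_insert ha, Finset.sum_insert ha, tSubst_add, ih]

theorem tSubst_letter (σ τ : Γ) :
    tSubst σ (letter (some τ) : NCSeries (XLetter Γ) k) = letter (some (σ * τ)) := by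
  ext w
  have h : w.map (Option.map (σ⁻¹ * ·)) = [some τ] ↔ w = [some (σ * τ)] := by
    rcases w with _ | ⟨_ | x, _ | ⟨y, w⟩⟩ <;> simp [inv_mul_eq_iff_eq_mul]
  change letter (some τ) (w.map (Option.map (σ⁻¹ * ·))) = _
  by_cases hw : w = [some (σ * τ)]
  · rw [letter, letter, if_pos (h.2 hw), if_pos hw]
  · rw [letter, letter, if_neg (fun h' => hw (h.1 h')), if_neg hw]

theorem tSubst_dLetter (σ : Γ) (ψ : NCSeries (XLetter Γ) k) (x : XLetter Γ) :
    tSubst σ (dLetter ψ x) = dLetter ψ (x.map (σ * ·)) := by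
  cases x with
  | none => rfl
  | some τ => simp [dLetter, tSubst_sub, tSubst_mul, tSubst_tSubst, tSubst_letter]

variable [Fintype Γ]

theorem tSubst_dOp (σ : Γ) (ψ f : NCSeries (XLetter Γ) k) :
    tSubst σ (dOp ψ f) = dOp ψ (tSubst σ f) := by
  have key : ∀ f : NCSeries (XLetter Γ) k,
      tSubst σ (∑ a, dLetter ψ a * shift a f) = ∑ a, dLetter ψ a * shift a (tSubst σ f) := by
    intro f
    rw [tSubst_sum]
    refine Fintype.sum_equiv (Equiv.optionCongr (Equiv.mulLeft σ)) _ _ fun x => ?_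
    rw [tSubst_mul, tSubst_dLetter]
    congr 1
    ext w
    cases x <;> simp [tSubst]
  ext w
  induction w generalizing f with
  | nil =>
    have := congrFun (key f) []
    simpa [tSubst, dOp, der] using this
  | cons b w ih =>
    have h := congrFun (key f) (b :: w)
    have h2 := ih (shift (b.map (σ⁻¹ * ·)) f)
    simp only [tSubst, List.map_cons] at h h2 ⊢
    simp only [dOp, der] at h h2 ⊢
    rw [h, h2]
    rfl

theorem dOp_lie (ψ₁ ψ₂ f : NCSeries (XLetter Γ) k) :
    dOp ψ₁ (dOp ψ₂ f) - dOp ψ₂ (dOp ψ₁ f) = dOp (sOp ψ₁ ψ₂ - sOp ψ₂ ψ₁) f := by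
  unfold dOp
  rw [der_commutator]
  congr 1
  funext x
  have hd : ∀ (ψ : NCSeries (XLetter Γ) k) (σ : Γ),
      der (dLetter ψ) (letter (some σ)) = dLetter ψ (some σ) := by
    intro ψ σ
    classical
    have hs : ∀ a : XLetter Γ, shift a (letter (some σ) : NCSeries (XLetter Γ) k) =
        if a = some σ then 1 else 0 := by
      intro a
      ext w
      cases w <;> by_cases h : a = some σ <;> simp [letter, h]
    have h0 : der (dLetter ψ) (0 : NCSeries (XLetter Γ) k) = 0 := by
      simpa using der_smul (dLetter ψ) 0 0
    have h1 : der (dLetter ψ) (1 : NCSeries (XLetter Γ) k) = 0 := by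
      have := der_mul (dLetter ψ) 1 1
      simpa using this
    ext w
    cases w with
    | nil => rw [der]; simp [hs]
    | cons b w =>
      rw [der]
      have : der (dLetter ψ) (shift b (letter (some σ))) = 0 := by
        rw [hs]; split_ifs <;> assumption
      rw [this]; simp [hs]
  cases x with
  | none =>
    have h0 : ∀ ψ : NCSeries (XLetter Γ) k, der (dLetter ψ) 0 = 0 := fun ψ => by
      simpa using der_smul (dLetter ψ) 0 0
    simp [dLetter, h0]
  | some σ =>
    have e : ∀ ψ₁ ψ₂ : NCSeries (XLetter Γ) k, der (dLetter ψ₁) (dLetter ψ₂ (some σ)) =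
        dLetter ψ₁ (some σ) * tSubst σ ψ₂ + letter (some σ) * tSubst σ (dOp ψ₁ ψ₂) -
        (tSubst σ (dOp ψ₁ ψ₂) * letter (some σ) + tSubst σ ψ₂ * dLetter ψ₁ (some σ)) := by
      intro ψ₁ ψ₂
      rw [tSubst_dOp]
      conv_lhs => rw [dLetter]
      rw [der_sub, der_mul, der_mul, hd]
      rfl
    rw [e, e]
    simp only [dLetter, sOp, tSubst_sub, tSubst_add, tSubst_mul]
    noncomm_ring

theorem sOp_lie (ψ₁ ψ₂ f : NCSeries (XLetter Γ) k) :
    sOp (sOp ψ₁ ψ₂ - sOp ψ₂ ψ₁) f = sOp ψ₁ (sOp ψ₂ f) - sOp ψ₂ (sOp ψ₁ f) := by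
  have h := dOp_lie ψ₁ ψ₂ f
  have hm : ∀ a f g : NCSeries (XLetter Γ) k, dOp a (f * g) = dOp a f * g + f * dOp a g :=
    fun a f g => der_mul _ f g
  have ha : ∀ a f g : NCSeries (XLetter Γ) k, dOp a (f + g) = dOp a f + dOp a g :=
    fun a f g => der_add _ f g
  conv_lhs => rw [sOp, ← h]
  simp only [sOp, hm, ha]
  noncomm_ring

theorem sOp_add (ψ f g : NCSeries (XLetter Γ) k) : sOp ψ (f + g) = sOp ψ f + sOp ψ g := by
  simp only [sOp, dOp, der_add, mul_add]; abel

theorem sOp_sub (ψ f g : NCSeries (XLetter Γ) k) : sOp ψ (f - g) = sOp ψ f - sOp ψ g := by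
  simp only [sOp, dOp, der_sub, mul_sub]; abel

theorem sOp_smul (c : k) (ψ f : NCSeries (XLetter Γ) k) : sOp ψ (c • f) = c • sOp ψ f := by
  simp only [sOp, dOp, der_smul, mul_smul', smul_add]

theorem add_sOp (φ ψ f : NCSeries (XLetter Γ) k) : sOp (φ + ψ) f = sOp φ f + sOp ψ f := by
  have hl : ∀ x, dLetter (φ + ψ) x = dLetter φ x + dLetter ψ x := by
    intro x
    cases x with
    | none => simp [dLetter]
    | some σ => simp only [dLetter, tSubst_add]; noncomm_ring
  have hd : dOp (φ + ψ) f = dOp φ f + dOp ψ f := by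
    unfold dOp
    ext w
    induction w generalizing f with
    | nil => simp [der, hl, add_mul, Finset.sum_add_distrib]
    | cons b w ih =>
      have h := ih (shift b f)
      rw [NCSeries.add_apply] at h ⊢
      simp only [der, h, hl, add_mul, Finset.sum_add_distrib, NCSeries.add_apply]
      ring
  rw [sOp, hd]; simp only [sOp]; noncomm_ring

theorem smul_sOp (c : k) (ψ f : NCSeries (XLetter Γ) k) : sOp (c • ψ) f = c • sOp ψ f := by
  have hl : ∀ x, dLetter (c • ψ) x = c • dLetter ψ x := by
    intro x
    cases x with
    | none => simp [dLetter]
    | some σ =>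
      have : tSubst σ (c • ψ) = c • tSubst σ ψ := rfl
      simp only [dLetter, this, mul_smul', smul_mul, smul_sub]
  have hd : dOp (c • ψ) f = c • dOp ψ f := by
    unfold dOp
    ext w
    induction w generalizing f with
    | nil => simp [der, hl, smul_mul, ← Finset.smul_sum, NCSeries.smul_apply]
    | cons b w ih =>
      have h := ih (shift b f)
      rw [NCSeries.smul_apply] at h ⊢
      simp only [der, h, hl, smul_mul, ← Finset.smul_sum, NCSeries.smul_apply]
      ring
  rw [sOp, hd]; simp only [sOp, smul_mul, smul_add]

theorem sOp_nil (ψ f : NCSeries (XLetter Γ) k) (hψ : ψ [] = 0) : sOp ψ f [] = 0 := by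
  have : ∀ x, dLetter ψ x [] = 0 := by
    intro x; cases x <;> simp [dLetter, letter]
  have hs : ∀ s : Finset (XLetter Γ), (∑ a ∈ s, dLetter ψ a * shift a f) [] = 0 := by
    classical
    intro s
    induction s using Finset.induction_on with
    | empty => rfl
    | insert a s ha ih => rw [Finset.sum_insert ha]; simp [ih, this]
  simp [sOp, dOp, der, hψ, hs]

end Ihara

/-! ### The Lie algebra `mt` -/

/-- `mt(k)`: the series in the `x_σ` without constant term. -/
def mtLie (Γ k : Type*) [CommRing k] : Submodule k (NCSeries (XLetter Γ) k) where
  carrier := {ψ | ψ [] = 0}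
  zero_mem' := rfl
  add_mem' := fun {a b} ha hb => by
    change a [] + b [] = 0
    rw [show a [] = 0 from ha, show b [] = 0 from hb, add_zero]
  smul_mem' := fun c f hf => by
    change c * f [] = 0
    rw [show f [] = 0 from hf, mul_zero]

section LieStructure

open NCSeries

variable {Γ k : Type*} [CommGroup Γ] [Fintype Γ] [CommRing k]

/-- The Ihara bracket `⟨ψ₁, ψ₂⟩ = s_{ψ₁}(ψ₂) - s_{ψ₂}(ψ₁)`. -/
noncomputable instance : Bracket (mtLie Γ k) (mtLie Γ k) :=
  ⟨fun ψ₁ ψ₂ => ⟨sOp ψ₁.1 ψ₂.1 - sOp ψ₂.1 ψ₁.1, by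
    change (sOp ψ₁.1 ψ₂.1 - sOp ψ₂.1 ψ₁.1) [] = 0
    rw [NCSeries.sub_apply, sOp_nil _ _ ψ₁.2, sOp_nil _ _ ψ₂.2, sub_zero]⟩⟩

theorem mtLie_bracket_coe (ψ₁ ψ₂ : mtLie Γ k) :
    ((⁅ψ₁, ψ₂⁆ : mtLie Γ k) : NCSeries (XLetter Γ) k) = sOp ψ₁.1 ψ₂.1 - sOp ψ₂.1 ψ₁.1 := rfl

noncomputable instance : LieRing (mtLie Γ k) :=
  { (inferInstance : AddCommGroup (mtLie Γ k)), (inferInstance : Bracket (mtLie Γ k) (mtLie Γ k)) with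
    add_lie := fun a b c => Subtype.ext <| by
      simp only [mtLie_bracket_coe, Submodule.coe_add, add_sOp, sOp_add]; abel
    lie_add := fun a b c => Subtype.ext <| by
      simp only [mtLie_bracket_coe, Submodule.coe_add, add_sOp, sOp_add]; abel
    lie_self := fun a => Subtype.ext <| by
      simp only [mtLie_bracket_coe, sub_self, Submodule.coe_zero]
    leibniz_lie := fun a b c => Subtype.ext <| by
      simp only [mtLie_bracket_coe, Submodule.coe_add, sOp_lie, sOp_sub]; abel }

noncomputable instance : LieAlgebra k (mtLie Γ k) :=
  { (inferInstance : Module k (mtLie Γ k)) with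
    lie_smul := fun c a b => Subtype.ext <| by
      simp only [mtLie_bracket_coe, Submodule.coe_smul, sOp_smul, smul_sOp, smul_sub] }

end LieStructure

/-! ### Double shuffle and regularization -/

section DoubleShuffle

open NCSeries

variable {Γ k : Type*} [CommGroup Γ] [CommRing k]

/-- The word `x_0^{n-1} x_ν`, i.e. `y_{n,ν}` as a word in the `x_σ`. -/
def yWord (n : ℕ+) (ν : Γ) : List (XLetter Γ) := List.replicate ((n : ℕ) - 1) none ++ [some ν]

/-- The projection `π_Y` that kills the words ending in `x_0`; the other words are identified with
words in the `y_{n,ν}`. -/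
def piY (f : NCSeries (XLetter Γ) k) : NCSeries (YLetter Γ) k :=
  fun w => f (w.flatMap fun y => yWord y.1 y.2)

/-- The map `p` on words in the `y_{n,ν}`, with `c` multiplied to all indices:
`y_{s₁,σ₁} y_{s₂,σ₂} ⋯ y_{s_r,σ_r} ↦ y_{s₁,cσ₁} y_{s₂,cσ₁σ₂} ⋯ y_{s_r,cσ₁⋯σ_r}`. -/
def pWord (c : Γ) : List (YLetter Γ) → List (YLetter Γ)
  | [] => []
  | (n, σ) :: w => (n, c * σ) :: pWord (c * σ) w

/-- The linear map `q : y_{s₁,σ₁} y_{s₂,σ₂} ⋯ y_{s_r,σ_r} ↦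
y_{s₁,σ₁} y_{s₂,σ₂σ₁⁻¹} ⋯ y_{s_r,σ_rσ_{r-1}⁻¹}`. It permutes the words and its inverse is `p`, so the
coefficient of `w` in `q(f)` is that of `p(w)` in `f`. -/
def qMap (f : NCSeries (YLetter Γ) k) : NCSeries (YLetter Γ) k := fun w => f (pWord 1 w)

/-- The coproduct `Δ`, for which the `x_σ` are primitive. -/
noncomputable def coprodX (f : NCSeries (XLetter Γ) k) :
    NCSeries (XLetter Γ) (NCSeries (XLetter Γ) k) :=
  coprod (fun x => tmul 1 (letter x) + tmul (letter x) 1) f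

open Classical in
/-- `y_{n,ν}` as a series, with `y_{0,1} = 1` and `y_{0,ν} = 0` for `ν ≠ 1`. -/
noncomputable def yLetter (n : ℕ) (ν : Γ) : NCSeries (YLetter Γ) k :=
  if h : 0 < n then letter (⟨n, h⟩, ν) else if ν = 1 then 1 else 0

/-- The coproduct `Δ_*`, with `Δ_* y_{n,ν} = ∑ y_{i,κ} ⊗ y_{j,λ}` over `i + j = n`, `κλ = ν`. -/
noncomputable def coprodY [Fintype Γ] (f : NCSeries (YLetter Γ) k) :
    NCSeries (YLetter Γ) (NCSeries (YLetter Γ) k) :=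
  coprod (fun y => ∑ ij ∈ Finset.HasAntidiagonal.antidiagonal (y.1 : ℕ), ∑ κ : Γ,
    tmul (yLetter ij.1 κ) (yLetter ij.2 (κ⁻¹ * y.2))) f

variable [Algebra ℚ k]

/-- `∑_{n ≥ 2} ((-1)^{n-1} / n) (f | y_{n,1}) y_{1,1}^n`; the coefficient of a word only involves
the term for which `n` is its length. -/
noncomputable def corrSum (f : NCSeries (XLetter Γ) k) : NCSeries (YLetter Γ) k := fun w =>
  ∑ n ∈ Finset.Icc 2 w.length,
    ((-1 : ℚ) ^ (n - 1) / n) • (piY f [(n.toPNat', 1)] * (yLetter 1 1 ^ n) w)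

/-- `Φ_* = Φ_corr · q π_Y(Φ)`, where `Φ_corr` is the exponential of `corrSum Φ`. -/
noncomputable def starGroup (Φ : NCSeries (XLetter Γ) k) : NCSeries (YLetter Γ) k :=
  NCSeries.exp (corrSum Φ) * qMap (piY Φ)

/-- `ψ_* = q π_Y(ψ) + ψ_corr`, where `ψ_corr` is `corrSum ψ`. -/
noncomputable def starLie (ψ : NCSeries (XLetter Γ) k) : NCSeries (YLetter Γ) k :=
  qMap (piY ψ) + corrSum ψ

end DoubleShuffle

/-! ### Functoriality in `Γ` and distribution -/

section Distribution

open NCSeries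

variable {k : Type*} [CommRing k]

/-- `φ_* : x_0 ↦ d x_0`, `x_σ ↦ x_{φ(σ)}`, where `d` is the order of the kernel of `φ`. -/
noncomputable def pushLetter {Γ Γ' : Type*} [CommGroup Γ] [CommGroup Γ'] (φ : Γ →* Γ') :
    XLetter Γ → NCSeries (XLetter Γ') k
  | none => (Nat.card φ.ker : k) • letter none
  | some σ => letter (some (φ σ))

/-- `φ^* : x_0 ↦ x_0`, `x_σ ↦ ∑_{φ(τ) = σ} x_τ`. -/
noncomputable def pullLetter {Γ Γ' : Type*} [CommGroup Γ] [CommGroup Γ'] (φ : Γ →* Γ') :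
    XLetter Γ' → NCSeries (XLetter Γ) k
  | none => letter none
  | some σ => ∑ᶠ (τ : Γ) (_ : φ τ = σ), letter (some τ)

/-- The subgroup `Γ^d` of `d`-th powers. -/
abbrev powSubgroup (Γ : Type*) [CommGroup Γ] (d : ℕ) : Subgroup Γ :=
  (powMonoidHom d : Γ →* Γ).range

variable {Γ : Type*} [CommGroup Γ]

/-- `p^d_*`, for `p^d : Γ → Γ^d`, `σ ↦ σ^d`. -/
noncomputable def pushPow (d : ℕ) (f : NCSeries (XLetter Γ) k) :
    NCSeries (XLetter (powSubgroup Γ d)) k :=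
  subst (pushLetter (powMonoidHom d : Γ →* Γ).rangeRestrict) f

/-- `i_d^*`, for the inclusion `i_d` of `Γ^d` in `Γ`. -/
noncomputable def pullIncl (d : ℕ) (f : NCSeries (XLetter Γ) k) :
    NCSeries (XLetter (powSubgroup Γ d)) k :=
  subst (pullLetter (powSubgroup Γ d).subtype) f

open Classical in
/-- `∑_{σ^d = 1} (f | x_σ) x_1`, in the series on `Γ^d`. -/
noncomputable def distTerm [Fintype Γ] (d : ℕ) (f : NCSeries (XLetter Γ) k) :
    NCSeries (XLetter (powSubgroup Γ d)) k :=
  (∑ σ : Γ with σ ^ d = 1, f [some σ]) • letter (some 1)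

end Distribution

/-! ### The sets `DMR`, `DMRD` and their tangent spaces -/

section Main

open NCSeries

variable (Γ k : Type*) [CommGroup Γ] [Fintype Γ] [CommRing k] [Algebra ℚ k]

/-- `DMR(Γ)(k)`. -/
def DMR : Set (NCSeries (XLetter Γ) k) :=
  {Φ | Φ [] = 1 ∧ Φ [none] = 0 ∧ Φ [some 1] = 0 ∧
    coprodX Φ = tmul Φ Φ ∧
    coprodY (starGroup Φ) = tmul (starGroup Φ) (starGroup Φ)}

/-- `DMRD(Γ)(k)`: the elements of `DMR(Γ)(k)` satisfying the distribution relations. -/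
def DMRD : Set (NCSeries (XLetter Γ) k) :=
  {Φ | Φ ∈ DMR Γ k ∧ ∀ d : ℕ, d ∣ Fintype.card Γ →
    pushPow d Φ = NCSeries.exp (distTerm d Φ) * pullIncl d Φ}

/-- `dmr(k)`. -/
def dmr : Set (NCSeries (XLetter Γ) k) :=
  {ψ | ψ [none] = 0 ∧ ψ [some 1] = 0 ∧
    coprodX ψ = tmul 1 ψ + tmul ψ 1 ∧
    coprodY (starLie ψ) = tmul 1 (starLie ψ) + tmul (starLie ψ) 1}

/-- `dmrd(k)`: the elements of `dmr(k)` satisfying the linearized distribution relations. -/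
def dmrd : Set (NCSeries (XLetter Γ) k) :=
  {ψ | ψ ∈ dmr Γ k ∧ ∀ d : ℕ, d ∣ Fintype.card Γ →
    pushPow d ψ = pullIncl d ψ + distTerm d ψ}

/-- The condition `(ψ_* | y_{n,ν}) + (-1)^n (ψ_* | y_{n,ν⁻¹}) = 0` for all `n ≥ 1` and `ν`. -/
def LengthOneParity (ψ : NCSeries (XLetter Γ) k) : Prop :=
  ∀ (n : ℕ+) (ν : Γ), starLie ψ [(n, ν)] + (-1) ^ (n : ℕ) * starLie ψ [(n, ν⁻¹)] = 0

/-- `dmr_0(k)`. -/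
def dmr0 : Set (NCSeries (XLetter Γ) k) := {ψ | ψ ∈ dmr Γ k ∧ LengthOneParity Γ k ψ}

/-- `dmrd_0(k)`. -/
def dmrd0 : Set (NCSeries (XLetter Γ) k) := {ψ | ψ ∈ dmrd Γ k ∧ LengthOneParity Γ k ψ}

variable {Γ k}

theorem exists_primitive (ι : Γ →* ℂˣ) (hι : Function.Injective ι) :
    ∃ ξ : Γ, ((ι ξ : ℂˣ) : ℂ) = Complex.exp (2 * Real.pi * Complex.I / Fintype.card Γ) := by
  have h : ι.range = rootsOfUnity (Fintype.card Γ) ℂ := by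
    apply Subgroup.eq_of_le_of_card_ge
    · rintro _ ⟨σ, rfl⟩
      rw [mem_rootsOfUnity, ← map_pow, pow_card_eq_one, map_one]
    · have : NeZero (Fintype.card Γ) := ⟨Fintype.card_ne_zero⟩
      rw [Complex.card_rootsOfUnity,
        ← Nat.card_congr (MonoidHom.ofInjective hι).toEquiv, Nat.card_eq_fintype_card]
  have hp := Complex.isPrimitiveRoot_exp (Fintype.card Γ) Fintype.card_ne_zero
  obtain ⟨u, hu⟩ := hp.isUnit Fintype.card_ne_zero
  have hm : u ∈ rootsOfUnity (Fintype.card Γ) ℂ := by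
    rw [mem_rootsOfUnity']
    rw [hu, hp.pow_eq_one]
  rw [← h] at hm
  obtain ⟨ξ, hξ⟩ := hm
  exact ⟨ξ, by rw [hξ, hu]⟩

/-- `ξ = ι⁻¹(exp(2iπ/n))`, for an embedding `ι` of a group `Γ` of order `n` in `ℂ^*`. -/
noncomputable def primitiveElt (ι : Γ →* ℂˣ) (hι : Function.Injective ι) : Γ :=
  (exists_primitive ι hι).choose

/-- The coefficient `(Φ | α_ι)`, where `α_ι = x_0 x_1` if the order `n` of `Γ` is at most `2`, and
`α_ι = (2n/(n-2)) (x_ξ - x_{ξ⁻¹})` if `n ≥ 3`. -/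
noncomputable def alphaCoeff (ι : Γ →* ℂˣ) (hι : Function.Injective ι)
    (Φ : NCSeries (XLetter Γ) k) : k :=
  if Fintype.card Γ ≤ 2 then Φ [none, some 1]
  else ((2 * Fintype.card Γ : ℚ) / (Fintype.card Γ - 2)) •
    (Φ [some (primitiveElt ι hι)] - Φ [some (primitiveElt ι hι)⁻¹])

end Main

/-! The proof rests on coderivations: operators `T` with `Δ ∘ T = (T ⊗ 1 + 1 ⊗ T) ∘ Δ`. If two of
them map `1` to primitive series, so does their commutator (`IsCoder.cop_commutator_one`), and the
exponential of a weight-raising one preserves group-like series (`IsCoder.cop_expOp`). Since `s_ψ(1)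
= ψ` and the Ihara bracket is the commutator of `s_φ` and `s_ψ` applied to `1`, the first two
assertions without distribution follow once `s_ψ` is a coderivation for `Δ`, and a suitable operator
on the `Y` side is one for `Δ_*`.

For `Δ` this is direct (`sLin_isCoder`): the operator `s_ψ` satisfies `s_ψ(x f) = e_x f + x s_ψ(f)`
with `e_x` primitive. On the `Y` side, `d_ψ(x_0) = 0` makes the kernel `k⟨⟨X⟩⟩ x_0` of `q π_Y`
stable, so `s_ψ` descends to `yOp ψ`. Adding left multiplication by the correction of `ψ` gives
`starOp ψ`, which maps `1` to `ψ_*`. All corrections are series in `y_{1,1}`; they commute with each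
other and with `yOp ψ`, so brackets and exponentials are compatible with the passage to `ψ_*` and
`Φ_*` (`starLie_bracket`, `starGroup_expS`).

The core is that `starOp ψ` is a coderivation for `Δ_*` (`starOp_isCoder`). Its value on `y_{n,ν}`
is the part of degree `ν` of a series with coefficient `(f_{m-n} | v)` at `v y_{m,μ}`, plus one with
coefficient `(g_{m-n} | v)` at `y_{m,μ} v` (`starValue_eq_pairValue`). Here `f_i` is `u ↦ (ψ | u
x_0^i)`, corrected so that `f_0 = ψ_*`, and `g_i` is its image, up to sign, under the
antiautomorphism `y_{n,ν} ↦ (-1)^n y_{n,ν⁻¹}`; it arises from the shuffle antipode. Primitivity of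
`ψ` for `Δ` expresses `f_{i+1}` by a derivation of the `Y` series that preserves primitivity, so all
`f_i` and `g_i` are primitive. For such sequences, opposite coefficients in length one and a zero
value on `y_{1,1}` force compatibility with `Δ_*` (`cop_pairValue_eq`). The parity condition
defining `dmr_0` gives the opposite coefficients and makes the correction odd under the
antiautomorphism; the value on `y_{1,1}` is zero by a direct cancellation.

In depth one, `exp(s_ψ)` adds the coefficients of `ψ`, and brackets have no terms. This controls the
corrections and, with parity, gives the invariance of `(Φ | α_ι)`. For distribution, `p^d_*` and
`i_d^*` both intertwine the operators `s`, while `s_{x_1}` is left multiplication by `x_1`, which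
commutes with every `s_ψ`; the extra terms in `x_1` therefore cancel in brackets and add up in
exponentials. -/

namespace NCSeries

/-! ### Letters, and decompositions by the first or the last letter -/

section Letters

variable {A R : Type*} [Ring R]

open Classical in
theorem shift_letter (a b : A) :
    shift a (letter b : NCSeries A R) = if a = b then 1 else 0 := by
  ext w
  cases w <;> by_cases h : a = b <;> simp [letter, h]

@[simp] theorem letter_nil (a : A) : (letter a : NCSeries A R) [] = 0 := by simp [letter]

open Classical in
theorem letter_mul_cons (a b : A) (f : NCSeries A R) (w : List A) :
    (letter a * f : NCSeries A R) (b :: w) = if b = a then f w else 0 := by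
  rw [mul_cons, shift_letter]
  split_ifs <;> simp

theorem shift_one (a : A) : shift a (1 : NCSeries A R) = 0 := rfl

theorem sum_apply {ι : Type*} (s : Finset ι) (f : ι → NCSeries A R) (w : List A) :
    (∑ i ∈ s, f i) w = ∑ i ∈ s, f i w := by
  classical
  induction s using Finset.induction_on with
  | empty => rfl
  | insert a s ha ih => rw [Finset.sum_insert ha, Finset.sum_insert ha, add_apply, ih]

/-- The series `f^a` in the decomposition `f = (f | 1) + ∑ a, f^a a`. -/
def lastShift (a : A) (f : NCSeries A R) : NCSeries A R := fun w => f (w ++ [a])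

@[simp] theorem lastShift_apply {A R : Type*} (a : A) (f : NCSeries A R) (w : List A) :
    lastShift a f w = f (w ++ [a]) := rfl

theorem lastShift_mul_apply (a : A) (f g : NCSeries A R) (w : List A) :
    (f * g) (w ++ [a]) = (f * lastShift a g) w + f (w ++ [a]) * g [] := by
  induction w generalizing f with
  | nil => simp [mul_cons]
  | cons b w ih => rw [List.cons_append, mul_cons, ih, mul_cons]; simp [add_assoc]

open Classical in
theorem lastShift_letter (a b : A) :
    lastShift a (letter b : NCSeries A R) = if a = b then 1 else 0 := by
  ext w
  cases w <;> by_cases h : a = b <;> simp [letter, h]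

open Classical in
theorem mul_letter_append (a b : A) (f : NCSeries A R) (w : List A) :
    (f * letter a : NCSeries A R) (w ++ [b]) = if b = a then f w else 0 := by
  rw [lastShift_mul_apply, lastShift_letter]
  split_ifs <;> simp

theorem mul_letter_nil (a : A) (f : NCSeries A R) : (f * letter a : NCSeries A R) [] = 0 := by simp

end Letters

/-! ### Tensors -/

section Tensor

variable {A k : Type*} [CommRing k]

/-- The series in the first variable obtained by fixing the second one. -/
def slice (v : List A) (F : NCSeries A (NCSeries A k)) : NCSeries A k := fun u => F u v

@[simp] theorem slice_apply {A k : Type*} (u v : List A) (F : NCSeries A (NCSeries A k)) :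
    slice v F u = F u v := rfl

/-- The left shift in the second variable. -/
def innerShift (b : A) (F : NCSeries A (NCSeries A k)) : NCSeries A (NCSeries A k) :=
  fun u => shift b (F u)

theorem tmul_apply (f g : NCSeries A k) (u v : List A) : tmul f g u v = f u * g v := rfl

theorem tmul_mul_apply (f g : NCSeries A k) (F : NCSeries A (NCSeries A k)) (u : List A) :
    (tmul f g * F) u = ∑ i ∈ Finset.range (u.length + 1), f (u.take i) • (g * F (u.drop i)) := by
  rw [mul_apply]
  refine Finset.sum_congr rfl fun i _ => ?_
  have : tmul f g (u.take i) = f (u.take i) • g := rfl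
  rw [this, smul_mul]

theorem tmul_mul_apply' (f g : NCSeries A k) (F : NCSeries A (NCSeries A k)) (u v : List A) :
    (tmul f g * F) u v =
      ∑ i ∈ Finset.range (v.length + 1), g (v.take i) * (f * slice (v.drop i) F) u := by
  rw [tmul_mul_apply, sum_apply]
  simp only [smul_apply, mul_apply, Finset.mul_sum]
  rw [Finset.sum_comm]
  refine Finset.sum_congr rfl fun i _ => Finset.sum_congr rfl fun j _ => ?_
  rw [slice_apply]
  ring

theorem tmul_mul_tmul (f g f' g' : NCSeries A k) :
    tmul f g * tmul f' g' = tmul (f * f') (g * g') := by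
  ext u v
  rw [tmul_mul_apply', tmul_apply, mul_apply g, Finset.mul_sum]
  refine Finset.sum_congr rfl fun i _ => ?_
  have : slice (v.drop i) (tmul f' g') = g' (v.drop i) • f' := by
    ext u; simp [tmul_apply, smul_apply, mul_comm]
  rw [this, mul_smul', smul_apply]
  ring

theorem tmul_add (f g h : NCSeries A k) : tmul f (g + h) = tmul f g + tmul f h := by
  ext u v; simp [tmul_apply, mul_add]

theorem add_tmul (f g h : NCSeries A k) : tmul (f + g) h = tmul f h + tmul g h := by
  ext u v; simp [tmul_apply, add_mul]

theorem one_tmul_one : tmul 1 1 = (1 : NCSeries A (NCSeries A k)) := by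
  ext u v; cases u <;> simp [tmul_apply]

theorem one_tmul_mul (g : NCSeries A k) (F : NCSeries A (NCSeries A k)) (u : List A) :
    (tmul 1 g * F) u = g * F u := by
  rw [tmul_mul_apply, Finset.sum_eq_single_of_mem 0 (by simp)]
  · rw [List.take_zero, one_nil, one_smul, List.drop_zero]
  · intro i hi h0
    cases u with
    | nil => simp at hi; omega
    | cons a u =>
      obtain ⟨i, rfl⟩ := Nat.exists_eq_succ_of_ne_zero h0
      rw [List.take_succ_cons, one_cons, zero_smul]

theorem letter_tmul_mul_nil (a : A) (g : NCSeries A k) (F : NCSeries A (NCSeries A k)) :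
    (tmul (letter a) g * F) [] = 0 := by
  rw [tmul_mul_apply]; simp

open Classical in
theorem letter_tmul_mul_cons (a b : A) (g : NCSeries A k) (F : NCSeries A (NCSeries A k))
    (u : List A) : (tmul (letter a) g * F) (b :: u) = if b = a then g * F u else 0 := by
  have h1 : tmul (letter a) g [] = 0 := by ext; simp [tmul_apply]
  have h2 : shift b (tmul (letter a) g) = if b = a then tmul 1 g else 0 := by
    have : shift b (tmul (letter a) g) = tmul (shift b (letter a)) g := rfl
    rw [this, shift_letter]
    split_ifs
    · rfl
    · ext; simp [tmul_apply]
  rw [mul_cons, h1, h2]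
  split_ifs
  · simp [one_tmul_mul]
  · simp

end Tensor

/-! ### Quasi-shuffle coproducts -/

section ListSum

variable {A k : Type*} [CommRing k]

/-- The sum of the coefficients of the words of a list. -/
def listSum (f : NCSeries A k) : List (List A) → k
  | [] => 0
  | w :: l => f w + listSum f l

theorem listSum_append (f : NCSeries A k) (l l' : List (List A)) :
    listSum f (l ++ l') = listSum f l + listSum f l' := by
  induction l with
  | nil => simp [listSum]
  | cons w l ih => simp [listSum, ih, add_assoc]

theorem listSum_map_cons (f : NCSeries A k) (a : A) (l : List (List A)) :
    listSum f (l.map (a :: ·)) = listSum (shift a f) l := by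
  induction l with
  | nil => rfl
  | cons w l ih => simp [listSum, ih]

theorem listSum_zero (l : List (List A)) : listSum (0 : NCSeries A k) l = 0 := by
  induction l with
  | nil => rfl
  | cons w l ih => simp [listSum, ih]

theorem listSum_add (f g : NCSeries A k) (l : List (List A)) :
    listSum (f + g) l = listSum f l + listSum g l := by
  induction l with
  | nil => simp [listSum]
  | cons w l ih => simp only [listSum, ih, add_apply]; ring

theorem listSum_smul (c : k) (f : NCSeries A k) (l : List (List A)) :
    listSum (c • f) l = c * listSum f l := by
  induction l with
  | nil => simp [listSum]
  | cons w l ih => simp only [listSum, ih, smul_apply]; ring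

theorem listSum_congr {f g : NCSeries A k} {l : List (List A)} (h : ∀ w ∈ l, f w = g w) :
    listSum f l = listSum g l := by
  induction l with
  | nil => rfl
  | cons w l ih =>
    rw [listSum, listSum, h w (by simp), ih fun w hw => h w (by simp [hw])]

open Classical in
-- Turns the sum over all words in `coprod` into a sum over a finite list of words with
-- multiplicity.
theorem finsum_mul_count (f : NCSeries A k) (l : List (List A)) :
    (∑ᶠ w, f w * (l.count w : k)) = listSum f l := by
  have h : ∀ s : Finset (List A), (∀ w ∈ l, w ∈ s) →
      ∑ w ∈ s, f w * (l.count w : k) = listSum f l := by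
    intro s
    induction l with
    | nil => simp [listSum]
    | cons x l ih =>
      intro hs
      rw [listSum, ← ih fun w hw => hs w (by simp [hw])]
      simp only [List.count_cons, Nat.cast_add, mul_add, Finset.sum_add_distrib]
      rw [add_comm, Finset.sum_eq_single_of_mem x (hs x (by simp))]
      · simp
      · intro b _ hb; simp [Ne.symm hb]
  rw [finsum_eq_sum_of_support_subset (s := l.toFinset), h _ (by simp)]
  intro w hw
  by_contra h'
  apply hw
  have : w ∉ l := by simpa using h'
  simp [List.count_eq_zero_of_not_mem this]

end ListSum

/-- A partial operation on an alphabet, with the finiteness that is needed to define the coproduct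
`a ↦ 1 ⊗ a + a ⊗ 1 + ∑_{bc = a} b ⊗ c` on series, and a compatible weight. -/
structure QuasiShuffle (A : Type*) where
  op : A → A → Option A
  splits : A → Finset (A × A)
  mem_splits : ∀ {a : A} {p : A × A}, p ∈ splits a ↔ op p.1 p.2 = some a
  wt : A → ℕ
  wt_op : ∀ {a b c : A}, op a b = some c → wt c = wt a + wt b
  finite_wt : ∀ n : ℕ, {w : List A | (w.map wt).sum < n}.Finite

namespace QuasiShuffle

variable {A k : Type*} [CommRing k] (Q : QuasiShuffle A)

/-- The words, with multiplicity, of the quasi-shuffle product of two words. -/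
def words : List A → List A → List (List A)
  | [], v => [v]
  | a :: u, [] => [a :: u]
  | a :: u, b :: v => (words u (b :: v)).map (a :: ·) ++ (words (a :: u) v).map (b :: ·) ++
      (Q.op a b).elim [] fun c => (words u v).map (c :: ·)
termination_by u v => u.length + v.length

/-- The quasi-shuffle coproduct of a series. -/
def cop (f : NCSeries A k) : NCSeries A (NCSeries A k) := fun u v => listSum f (Q.words u v)

/-- The contribution of the product of two letters in the recursion for `cop`. -/
def opShift (a b : A) (f : NCSeries A k) : NCSeries A k :=
  (Q.op a b).elim 0 fun c => shift c f

@[simp] theorem cop_nil_left (f : NCSeries A k) (v : List A) : Q.cop f [] v = f v := by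
  simp [cop, words, listSum]

@[simp] theorem cop_nil_right (f : NCSeries A k) (u : List A) : Q.cop f u [] = f u := by
  cases u <;> simp [cop, words, listSum]

theorem cop_zero : Q.cop (0 : NCSeries A k) = 0 := by
  ext u v
  exact listSum_zero _

/-- The first letter of a word in the product of `a u` and `b v` is `a`, `b` or their product. This
recursion drives the inductions on `u.length + v.length` below. -/
theorem cop_cons (f : NCSeries A k) (a b : A) (u v : List A) :
    Q.cop f (a :: u) (b :: v) = Q.cop (shift a f) u (b :: v) + Q.cop (shift b f) (a :: u) v +
      Q.cop (Q.opShift a b f) u v := by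
  rw [cop, words, listSum_append, listSum_append, listSum_map_cons, listSum_map_cons]
  congr 1
  unfold opShift
  cases h : Q.op a b with
  | none => simp [cop_zero, listSum]
  | some c => simp only [Option.elim_some, listSum_map_cons]; rfl

theorem cop_add (f g : NCSeries A k) : Q.cop (f + g) = Q.cop f + Q.cop g := by
  ext u v
  exact listSum_add _ _ _

theorem cop_smul_apply (c : k) (f : NCSeries A k) (u v : List A) :
    Q.cop (c • f) u v = c * Q.cop f u v :=
  listSum_smul _ _ _

theorem cop_sub (f g : NCSeries A k) : Q.cop (f - g) = Q.cop f - Q.cop g := by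
  rw [eq_sub_iff_add_eq, ← cop_add, sub_add_cancel]

/-- The recursion for `cop` in terms of last letters. -/
theorem cop_append (f : NCSeries A k) (a b : A) (u v : List A) :
    Q.cop f (u ++ [a]) (v ++ [b]) = Q.cop (lastShift a f) u (v ++ [b]) +
      Q.cop (lastShift b f) (u ++ [a]) v +
      (Q.op a b).elim 0 fun c => Q.cop (lastShift c f) u v := by
  have hop : ∀ (x y : A) (f : NCSeries A k), lastShift a (Q.opShift x y f) =
      Q.opShift x y (lastShift a f) := by
    intro x y f; unfold opShift; cases Q.op x y <;> rfl
  have hop' : ∀ (x y : A) (f : NCSeries A k), lastShift b (Q.opShift x y f) =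
      Q.opShift x y (lastShift b f) := by
    intro x y f; unfold opShift; cases Q.op x y <;> rfl
  have hop'' : ∀ (x y c : A) (f : NCSeries A k), lastShift c (Q.opShift x y f) =
      Q.opShift x y (lastShift c f) := by
    intro x y c f; unfold opShift; cases Q.op x y <;> rfl
  have hs : ∀ (x c : A) (f : NCSeries A k), lastShift c (shift x f) = shift x (lastShift c f) :=
    fun _ _ _ => rfl
  have hsa : ∀ (x c : A) (w : List A) (f : NCSeries A k), shift x f (w ++ [c]) =
      lastShift c f (x :: w) := fun _ _ _ _ => rfl
  have hoa : ∀ (x y c : A) (w : List A) (f : NCSeries A k), Q.opShift x y f (w ++ [c]) =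
      Q.opShift x y (lastShift c f) w := by
    intro x y c w f; rw [← hop'']; rfl
  have hab : ∀ f : NCSeries A k, Q.opShift a b f [] =
      (Q.op a b).elim 0 fun c => lastShift c f [] := by
    intro f; unfold opShift; cases Q.op a b <;> rfl
  induction hn : u.length + v.length using Nat.strong_induction_on generalizing f u v with
  | _ n ih =>
    cases u with
    | nil =>
      cases v with
      | nil => 
        simp only [List.nil_append, cop_cons, cop_nil_left, cop_nil_right, hab, shift_apply, lastShift_apply]
        simp only [List.cons_append, List.nil_append]
        ring
      | cons y v =>
        have h := ih _ (by simp at hn ⊢; omega) (f := shift y f) (u := []) (v := v) rfl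
        simp only [List.nil_append, List.cons_append, cop_cons, cop_nil_left] at h ⊢
        rw [h, hs, hsa, hoa]
        cases Q.op a b <;> simp [hs] <;> ring
    | cons x u =>
      cases v with
      | nil =>
        have h := ih _ (by simp at hn ⊢; omega) (f := shift x f) (u := u) (v := []) rfl
        simp only [List.nil_append, List.cons_append, cop_cons, cop_nil_right] at h ⊢
        rw [h, hs, hoa, ← List.cons_append, lastShift_apply, lastShift_apply]
        cases Q.op a b <;> simp <;> ring
      | cons y v =>
        have h1 := ih _ (by simp at hn ⊢; omega) (f := shift x f) (u := u) (v := y :: v) rfl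
        have h2 := ih _ (by simp at hn ⊢; omega) (f := shift y f) (u := x :: u) (v := v) rfl
        have h3 := ih _ (by simp at hn ⊢; omega) (f := Q.opShift x y f) (u := u) (v := v) rfl
        simp only [List.cons_append] at h1 h2 h3 ⊢
        rw [cop_cons, h1, h2, h3, hop, hop']
        cases Q.op a b <;> simp [cop_cons, hs, hop''] <;> ring

theorem mul_cop_cons_cons (f : NCSeries A k) (F : NCSeries A (NCSeries A k)) (a b : A)
    (u v : List A) :
    (F * Q.cop f) (a :: u) (b :: v) = F [] [] * Q.cop f (a :: u) (b :: v) +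
      (shift b (F []) * Q.cop f (a :: u)) v + (shift a F * Q.cop f) u (b :: v) := by
  rw [mul_cons, add_apply, mul_cons]

theorem mul_apply_cons (F G : NCSeries A (NCSeries A k)) (u : List A) (b : A) (v : List A) :
    (F * G) u (b :: v) = ∑ i ∈ Finset.range (u.length + 1), F (u.take i) [] *
      G (u.drop i) (b :: v) + (innerShift b F * G) u v := by
  rw [mul_apply, sum_apply, mul_apply, sum_apply, ← Finset.sum_add_distrib]
  exact Finset.sum_congr rfl fun i _ => mul_cons _ _ _ _

/-- Both sides obey the same recursion on pairs of words: the constant term of `f` reproduces the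
three cases for `g`, and the shifts of `f` give the remaining terms. -/
theorem cop_mul (f g : NCSeries A k) : Q.cop (f * g) = Q.cop f * Q.cop g := by
  ext u v
  induction hn : u.length + v.length using Nat.strong_induction_on generalizing f u v with
  | _ n ih =>
    cases u with
    | nil =>
      rw [mul_nil, cop_nil_left]
      have h : ∀ f : NCSeries A k, Q.cop f [] = f := fun f => by ext; simp
      rw [h, h]
    | cons a u =>
      cases v with
      | nil =>
        rw [cop_nil_right, mul_apply, mul_apply, sum_apply]
        simp
      | cons b v =>
        have h1 := ih _ (by simp at hn ⊢; omega) (f := shift a f) (u := u) (v := b :: v) rfl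
        have h2 := ih _ (by simp at hn ⊢; omega) (f := shift b f) (u := a :: u) (v := v) rfl
        have h3 := ih _ (by simp at hn ⊢; omega) (f := Q.opShift a b f) (u := u) (v := v) rfl
        have ho : Q.opShift a b (f * g) = f [] • Q.opShift a b g + Q.opShift a b f * g := by
          unfold opShift; cases Q.op a b <;> simp [shift_mul]
        rw [cop_cons, shift_mul, shift_mul, ho, cop_add, cop_add, cop_add]
        simp only [add_apply, cop_smul_apply]
        rw [h1, h2, h3, mul_cop_cons_cons, mul_apply_cons (shift a (Q.cop f)),
          mul_apply_cons (Q.cop (shift a f)), mul_cons (Q.cop (shift b f)), cop_cons Q g]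
        have e1 : innerShift b (shift a (Q.cop f)) =
            innerShift b (Q.cop (shift a f)) + shift a (Q.cop (shift b f)) +
              Q.cop (Q.opShift a b f) := by
          ext u' v'
          exact Q.cop_cons f a b u' v'
        have e2 : Q.cop (shift b f) [] = shift b (Q.cop f []) := by ext; simp
        rw [e1, e2, add_mul, add_mul]
        simp only [add_apply, shift_apply, cop_nil_right]
        ring

open Classical in
-- When the product of the coproducts of the letters of `w` is expanded, each letter goes to the
-- left, to the right, or is split between both. The coefficient at `u ⊗ v` thus counts the ways of
-- obtaining `w` as a quasi-shuffle of `u` and `v`.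
theorem letterCoproduct_prod_apply (c : A → NCSeries A (NCSeries A k))
    (hc : ∀ a, c a = tmul 1 (letter a) + tmul (letter a) 1 +
      ∑ p ∈ Q.splits a, tmul (letter p.1) (letter p.2)) (w u v : List A) :
    (w.map c).prod u v = ((Q.words u v).count w : k) := by
  have hcount : ∀ (x a : A) (w : List A) (l : List (List A)),
      ((l.map (a :: ·)).count (x :: w) : k) = if a = x then (l.count w : k) else 0 := by
    intro x a w l
    induction l with
    | nil => simp
    | cons y l ih =>
      rw [List.map_cons, List.count_cons, Nat.cast_add, ih, List.count_cons]
      by_cases h : a = x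
      · simp [h]
      · simp [h]
  induction w generalizing u v with
  | nil =>
    rw [List.map_nil, List.prod_nil]
    cases u with
    | nil => cases v <;> simp [words]
    | cons a u =>
      cases v with
      | nil => simp [words]
      | cons b v =>
        have : ([] : List A) ∉ Q.words (a :: u) (b :: v) := by
          rw [words]
          cases Q.op a b <;> simp
        rw [List.count_eq_zero_of_not_mem this]
        simp
  | cons x w ih =>
    rw [List.map_cons, List.prod_cons, hc, add_mul, add_mul, Finset.sum_mul]
    simp only [add_apply, sum_apply, one_tmul_mul]
    cases u with
    | nil =>
      have h : ∀ p : A × A, (tmul (letter p.1) (letter p.2) *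
          (w.map c).prod : NCSeries A (NCSeries A k)) [] v = 0 := fun p => by
        rw [letter_tmul_mul_nil]; rfl
      simp only [letter_tmul_mul_nil, h]
      cases v with
      | nil => simp [words]
      | cons b v =>
        rw [letter_mul_cons, ih]
        simp only [words, List.count_singleton]
        by_cases h : b = x <;> simp [h, Ne.symm]
    | cons a u =>
      simp only [letter_tmul_mul_cons, one_mul]
      cases v with
      | nil =>
        simp only [mul_nil, letter_nil, zero_mul, zero_add]
        have : ∀ p : A × A, (if a = p.1 then (letter p.2 * (w.map c).prod u :
            NCSeries A k) else 0) [] = 0 := by intro p; split_ifs <;> simp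
        rw [Finset.sum_eq_zero fun p _ => this p]
        simp only [words, List.count_singleton]
        by_cases h : a = x
        · rw [if_pos h, ih]; cases u <;> simp [h, words, List.count_singleton]
        · simp [h]
      | cons b v =>
        rw [words, List.count_append, List.count_append, Nat.cast_add, Nat.cast_add, hcount,
          hcount, letter_mul_cons, ih]
        have : ∀ p : A × A, (if a = p.1 then (letter p.2 * (w.map c).prod u :
            NCSeries A k) else 0) (b :: v) = if p = (a, b) then ((Q.words u v).count w : k) else 0 := by
          rintro ⟨p, q⟩
          by_cases h : a = p
          · subst h
            rw [if_pos rfl, letter_mul_cons, ih]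
            by_cases h' : b = q <;> simp [h', eq_comm]
          · rw [if_neg h, if_neg (by simp [Ne.symm h])]; rfl
        simp only [this]
        rw [Finset.sum_ite_eq']
        simp only [mem_splits]
        have h2 : (if a = x then (w.map c).prod u else 0 : NCSeries A k) (b :: v) =
            if a = x then ((Q.words u (b :: v)).count w : k) else 0 := by
          split_ifs
          · exact ih _ _
          · rfl
        rw [h2]
        have h3 : (((Q.op a b).elim [] fun c => (Q.words u v).map (c :: ·)).count (x :: w) : k) =
            if Q.op a b = some x then ((Q.words u v).count w : k) else 0 := by
          cases Q.op a b with
          | none => simp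
          | some y => simp [hcount]
        rw [h3]
        ring

/-- Replaces the coproducts of the statement, which are infinite sums, by the recursive `cop`. -/
theorem coprod_eq_cop (c : A → NCSeries A (NCSeries A k))
    (hc : ∀ a, c a = tmul 1 (letter a) + tmul (letter a) 1 +
      ∑ p ∈ Q.splits a, tmul (letter p.1) (letter p.2)) (f : NCSeries A k) :
    coprod c f = Q.cop f := by
  classical
  ext u v
  simp only [coprod, Q.letterCoproduct_prod_apply c hc, finsum_mul_count]
  rfl

end QuasiShuffle

/-! ### Weights and locality -/

section Weight

variable {A B k : Type*} [CommRing k]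

/-- The weight of a word. -/
def wordWt (wt : A → ℕ) (w : List A) : ℕ := (w.map wt).sum

@[simp] theorem wordWt_nil (wt : A → ℕ) : wordWt wt [] = 0 := rfl

@[simp] theorem wordWt_cons (wt : A → ℕ) (a : A) (w : List A) :
    wordWt wt (a :: w) = wt a + wordWt wt w := rfl

@[simp] theorem wordWt_append (wt : A → ℕ) (u v : List A) :
    wordWt wt (u ++ v) = wordWt wt u + wordWt wt v := by simp [wordWt]

theorem wordWt_one (w : List A) : wordWt (fun _ => 1) w = w.length := by
  induction w with
  | nil => rfl
  | cons a w ih => simp [ih, add_comm]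

/-- All the terms of `f` have weight at least `n`. -/
def VanishBelow (wt : A → ℕ) (n : ℕ) (f : NCSeries A k) : Prop :=
  ∀ w, wordWt wt w < n → f w = 0

variable {wt : A → ℕ}

theorem vanishBelow_zero_left (f : NCSeries A k) : VanishBelow wt 0 f :=
  fun _ h => absurd h (Nat.not_lt_zero _)

theorem VanishBelow.mono {m n : ℕ} {f : NCSeries A k} (hf : VanishBelow wt n f) (h : m ≤ n) :
    VanishBelow wt m f := fun w hw => hf w (hw.trans_le h)

theorem vanishBelow_zero (n : ℕ) : VanishBelow wt n (0 : NCSeries A k) := fun _ _ => rfl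

theorem VanishBelow.add {n : ℕ} {f g : NCSeries A k} (hf : VanishBelow wt n f)
    (hg : VanishBelow wt n g) : VanishBelow wt n (f + g) := fun w hw => by
  rw [add_apply, hf w hw, hg w hw, add_zero]

theorem VanishBelow.sub {n : ℕ} {f g : NCSeries A k} (hf : VanishBelow wt n f)
    (hg : VanishBelow wt n g) : VanishBelow wt n (f - g) := fun w hw => by
  rw [sub_apply, hf w hw, hg w hw, sub_zero]

theorem VanishBelow.sum {ι : Type*} {n : ℕ} {s : Finset ι} {f : ι → NCSeries A k}
    (hf : ∀ i ∈ s, VanishBelow wt n (f i)) : VanishBelow wt n (∑ i ∈ s, f i) := fun w hw => by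
  rw [sum_apply]; exact Finset.sum_eq_zero fun i hi => hf i hi w hw

theorem VanishBelow.mul {m n : ℕ} {f g : NCSeries A k} (hf : VanishBelow wt m f)
    (hg : VanishBelow wt n g) : VanishBelow wt (m + n) (f * g) := fun w hw => by
  rw [mul_apply]
  refine Finset.sum_eq_zero fun i _ => ?_
  have h : wordWt wt w = wordWt wt (w.take i) + wordWt wt (w.drop i) := by
    rw [← wordWt_append, List.take_append_drop]
  by_cases h' : wordWt wt (w.take i) < m
  · rw [hf _ h', zero_mul]
  · rw [hg _ (by omega), mul_zero]

theorem vanishBelow_one_of_nil {f : NCSeries A k} (hwt : ∀ a, 0 < wt a) (hf : f [] = 0) :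
    VanishBelow wt 1 f := fun w hw => by
  cases w with
  | nil => exact hf
  | cons a w => have := hwt a; simp at hw; omega

/-- A linear operator that does not decrease the weight. -/
def IsLocal (wtA : A → ℕ) (wtB : B → ℕ) (T : NCSeries A k →ₗ[k] NCSeries B k) : Prop :=
  ∀ n f, VanishBelow wtA n f → VanishBelow wtB n (T f)

/-- A linear operator that increases the weight. -/
def IsRaising (wt : A → ℕ) (T : NCSeries A k →ₗ[k] NCSeries A k) : Prop :=
  ∀ n f, VanishBelow wt n f → VanishBelow wt (n + 1) (T f)

theorem IsRaising.isLocal {T : NCSeries A k →ₗ[k] NCSeries A k} (hT : IsRaising wt T) :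
    IsLocal wt wt T := fun n f hf => (hT n f hf).mono (Nat.le_succ n)

theorem IsRaising.add {S T : NCSeries A k →ₗ[k] NCSeries A k} (hS : IsRaising wt S)
    (hT : IsRaising wt T) : IsRaising wt (S + T) := fun n f hf => (hS n f hf).add (hT n f hf)

theorem IsRaising.pow {T : NCSeries A k →ₗ[k] NCSeries A k} (hT : IsRaising wt T) (i n : ℕ)
    (f : NCSeries A k) (hf : VanishBelow wt n f) : VanishBelow wt (n + i) ((T ^ i) f) := by
  induction i with
  | zero => exact hf
  | succ i ih => rw [pow_succ', Module.End.mul_apply]; exact hT _ _ ih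

/-- A word, as a series. -/
noncomputable def word (w : List A) : NCSeries A k := (w.map letter).prod

theorem word_cons (a : A) (w : List A) : (word (a :: w) : NCSeries A k) = letter a * word w := by
  simp [word]

open Classical in
theorem word_apply (w w' : List A) : (word w : NCSeries A k) w' = if w' = w then 1 else 0 := by
  induction w generalizing w' with
  | nil => cases w' <;> simp [word]
  | cons a w ih =>
    rw [word_cons]
    cases w' with
    | nil => simp
    | cons b w' =>
      rw [letter_mul_cons, ih]
      by_cases h : b = a <;> simp [h]

/-- Reduces identities between operators that do not decrease the weight to the case of words: at a
fixed word, the remainder `r` does not contribute. -/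
theorem exists_truncation {n : ℕ} (hfin : {w : List A | (w.map wt).sum < n}.Finite)
    (f : NCSeries A k) :
    ∃ r : NCSeries A k, VanishBelow wt n r ∧ f = ∑ w ∈ hfin.toFinset, f w • word w + r := by
  classical
  refine ⟨f - ∑ w ∈ hfin.toFinset, f w • word w, fun w hw => ?_, by abel⟩
  rw [sub_apply, sum_apply]
  simp only [smul_apply, word_apply]
  rw [Finset.sum_eq_single_of_mem w (hfin.mem_toFinset.2 hw)]
  · simp
  · intro b _ hb; simp [Ne.symm hb]

/-- Left multiplication by `f`. -/
noncomputable def lmulOp (f : NCSeries A k) : NCSeries A k →ₗ[k] NCSeries A k where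
  toFun g := f * g
  map_add' := mul_add f
  map_smul' c g := mul_smul' c f g

@[simp] theorem lmulOp_apply (f g : NCSeries A k) : lmulOp f g = f * g := rfl

theorem lmulOp_pow (f g : NCSeries A k) (n : ℕ) : (lmulOp f ^ n) g = f ^ n * g := by
  induction n with
  | zero => simp
  | succ n ih => rw [pow_succ', Module.End.mul_apply, ih, pow_succ', mul_assoc]; rfl

theorem lmulOp_isRaising {f : NCSeries A k} (hf : VanishBelow wt 1 f) :
    IsRaising wt (lmulOp f) := fun n g hg => (hf.mul hg).mono (by omega)

theorem VanishBelow.pow {f : NCSeries A k} (hf : VanishBelow wt 1 f) (n : ℕ) :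
    VanishBelow wt n (f ^ n) := by
  induction n with
  | zero => exact vanishBelow_zero_left _
  | succ n ih => rw [pow_succ]; exact ih.mul hf

end Weight

/-! ### Exponentials of operators -/

/-- The triangle `i + j < N` may replace the square `i, j < N`. This is how truncated exponentials
are multiplied. -/
theorem sum_antidiagonal_eq_sum_range {k : Type*} [AddCommMonoid k] {N : ℕ} {g : ℕ → ℕ → k}
    (hg : ∀ i j, N ≤ i + j → g i j = 0) :
    ∑ n ∈ Finset.range N, ∑ p ∈ Finset.HasAntidiagonal.antidiagonal n, g p.1 p.2 =
      ∑ i ∈ Finset.range N, ∑ j ∈ Finset.range N, g i j := by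
  rw [← Finset.sum_product', ← Finset.sum_filter_add_sum_filter_not _ (fun p => p.1 + p.2 < N)
    (fun p : ℕ × ℕ => g p.1 p.2),
    Finset.sum_eq_zero (s := Finset.filter (fun p : ℕ × ℕ => ¬ p.1 + p.2 < N) _), add_zero,
    ← Finset.sum_fiberwise_of_maps_to (t := Finset.range N) (g := fun p : ℕ × ℕ => p.1 + p.2)]
  · refine Finset.sum_congr rfl fun n hn => Finset.sum_congr ?_ fun _ _ => rfl
    ext ⟨i, j⟩
    simp at hn ⊢
    omega
  · intro p hp; simp at hp ⊢; omega
  · intro p hp; simp at hp; exact hg _ _ (by omega)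

section Exponential

variable {A B k : Type*} [CommRing k] [Algebra ℚ k] {wt : A → ℕ}

/-- The inverse of `n!` in a `ℚ`-algebra. -/
noncomputable def invFactorial (k : Type*) [CommRing k] [Algebra ℚ k] (n : ℕ) : k :=
  algebraMap ℚ k ((n.factorial : ℚ)⁻¹)

theorem choose_mul_invFactorial (i j : ℕ) :
    ((i + j).choose i : k) * invFactorial k (i + j) = invFactorial k i * invFactorial k j := by
  rw [invFactorial, invFactorial, invFactorial, ← map_mul, ← map_natCast (algebraMap ℚ k),
    ← map_mul]
  congr 1
  have h : ((i + j).choose i : ℚ) * i.factorial * j.factorial = (i + j).factorial := by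
    rw [Nat.choose_symm_add]
    exact_mod_cast Nat.add_choose_mul_factorial_mul_factorial i j
  have h1 : (i.factorial : ℚ) ≠ 0 := by positivity
  have h2 : (j.factorial : ℚ) ≠ 0 := by positivity
  have h3 : ((i + j).factorial : ℚ) ≠ 0 := by positivity
  field_simp
  linarith

/-- The partial sums of the exponential series of an operator. -/
noncomputable def expSum (T : NCSeries A k →ₗ[k] NCSeries A k) (N : ℕ) (f : NCSeries A k) :
    NCSeries A k := ∑ n ∈ Finset.range N, invFactorial k n • (T ^ n) f

/-- The exponential of an operator that increases the weight. -/
noncomputable def expOp (wt : A → ℕ) (T : NCSeries A k →ₗ[k] NCSeries A k) (f : NCSeries A k) :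
    NCSeries A k := fun w => expSum T (wordWt wt w + 1) f w

theorem expSum_apply (T : NCSeries A k →ₗ[k] NCSeries A k) (N : ℕ) (f : NCSeries A k)
    (w : List A) : expSum T N f w =
      ∑ n ∈ Finset.range N, invFactorial k n * (T ^ n) f w := by
  rw [expSum, sum_apply]; rfl

theorem expOp_apply_of_lt {T : NCSeries A k →ₗ[k] NCSeries A k} (hT : IsRaising wt T)
    (f : NCSeries A k) {N : ℕ} {w : List A} (hN : wordWt wt w < N) :
    expOp wt T f w = expSum T N f w := by
  rw [expOp, expSum_apply, expSum_apply]
  refine Finset.sum_subset (by simpa using hN) fun n _ hn => ?_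
  rw [hT.pow n 0 f (vanishBelow_zero_left f) w (by simp at hn; omega), mul_zero]

theorem vanishBelow_expOp_sub {T : NCSeries A k →ₗ[k] NCSeries A k} (hT : IsRaising wt T)
    (f : NCSeries A k) (N : ℕ) : VanishBelow wt N (expOp wt T f - expSum T N f) := fun w hw => by
  rw [sub_apply, expOp_apply_of_lt hT f hw, sub_self]

/-- At a fixed word of weight `N - 1`, both sides are finite sums of terms `S^i T^j f` and the terms
with `i + j ≥ N` vanish; the rest is the binomial theorem. -/
theorem expOp_add {S T : NCSeries A k →ₗ[k] NCSeries A k} (hS : IsRaising wt S)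
    (hT : IsRaising wt T) (hc : Commute S T) (f : NCSeries A k) :
    expOp wt (S + T) f = expOp wt S (expOp wt T f) := by
  ext w
  set N := wordWt wt w + 1 with hN
  have h1 : expOp wt S (expOp wt T f) w = expSum S N (expSum T N f) w := by
    rw [expOp_apply_of_lt hS _ (show _ < N by omega), expSum_apply, expSum_apply]
    refine Finset.sum_congr rfl fun n _ => ?_
    -- The difference between `expOp wt T f` and its partial sum has weight at least `N`, and powers
    -- of `S` keep it there, so it is invisible at `w`.
    have h := hS.pow n _ _ (vanishBelow_expOp_sub hT f N) w (by omega)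
    rw [map_sub, sub_apply, sub_eq_zero] at h
    rw [h]
  rw [h1, expOp, ← hN, expSum_apply, expSum_apply]
  have h2 : ∀ i, invFactorial k i * (S ^ i) (expSum T N f) w = ∑ j ∈ Finset.range N,
      invFactorial k i * invFactorial k j * (S ^ i) ((T ^ j) f) w := by
    intro i
    rw [expSum, map_sum, sum_apply, Finset.mul_sum]
    refine Finset.sum_congr rfl fun j _ => ?_
    rw [map_smul, smul_apply, mul_assoc]
  rw [Finset.sum_congr rfl fun i _ => h2 i, ← sum_antidiagonal_eq_sum_range]
  · refine Finset.sum_congr rfl fun n _ => ?_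
    rw [hc.add_pow', LinearMap.sum_apply, sum_apply, Finset.mul_sum]
    refine Finset.sum_congr rfl fun p hp => ?_
    rw [Finset.HasAntidiagonal.mem_antidiagonal] at hp
    rw [← choose_mul_invFactorial, hp, LinearMap.smul_apply, Module.End.mul_apply,
      ← Nat.cast_smul_eq_nsmul k, smul_apply]
    ring
  · intro i j hij
    rw [hS.pow i j _ ((hT.pow j 0 f (vanishBelow_zero_left f)).mono (by omega)) w (by omega),
      mul_zero]

/-- At a given word, `M` only sees a partial sum of the exponential of `S`, and maps it term by term
to the same partial sum for `T`. -/
theorem map_expOp {wtB : B → ℕ} {M : NCSeries A k →ₗ[k] NCSeries B k} (hM : IsLocal wt wtB M)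
    {S : NCSeries A k →ₗ[k] NCSeries A k} {T : NCSeries B k →ₗ[k] NCSeries B k}
    (hS : IsRaising wt S) (h : ∀ f, M (S f) = T (M f)) (f : NCSeries A k) :
    M (expOp wt S f) = expOp wtB T (M f) := by
  have hpow : ∀ n, M ((S ^ n) f) = (T ^ n) (M f) := by
    intro n
    induction n with
    | zero => rfl
    | succ n ih => rw [pow_succ', pow_succ', Module.End.mul_apply, h, ih]; rfl
  ext w
  have h1 := hM _ _ (vanishBelow_expOp_sub hS f (wordWt wtB w + 1)) w (Nat.lt_succ_self _)
  rw [map_sub, sub_apply, sub_eq_zero] at h1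
  rw [h1, expOp, expSum, expSum, map_sum]
  simp only [map_smul, hpow]

/-- The first exponential is truncated by length and the second by weight. As letters have positive
weight, the length of a word is at most its weight, and both can be truncated at the weight. -/
theorem exp_mul_eq_expOp {f : NCSeries A k} (hwt : ∀ a, 0 < wt a) (hf : f [] = 0)
    (g : NCSeries A k) : NCSeries.exp f * g = expOp wt (lmulOp f) g := by
  ext w
  have h1 : ∀ (w' : List A) (N : ℕ), w'.length < N →
      NCSeries.exp f w' = ∑ n ∈ Finset.range N, invFactorial k n * (f ^ n) w' := by
    intro w' N hN
    simp only [NCSeries.exp, invFactorial, ← Algebra.smul_def]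
    refine Finset.sum_subset (by simpa using hN) fun n _ hn => ?_
    have := (vanishBelow_one_of_nil (wt := fun _ => 1) (by simp) hf).pow n w'
      (by rw [wordWt_one]; simp at hn; omega)
    rw [this, smul_zero]
  have hlen : ∀ w : List A, w.length ≤ wordWt wt w := by
    intro w
    induction w with
    | nil => simp
    | cons a w ih => have := hwt a; simp; omega
  rw [expOp, expSum_apply, mul_apply]
  simp only [lmulOp_pow]
  simp only [mul_apply (_ ^ _)]
  simp only [Finset.mul_sum]
  rw [Finset.sum_comm]
  refine Finset.sum_congr rfl fun i _ => ?_
  rw [h1 _ (wordWt wt w + 1) (by have := hlen w; simp; omega), Finset.sum_mul]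
  exact Finset.sum_congr rfl fun n _ => mul_assoc _ _ _

end Exponential

/-! ### Coderivations -/

section Coderivation

variable {A k : Type*} [CommRing k]

/-- The operator `T ⊗ 1`. -/
def leftOp (T : NCSeries A k →ₗ[k] NCSeries A k) (F : NCSeries A (NCSeries A k)) :
    NCSeries A (NCSeries A k) := fun u v => T (slice v F) u

/-- The operator `1 ⊗ T`. -/
def rightOp (T : NCSeries A k →ₗ[k] NCSeries A k) (F : NCSeries A (NCSeries A k)) :
    NCSeries A (NCSeries A k) := fun u => T (F u)

variable (T : NCSeries A k →ₗ[k] NCSeries A k)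

theorem leftOp_apply (F : NCSeries A (NCSeries A k)) (u v : List A) :
    leftOp T F u v = T (slice v F) u := rfl

theorem rightOp_apply (F : NCSeries A (NCSeries A k)) (u : List A) :
    rightOp T F u = T (F u) := rfl

theorem leftOp_add (F G : NCSeries A (NCSeries A k)) :
    leftOp T (F + G) = leftOp T F + leftOp T G := by
  ext u v
  have : slice v (F + G) = slice v F + slice v G := rfl
  rw [leftOp_apply, this, map_add]; rfl

theorem rightOp_add (F G : NCSeries A (NCSeries A k)) :
    rightOp T (F + G) = rightOp T F + rightOp T G := by
  ext u v
  rw [rightOp_apply, add_apply, map_add]; rfl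

theorem leftOp_zero : leftOp T 0 = 0 := by
  have := leftOp_add T 0 0
  simpa using this

theorem rightOp_zero : rightOp T 0 = 0 := by
  have := rightOp_add T 0 0
  simpa using this

theorem leftOp_sum {ι : Type*} (s : Finset ι) (F : ι → NCSeries A (NCSeries A k)) :
    leftOp T (∑ i ∈ s, F i) = ∑ i ∈ s, leftOp T (F i) := by
  classical
  induction s using Finset.induction_on with
  | empty => exact leftOp_zero T
  | insert a s ha ih => rw [Finset.sum_insert ha, Finset.sum_insert ha, leftOp_add, ih]

theorem rightOp_sum {ι : Type*} (s : Finset ι) (F : ι → NCSeries A (NCSeries A k)) :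
    rightOp T (∑ i ∈ s, F i) = ∑ i ∈ s, rightOp T (F i) := by
  classical
  induction s using Finset.induction_on with
  | empty => exact rightOp_zero T
  | insert a s ha ih => rw [Finset.sum_insert ha, Finset.sum_insert ha, rightOp_add, ih]

theorem leftOp_tmul (f g : NCSeries A k) : leftOp T (tmul f g) = tmul (T f) g := by
  ext u v
  have : slice v (tmul f g) = g v • f := by ext u; rw [slice_apply, tmul_apply, smul_apply, mul_comm]
  rw [leftOp_apply, this, map_smul, smul_apply, tmul_apply, mul_comm]

theorem rightOp_tmul (f g : NCSeries A k) : rightOp T (tmul f g) = tmul f (T g) := by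
  ext u v
  have : tmul f g u = f u • g := rfl
  rw [rightOp_apply, this, map_smul]; rfl

/-- The Leibniz rule of `T` on multiples of `h` passes to `T ⊗ 1`. It is used with `h` a letter, and
with `h = 1` and `e = 0`. -/
theorem leftOp_tmul_mul {h e : NCSeries A k} (he : ∀ f, T (h * f) = e * f + h * T f)
    (g : NCSeries A k) (F : NCSeries A (NCSeries A k)) :
    leftOp T (tmul h g * F) = tmul e g * F + tmul h g * leftOp T F := by
  ext u v
  have : slice v (tmul h g * F) = ∑ i ∈ Finset.range (v.length + 1),
      g (v.take i) • (h * slice (v.drop i) F) := by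
    ext u
    rw [slice_apply, tmul_mul_apply', sum_apply]; rfl
  rw [leftOp_apply, this, map_sum, sum_apply, add_apply, add_apply, tmul_mul_apply',
    tmul_mul_apply', ← Finset.sum_add_distrib]
  refine Finset.sum_congr rfl fun i _ => ?_
  rw [map_smul, he, smul_apply, add_apply, mul_add]
  rfl

theorem rightOp_tmul_mul {h e : NCSeries A k} (he : ∀ f, T (h * f) = e * f + h * T f)
    (g : NCSeries A k) (F : NCSeries A (NCSeries A k)) :
    rightOp T (tmul g h * F) = tmul g e * F + tmul g h * rightOp T F := by
  ext u v
  rw [rightOp_apply, tmul_mul_apply, map_sum, sum_apply, add_apply, add_apply, tmul_mul_apply,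
    tmul_mul_apply, sum_apply, sum_apply, ← Finset.sum_add_distrib]
  refine Finset.sum_congr rfl fun i _ => ?_
  rw [map_smul, he, smul_add]
  rfl

namespace QuasiShuffle

variable (Q : QuasiShuffle A)

theorem wordWt_words {u v w : List A} (hw : w ∈ Q.words u v) :
    wordWt Q.wt w = wordWt Q.wt u + wordWt Q.wt v := by
  induction hn : u.length + v.length using Nat.strong_induction_on generalizing u v w with
  | _ n ih =>
    cases u with
    | nil => simp [words] at hw; simp [hw]
    | cons a u =>
      cases v with
      | nil => simp [words] at hw; simp [hw]
      | cons b v =>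
        rw [words, List.mem_append, List.mem_append, List.mem_map, List.mem_map] at hw
        rcases hw with (⟨w', hw', rfl⟩ | ⟨w', hw', rfl⟩) | hw
        · have := ih _ (by simp at hn ⊢; omega) hw' rfl
          simp at this ⊢; omega
        · have := ih _ (by simp at hn ⊢; omega) hw' rfl
          simp at this ⊢; omega
        · cases hc : Q.op a b with
          | none => simp [hc] at hw
          | some c =>
            simp only [hc, Option.elim_some, List.mem_map] at hw
            obtain ⟨w', hw', rfl⟩ := hw
            have := ih _ (by simp at hn ⊢; omega) hw' rfl
            have := Q.wt_op hc
            simp; omega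

theorem cop_eq_zero {n : ℕ} {f : NCSeries A k} (hf : VanishBelow Q.wt n f) {u v : List A}
    (h : wordWt Q.wt u + wordWt Q.wt v < n) : Q.cop f u v = 0 := by
  rw [cop, listSum_congr (g := 0), listSum_zero]
  intro w hw
  exact hf w (by rw [Q.wordWt_words hw]; exact h)

theorem cop_one : Q.cop (1 : NCSeries A k) = 1 := by
  have h : ∀ a b, Q.opShift a b (1 : NCSeries A k) = 0 := by
    intro a b; unfold opShift; cases Q.op a b <;> rfl
  ext u v
  cases u with
  | nil => simp
  | cons a u =>
    cases v with
    | nil => simp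
    | cons b v => rw [cop_cons, shift_one, shift_one, h, cop_zero]; simp

/-- A linear operator is a coderivation. -/
def IsCoder : Prop :=
  ∀ f : NCSeries A k, Q.cop (T f) = leftOp T (Q.cop f) + rightOp T (Q.cop f)

theorem cop_finset_sum {ι : Type*} (s : Finset ι) (f : ι → NCSeries A k) :
    Q.cop (∑ i ∈ s, f i) = ∑ i ∈ s, Q.cop (f i) := by
  classical
  induction s using Finset.induction_on with
  | empty => exact Q.cop_zero
  | insert a s ha ih => rw [Finset.sum_insert ha, Finset.sum_insert ha, cop_add, ih]

theorem cop_letter (a : A) : Q.cop (letter a : NCSeries A k) = tmul 1 (letter a) +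
    tmul (letter a) 1 + ∑ p ∈ Q.splits a, tmul (letter p.1) (letter p.2) := by
  classical
  ext u v
  have h := Q.letterCoproduct_prod_apply (k := k) (fun a => tmul 1 (letter a) +
    tmul (letter a) 1 + ∑ p ∈ Q.splits a, tmul (letter p.1) (letter p.2)) (fun _ => rfl) [a] u v
  rw [List.map_singleton, List.prod_singleton] at h
  rw [h, cop, ← finsum_mul_count, finsum_eq_single _ [a]]
  · simp [letter]
  · intro w hw; simp [letter, hw]

variable {T Q}

/-- As the coproduct is multiplicative, the coderivation identity passes from a word `w` to `a w` by
the Leibniz rule; `hc` is the derivative of the formula for the coproduct of a letter. Locality then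
extends the identity from words to series. -/
theorem isCoder_of_letters {e : A → NCSeries A k} (hloc : IsLocal Q.wt Q.wt T)
    (he : ∀ a f, T (letter a * f) = e a * f + letter a * T f)
    (h1 : Q.cop (T 1) = tmul 1 (T 1) + tmul (T 1) 1)
    (hc : ∀ a, Q.cop (e a) = tmul 1 (e a) + tmul (e a) 1 +
      ∑ p ∈ Q.splits a, (tmul (e p.1) (letter p.2) + tmul (letter p.1) (e p.2))) :
    Q.IsCoder T := by
  have hone : ∀ f, T (1 * f) = 0 * f + 1 * T f := by intro f; simp
  have hword : ∀ w : List A, Q.cop (T (word w)) =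
      leftOp T (Q.cop (word w)) + rightOp T (Q.cop (word w)) := by
    intro w
    induction w with
    | nil =>
      have : (word [] : NCSeries A k) = 1 := rfl
      rw [this, h1, cop_one, ← one_tmul_one, leftOp_tmul, rightOp_tmul, add_comm]
    | cons a w ih =>
      rw [word_cons, he, cop_add, cop_mul, cop_mul, cop_mul, ih, cop_letter, hc]
      simp only [add_mul, leftOp_add, rightOp_add, Finset.sum_mul, leftOp_sum, rightOp_sum,
        leftOp_tmul_mul T hone, leftOp_tmul_mul T (he _), rightOp_tmul_mul T hone,
        rightOp_tmul_mul T (he _), Finset.sum_add_distrib, mul_add]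
      have z1 : ∀ f : NCSeries A k, tmul f 0 = 0 := fun f => by ext; simp [tmul_apply]
      have z2 : ∀ f : NCSeries A k, tmul 0 f = 0 := fun f => by ext; simp [tmul_apply]
      simp only [z1, z2, zero_mul, zero_add]
      abel
  intro f
  ext u v
  obtain ⟨r, hr, hf⟩ := exists_truncation (Q.finite_wt (wordWt Q.wt u + wordWt Q.wt v + 1)) f
  have hsm : ∀ (c : k) (w : List A), Q.cop (T (c • word w)) =
      leftOp T (Q.cop (c • word w)) + rightOp T (Q.cop (c • word w)) := by
    intro c w
    ext u v
    have e1 : ∀ v, slice v (Q.cop (c • word w)) = c • slice v (Q.cop (word w : NCSeries A k)) := by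
      intro v; ext u; exact cop_smul_apply _ _ _ _ _
    have e2 : ∀ u, Q.cop (c • word w) u = c • Q.cop (word w : NCSeries A k) u := by
      intro u; ext v; exact cop_smul_apply _ _ _ _ _
    rw [map_smul, cop_smul_apply, hword, add_apply, add_apply, add_apply, add_apply, leftOp_apply,
      leftOp_apply, rightOp_apply, rightOp_apply, e1, e2, map_smul, map_smul, smul_apply,
      smul_apply, mul_add]
  -- The coproduct preserves the weight, so `r` contributes to the slice at `v` only words heavier
  -- than `u`; `T` does not make them lighter.
  have hrL : leftOp T (Q.cop r) u v = 0 := by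
    refine hloc (wordWt Q.wt u + 1) _ (fun u' hu' => ?_) u (Nat.lt_succ_self _)
    exact Q.cop_eq_zero hr (by omega)
  have hrR : rightOp T (Q.cop r) u v = 0 := by
    refine hloc (wordWt Q.wt v + 1) _ (fun u' hu' => ?_) v (Nat.lt_succ_self _)
    exact Q.cop_eq_zero hr (by omega)
  have hr0 : Q.cop (T r) u v = 0 := Q.cop_eq_zero (hloc _ _ hr) (Nat.lt_succ_self _)
  rw [hf, map_add, cop_add, cop_add, leftOp_add, rightOp_add, map_sum, cop_finset_sum,
    cop_finset_sum, leftOp_sum, rightOp_sum, Finset.sum_congr rfl fun w _ => hsm (f w) w,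
    Finset.sum_add_distrib]
  simp only [add_apply, hrL, hrR, hr0]
  ring

/-- For `p = T 1` the cross terms `S 1 ⊗ p + p ⊗ S 1` are unchanged when `S` and `T` are exchanged.
They therefore cancel in a commutator. -/
theorem IsCoder.cop_apply_tmul_primitive {S : NCSeries A k →ₗ[k] NCSeries A k}
    (hS : Q.IsCoder S) {p : NCSeries A k} (hp : Q.cop p = tmul 1 p + tmul p 1) :
    Q.cop (S p) = tmul 1 (S p) + tmul (S p) 1 + tmul (S 1) p + tmul p (S 1) := by
  rw [hS, hp]
  simp only [leftOp_add, rightOp_add, leftOp_tmul, rightOp_tmul]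
  abel

/-- The commutator of two coderivations that map `1` to primitive elements does so too. -/
theorem IsCoder.cop_commutator_one {S : NCSeries A k →ₗ[k] NCSeries A k}
    (hS : Q.IsCoder S) (hT : Q.IsCoder T) (hS1 : Q.cop (S 1) = tmul 1 (S 1) + tmul (S 1) 1)
    (hT1 : Q.cop (T 1) = tmul 1 (T 1) + tmul (T 1) 1) :
    Q.cop (S (T 1) - T (S 1)) =
      tmul 1 (S (T 1) - T (S 1)) + tmul (S (T 1) - T (S 1)) 1 := by
  have h1 : ∀ f g : NCSeries A k, tmul 1 (f - g) = tmul 1 f - tmul 1 g := fun f g => by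
    ext u v; simp [tmul_apply, mul_sub]
  have h2 : ∀ f g : NCSeries A k, tmul (f - g) 1 = tmul f 1 - tmul g 1 := fun f g => by
    ext u v; simp [tmul_apply, sub_mul]
  rw [cop_sub, hS.cop_apply_tmul_primitive hT1, hT.cop_apply_tmul_primitive hS1, h1, h2]
  abel

/-- Binomial formula for `T ⊗ 1 + 1 ⊗ T`, whose two terms commute. -/
theorem IsCoder.cop_pow (hT : Q.IsCoder T) {Φ : NCSeries A k} (hΦ : Q.cop Φ = tmul Φ Φ) (n : ℕ) :
    Q.cop ((T ^ n) Φ) = ∑ p ∈ Finset.HasAntidiagonal.antidiagonal n,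
      n.choose p.1 • tmul ((T ^ p.1) Φ) ((T ^ p.2) Φ) := by
  have hL : ∀ (m : ℕ) (F : NCSeries A (NCSeries A k)), leftOp T (m • F) = m • leftOp T F := by
    intro m F
    induction m with
    | zero => simp [leftOp_zero]
    | succ m ih => rw [succ_nsmul, succ_nsmul, leftOp_add, ih]
  have hR : ∀ (m : ℕ) (F : NCSeries A (NCSeries A k)), rightOp T (m • F) = m • rightOp T F := by
    intro m F
    induction m with
    | zero => simp [rightOp_zero]
    | succ m ih => rw [succ_nsmul, succ_nsmul, rightOp_add, ih]
  induction n with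
  | zero => simpa using hΦ
  | succ n ih =>
    rw [pow_succ', Module.End.mul_apply, hT, ih, leftOp_sum, rightOp_sum,
      Finset.sum_antidiagonal_choose_succ_nsmul
        (fun i j => tmul ((T ^ i) Φ) ((T ^ j) Φ)) n, add_comm]
    simp only [hL, hR, leftOp_tmul, rightOp_tmul, pow_succ', Module.End.mul_apply]
    congr 1
    refine Finset.sum_congr rfl fun p hp => ?_
    rw [Finset.HasAntidiagonal.mem_antidiagonal] at hp
    rw [← hp, Nat.choose_symm_add]

/-- Dividing the binomial formula for `T^n Φ` by `n!` gives the coefficients `1 / (i! j!)` with `i +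
j = n`, that is, the product of two exponentials. All sums are cut at the total weight of the two
words. -/
theorem IsCoder.cop_expOp [Algebra ℚ k] (hT : Q.IsCoder T) (hr : IsRaising Q.wt T)
    {Φ : NCSeries A k} (hΦ : Q.cop Φ = tmul Φ Φ) :
    Q.cop (expOp Q.wt T Φ) = tmul (expOp Q.wt T Φ) (expOp Q.wt T Φ) := by
  ext u v
  set N := wordWt Q.wt u + wordWt Q.wt v + 1 with hN
  have h0 := Q.cop_eq_zero (vanishBelow_expOp_sub hr Φ N) (u := u) (v := v) (by omega)
  rw [cop_sub, sub_apply, sub_apply, sub_eq_zero] at h0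
  have hns : ∀ (m : ℕ) (F : NCSeries A (NCSeries A k)), (m • F) u v = m * F u v := by
    intro m F
    induction m with
    | zero => simp
    | succ m ih => rw [succ_nsmul, add_apply, add_apply, ih]; push_cast; ring
  rw [h0, expSum, cop_finset_sum, sum_apply, sum_apply, tmul_apply,
    expOp_apply_of_lt hr Φ (show _ < N by omega), expOp_apply_of_lt hr Φ (show _ < N by omega),
    expSum_apply, expSum_apply, Finset.sum_mul_sum, ← sum_antidiagonal_eq_sum_range]
  · refine Finset.sum_congr rfl fun n _ => ?_
    rw [cop_smul_apply, hT.cop_pow hΦ, sum_apply, sum_apply, Finset.mul_sum]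
    refine Finset.sum_congr rfl fun p hp => ?_
    rw [Finset.HasAntidiagonal.mem_antidiagonal] at hp
    rw [hns, tmul_apply]
    have := choose_mul_invFactorial (k := k) p.1 p.2
    rw [hp] at this
    linear_combination (T ^ p.1) Φ u * (T ^ p.2) Φ v * this
  · intro i j hij
    by_cases h : wordWt Q.wt u < i
    · rw [hr.pow i 0 Φ (vanishBelow_zero_left Φ) u (by omega)]; ring
    · rw [hr.pow j 0 Φ (vanishBelow_zero_left Φ) v (by omega)]; ring

end QuasiShuffle
end Coderivation
end NCSeries

/-! ### The shuffle and the stuffle alphabets -/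

namespace NCSeries

/-- The shuffle coproduct, for which the letters are primitive. -/
def shuffle (A : Type*) [Finite A] : QuasiShuffle A where
  op _ _ := none
  splits _ := ∅
  mem_splits := by simp
  wt _ := 1
  wt_op := by simp
  finite_wt n := by simpa using List.finite_length_lt A n

theorem finite_stuffle_wt (Γ : Type*) [Finite Γ] (n : ℕ) :
    {w : List (YLetter Γ) | (w.map fun y => (y.1 : ℕ)).sum < n}.Finite := by
  have hfin : ∀ n : ℕ, {y : YLetter Γ | (y.1 : ℕ) < n}.Finite := by
    intro n
    have h : {m : ℕ+ | (m : ℕ) < n}.Finite :=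
      (Set.finite_Iio n).preimage PNat.coe_injective.injOn
    exact (h.prod (Set.finite_univ (α := Γ))).subset fun y hy => ⟨hy, trivial⟩
  induction n with
  | zero => simp
  | succ n ih =>
    refine ((Set.finite_singleton []).union ((hfin (n + 1)).image2 List.cons ih)).subset ?_
    intro w hw
    cases w with
    | nil => exact Or.inl rfl
    | cons a w =>
      have := a.1.pos
      simp only [Set.mem_ofPred_eq, List.map_cons, List.sum_cons] at hw
      refine Or.inr ⟨a, ?_, w, ?_, rfl⟩ <;> simp only [Set.mem_ofPred_eq] <;> omega

open Classical in
/-- The stuffle coproduct `Δ_*`. -/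
noncomputable def stuffle (Γ : Type*) [CommGroup Γ] [Fintype Γ] : QuasiShuffle (YLetter Γ) where
  op a b := some (a.1 + b.1, a.2 * b.2)
  -- The first factor has index `i + 1` with `i < n - 1`, where `n` is the index of `a`, so that
  -- both factors have positive index. The element of `Γ` in the first factor is free and determines
  -- that in the second.
  splits a := (Finset.range ((a.1 : ℕ) - 1) ×ˢ (Finset.univ : Finset Γ)).image fun p =>
    ((p.1.succPNat, p.2), (((a.1 : ℕ) - (p.1 + 1)).toPNat', p.2⁻¹ * a.2))
  mem_splits := by
    rintro ⟨m, ν⟩ ⟨⟨i, κ⟩, ⟨j, l⟩⟩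
    simp only [Finset.mem_image, Finset.mem_product, Finset.mem_range, Finset.mem_univ, and_true,
      Prod.exists, Prod.mk.injEq, Option.some.injEq]
    constructor
    · rintro ⟨x, y, hx, ⟨rfl, rfl⟩, rfl, rfl⟩
      refine ⟨PNat.eq ?_, by simp⟩
      rw [PNat.add_coe, Nat.succPNat_coe, Nat.toPNat'_coe, if_pos (by omega)]
      omega
    · rintro ⟨rfl, rfl⟩
      have hi := i.pos
      have hj := j.pos
      refine ⟨(i : ℕ) - 1, κ, ?_, ⟨PNat.eq ?_, rfl⟩, PNat.eq ?_, by simp⟩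
      · rw [PNat.add_coe]; omega
      · rw [Nat.succPNat_coe]; omega
      · rw [PNat.add_coe, Nat.toPNat'_coe, if_pos (by omega)]; omega
  wt a := a.1
  wt_op := by
    intro a b c h
    simp only [Option.some.injEq] at h
    rw [← h]; rfl
  finite_wt n := finite_stuffle_wt Γ n

variable {Γ k : Type*} [CommGroup Γ] [Fintype Γ] [CommRing k]

theorem coprodX_eq_cop (f : NCSeries (XLetter Γ) k) : coprodX f = (shuffle (XLetter Γ)).cop f :=
  QuasiShuffle.coprod_eq_cop _ _ (fun a => by simp [shuffle]) f

/-- In the sum over `i + j = n`, the convention for `y_{0,ν}` leaves `1 ⊗ y_{n,ν}` from `i = 0` and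
`y_{n,ν} ⊗ 1` from `j = 0`; the other terms are the splittings into two letters. -/
theorem coprodY_eq_cop (f : NCSeries (YLetter Γ) k) : coprodY f = (stuffle Γ).cop f := by
  classical
  refine QuasiShuffle.coprod_eq_cop _ _ (fun a => ?_) f
  obtain ⟨m, ν⟩ := a
  obtain ⟨n, hn⟩ : ∃ n, (m : ℕ) = n + 1 := ⟨(m : ℕ) - 1, by have := m.pos; omega⟩
  have hy : ∀ (i : ℕ) (hi : 0 < i) (κ : Γ),
      (yLetter i κ : NCSeries (YLetter Γ) k) = letter (⟨i, hi⟩, κ) := by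
    intro i hi κ; rw [yLetter, dif_pos hi]
  have hy0 : ∀ κ : Γ, (yLetter 0 κ : NCSeries (YLetter Γ) k) = if κ = 1 then 1 else 0 := by
    intro κ; rw [yLetter, dif_neg (lt_irrefl 0)]
  have z1 : ∀ f : NCSeries (YLetter Γ) k, tmul f 0 = 0 := fun f => by ext; simp [tmul_apply]
  have z2 : ∀ f : NCSeries (YLetter Γ) k, tmul 0 f = 0 := fun f => by ext; simp [tmul_apply]
  have hsplit : ∑ p ∈ (stuffle Γ).splits (m, ν), tmul (letter p.1) (letter p.2) =
      ∑ i ∈ Finset.range n, ∑ κ : Γ, tmul (yLetter (i + 1) κ)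
        (yLetter (m - (i + 1)) (κ⁻¹ * ν) : NCSeries (YLetter Γ) k) := by
    simp only [stuffle]
    rw [Finset.sum_image, Finset.sum_product]
    · rw [hn]
      refine Finset.sum_congr rfl fun i hi => Finset.sum_congr rfl fun κ _ => ?_
      rw [Finset.mem_range] at hi
      rw [hy (i + 1) (Nat.succ_pos _), hy (n + 1 - (i + 1)) (by omega)]
      have : (n + 1 - (i + 1)).toPNat' = ⟨n + 1 - (i + 1), by omega⟩ :=
        PNat.eq (by rw [Nat.toPNat'_coe, if_pos (by omega)]; rfl)
      rw [this]; rfl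
    · rintro ⟨i, κ⟩ _ ⟨j, l⟩ _ h
      simp only [Prod.mk.injEq] at h
      obtain ⟨⟨h1, rfl⟩, -⟩ := h
      rw [Nat.succPNat_injective h1]
  have e0 : ∑ κ : Γ, tmul (yLetter 0 κ) (yLetter (m : ℕ) (κ⁻¹ * ν)) =
      tmul 1 (letter (m, ν) : NCSeries (YLetter Γ) k) := by
    rw [Fintype.sum_eq_single 1]
    · rw [hy0, if_pos rfl, hy _ m.pos, inv_one, one_mul]; rfl
    · intro κ hκ; rw [hy0, if_neg hκ, z2]
  have e1 : ∑ κ : Γ, tmul (yLetter (m : ℕ) κ) (yLetter 0 (κ⁻¹ * ν)) =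
      tmul (letter (m, ν) : NCSeries (YLetter Γ) k) 1 := by
    rw [Fintype.sum_eq_single ν]
    · rw [hy0, if_pos (by simp), hy _ m.pos]; rfl
    · intro κ hκ
      rw [hy0, if_neg (by rw [inv_mul_eq_one]; exact hκ), z1]
  rw [hsplit, Finset.Nat.sum_antidiagonal_eq_sum_range_succ
    (f := fun i j => ∑ κ : Γ, tmul (yLetter i κ) (yLetter j (κ⁻¹ * ν))), Finset.sum_range_succ,
    Nat.sub_self, e1, hn, Finset.sum_range_succ', ← hn, Nat.sub_zero, e0]
  abel

end NCSeries

/-! ### The operators `s_ψ` -/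

namespace NCSeries

/-! ### Effect of derivations on weights -/

section DerivationBounds

variable {A k : Type*} [CommRing k] [Fintype A] {wt : A → ℕ}

theorem der_letter (δ : A → NCSeries A k) (a : A) : der δ (letter a) = δ a := by
  classical
  have h0 : der δ (0 : NCSeries A k) = 0 := by simpa using der_smul δ 0 0
  have h1 : der δ (1 : NCSeries A k) = 0 := by
    have := der_mul δ 1 1
    simpa using this
  have hs : ∑ b, δ b * shift b (letter a : NCSeries A k) = δ a := by
    simp [shift_letter]
  ext w
  cases w with
  | nil => rw [der_nil, hs]
  | cons b w =>
    have : der δ (shift b (letter a)) = 0 := by rw [shift_letter]; split_ifs <;> assumption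
    rw [der_cons, hs, this, zero_apply, add_zero]

theorem VanishBelow.shift {n : ℕ} {f : NCSeries A k} (hf : VanishBelow wt n f) (a : A) :
    VanishBelow wt (n - wt a) (shift a f) := fun w hw =>
  hf (a :: w) (by rw [wordWt_cons]; omega)

theorem VanishBelow.der {m n : ℕ} {δ : A → NCSeries A k}
    (hδ : ∀ a, VanishBelow wt (wt a + m) (δ a)) {f : NCSeries A k} (hf : VanishBelow wt n f) :
    VanishBelow wt (n + m) (der δ f) := by
  have key : ∀ {n : ℕ} {f : NCSeries A k}, VanishBelow wt n f →
      VanishBelow wt (n + m) (∑ a, δ a * NCSeries.shift a f) := fun hf =>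
    VanishBelow.sum fun a _ => ((hδ a).mul (hf.shift a)).mono (by omega)
  intro w
  induction w generalizing n f with
  | nil => intro hw; rw [der_nil]; exact key hf _ hw
  | cons b w ih =>
    intro hw
    rw [der_cons, key hf _ hw, zero_add]
    rw [wordWt_cons] at hw
    exact ih (hf.shift b) (by omega)

/-- Each term of `der δ f` contains one of the values `δ a`, whose weight is thus a lower bound
whatever `f` is. This is meant for the depth, where the letter `x_0` has weight zero. -/
theorem vanishBelow_der {m : ℕ} {δ : A → NCSeries A k} (hδ : ∀ a, VanishBelow wt m (δ a))
    (f : NCSeries A k) : VanishBelow wt m (NCSeries.der δ f) := by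
  have key : ∀ f : NCSeries A k, VanishBelow wt m (∑ a, δ a * NCSeries.shift a f) := fun f =>
    VanishBelow.sum fun a _ => (hδ a).mul (vanishBelow_zero_left _)
  intro w
  induction w generalizing f with
  | nil => intro hw; rw [der_nil]; exact key f _ hw
  | cons b w ih =>
    intro hw
    rw [der_cons, key f _ hw, zero_add]
    rw [wordWt_cons] at hw
    exact ih _ (by omega)

end DerivationBounds

/-! ### The operators `s_ψ` on series in `X` -/

section Operators

variable {Γ k : Type*} [CommGroup Γ] [CommRing k]

/-- The weight that counts the letters other than `x_0`. -/
def depthWt : XLetter Γ → ℕ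
  | none => 0
  | some _ => 1

theorem vanishBelow_letter {A : Type*} {wt : A → ℕ} (a : A) :
    VanishBelow wt (wt a) (letter a : NCSeries A k) := fun w hw => by
  classical
  unfold letter
  rw [if_neg]
  rintro rfl
  simp at hw

theorem VanishBelow.tSubst {wt : XLetter Γ → ℕ} (hwt : ∀ σ τ : Γ, wt (some σ) = wt (some τ))
    {n : ℕ} {f : NCSeries (XLetter Γ) k} (hf : VanishBelow wt n f) (σ : Γ) :
    VanishBelow wt n (tSubst σ f) := fun w hw => by
  refine hf _ (lt_of_eq_of_lt ?_ hw)
  clear hw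
  induction w with
  | nil => rfl
  | cons a w ih =>
    rw [List.map_cons, wordWt_cons, wordWt_cons, ih]
    cases a with
    | none => rfl
    | some τ => rw [Option.map_some, hwt _ τ]

theorem vanishBelow_dLetter {wt : XLetter Γ → ℕ} (hwt : ∀ σ τ : Γ, wt (some σ) = wt (some τ))
    {n : ℕ} {ψ : NCSeries (XLetter Γ) k} (hψ : VanishBelow wt n ψ) (a : XLetter Γ) :
    VanishBelow wt (wt a + n) (dLetter ψ a) := by
  cases a with
  | none => exact vanishBelow_zero _
  | some σ =>
    exact ((vanishBelow_letter _).mul (hψ.tSubst hwt σ)).sub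
      (((hψ.tSubst hwt σ).mul (vanishBelow_letter _)).mono (by omega))

variable [Fintype Γ]

/-- The operator `s_ψ`, as a linear map. -/
noncomputable def sLin (ψ : NCSeries (XLetter Γ) k) :
    NCSeries (XLetter Γ) k →ₗ[k] NCSeries (XLetter Γ) k where
  toFun := sOp ψ
  map_add' := sOp_add ψ
  map_smul' c f := sOp_smul c ψ f

@[simp] theorem sLin_apply (ψ f : NCSeries (XLetter Γ) k) : sLin ψ f = sOp ψ f := rfl

theorem sLin_isRaising {ψ : NCSeries (XLetter Γ) k} (hψ : ψ [] = 0) :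
    IsRaising (fun _ => 1) (sLin ψ) := fun n f hf => by
  have h := vanishBelow_one_of_nil (wt := fun _ => 1) (by simp) hψ
  exact ((h.mul hf).mono (by omega)).add
    (VanishBelow.der (fun a => vanishBelow_dLetter (fun _ _ => rfl) h a) hf)

theorem expS_eq_expOp [Algebra ℚ k] (ψ f : NCSeries (XLetter Γ) k) :
    expS ψ f = expOp (fun _ => 1) (sLin ψ) f := by
  ext w
  rw [expOp, expSum_apply, wordWt_one]
  refine Finset.sum_congr rfl fun n _ => ?_
  rw [Algebra.smul_def, Module.End.pow_apply]
  rfl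

theorem dOp_mul (ψ f g : NCSeries (XLetter Γ) k) :
    dOp ψ (f * g) = dOp ψ f * g + f * dOp ψ g := der_mul _ f g

theorem dOp_letter (ψ : NCSeries (XLetter Γ) k) (a : XLetter Γ) :
    dOp ψ (letter a) = dLetter ψ a := der_letter _ a

/-- Moving `ψ` past the letter costs a commutator, and `d_ψ` is a derivation. This is the Leibniz
form required by `isCoder_of_letters`. -/
theorem sOp_letter_mul (ψ f : NCSeries (XLetter Γ) k) (a : XLetter Γ) :
    sOp ψ (letter a * f) = (ψ * letter a - letter a * ψ + dLetter ψ a) * f +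
      letter a * sOp ψ f := by
  rw [sOp, dOp_mul, dOp_letter, sOp]
  noncomm_ring

theorem sOp_one (ψ : NCSeries (XLetter Γ) k) : sOp ψ 1 = ψ := by
  have : dOp ψ (1 : NCSeries (XLetter Γ) k) = 0 := by
    have := dOp_mul ψ 1 1
    simpa using this
  rw [sOp, this, mul_one, add_zero]

theorem cop_tSubst (σ : Γ) (f : NCSeries (XLetter Γ) k) (u v : List (XLetter Γ)) :
    (shuffle (XLetter Γ)).cop (tSubst σ f) u v = (shuffle (XLetter Γ)).cop f
      (u.map (Option.map (σ⁻¹ * ·))) (v.map (Option.map (σ⁻¹ * ·))) := by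
  have hs : ∀ a (f : NCSeries (XLetter Γ) k),
      shift a (tSubst σ f) = tSubst σ (shift (a.map (σ⁻¹ * ·)) f) := fun _ _ => rfl
  have ho : ∀ a b (f : NCSeries (XLetter Γ) k), (shuffle (XLetter Γ)).opShift a b f = 0 :=
    fun _ _ _ => rfl
  induction hn : u.length + v.length using Nat.strong_induction_on generalizing f u v with
  | _ n ih =>
    cases u with
    | nil => rw [List.map_nil, QuasiShuffle.cop_nil_left, QuasiShuffle.cop_nil_left]; rfl
    | cons a u =>
      cases v with
      | nil => rw [List.map_nil, QuasiShuffle.cop_nil_right, QuasiShuffle.cop_nil_right]; rfl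
      | cons b v =>
        rw [QuasiShuffle.cop_cons, hs, hs, ih _ (by simp at hn ⊢; omega) _ _ _ rfl,
          ih _ (by simp at hn ⊢; omega) _ _ _ rfl, List.map_cons, List.map_cons,
          QuasiShuffle.cop_cons, ho, ho, QuasiShuffle.cop_zero]
        rfl

end Operators

/-! ### Primitive series -/

namespace QuasiShuffle

variable {A k : Type*} [CommRing k] (Q : QuasiShuffle A)

/-- `f` is primitive for the coproduct. -/
def IsPrimitive (f : NCSeries A k) : Prop := Q.cop f = tmul 1 f + tmul f 1

variable {Q}

theorem IsPrimitive.apply_nil {f : NCSeries A k} (hf : Q.IsPrimitive f) : f [] = 0 := by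
  have h := congrFun (congrFun hf []) []
  rw [cop_nil_left] at h
  change f [] = 1 * f [] + f [] * 1 at h
  linear_combination -h

theorem IsPrimitive.cop_apply {f : NCSeries A k} (hf : Q.IsPrimitive f) {u v : List A}
    (hu : u ≠ []) (hv : v ≠ []) : Q.cop f u v = 0 := by
  obtain ⟨a, u, rfl⟩ := List.exists_cons_of_ne_nil hu
  obtain ⟨b, v, rfl⟩ := List.exists_cons_of_ne_nil hv
  rw [hf, add_apply, add_apply, tmul_apply, tmul_apply, one_cons, one_cons, zero_mul, mul_zero,
    add_zero]

theorem isPrimitive_of_cop_apply {f : NCSeries A k} (h0 : f [] = 0)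
    (h : ∀ u v, u ≠ [] → v ≠ [] → Q.cop f u v = 0) : Q.IsPrimitive f := by
  ext u v
  rw [add_apply, add_apply, tmul_apply, tmul_apply]
  cases u with
  | nil => rw [cop_nil_left, h0, one_nil]; ring
  | cons a u =>
    cases v with
    | nil => rw [cop_nil_right, h0, one_nil]; ring
    | cons b v => rw [h _ _ (by simp) (by simp), one_cons, one_cons]; ring

theorem IsPrimitive.add {f g : NCSeries A k} (hf : Q.IsPrimitive f) (hg : Q.IsPrimitive g) :
    Q.IsPrimitive (f + g) := by
  rw [IsPrimitive, cop_add, hf, hg, tmul_add, add_tmul]; abel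

theorem IsPrimitive.smul {f : NCSeries A k} (hf : Q.IsPrimitive f) (c : k) :
    Q.IsPrimitive (c • f) := by
  refine isPrimitive_of_cop_apply ?_ fun u v hu hv => ?_
  · rw [smul_apply, hf.apply_nil, mul_zero]
  · rw [cop_smul_apply, hf.cop_apply hu hv, mul_zero]

theorem IsPrimitive.commutator {f g : NCSeries A k} (hf : Q.IsPrimitive f)
    (hg : Q.IsPrimitive g) : Q.IsPrimitive (f * g - g * f) := by
  have h1 : ∀ f g : NCSeries A k, tmul 1 (f - g) = tmul 1 f - tmul 1 g := fun f g => by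
    ext u v; simp [tmul_apply, mul_sub]
  have h2 : ∀ f g : NCSeries A k, tmul (f - g) 1 = tmul f 1 - tmul g 1 := fun f g => by
    ext u v; simp [tmul_apply, sub_mul]
  rw [IsPrimitive, cop_sub, cop_mul, cop_mul, hf, hg, h1, h2]
  simp only [add_mul, mul_add, tmul_mul_tmul, one_mul, mul_one]
  abel

end QuasiShuffle

/-! ### The shuffle side: coderivations and the antipode -/

section ShufflePrimitive

open QuasiShuffle

variable {Γ k : Type*} [CommGroup Γ] [Fintype Γ] [CommRing k]

theorem isPrimitive_letter {A : Type*} [Finite A] (a : A) :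
    (shuffle A).IsPrimitive (letter a : NCSeries A k) := by
  rw [IsPrimitive, cop_letter]; simp [shuffle]

theorem isPrimitive_tSubst {ψ : NCSeries (XLetter Γ) k}
    (hψ : (shuffle (XLetter Γ)).IsPrimitive ψ) (σ : Γ) :
    (shuffle (XLetter Γ)).IsPrimitive (tSubst σ ψ) := by
  refine isPrimitive_of_cop_apply hψ.apply_nil fun u v hu hv => ?_
  rw [cop_tSubst, hψ.cop_apply (by simpa using hu) (by simpa using hv)]

/-- The value of `s_ψ` attached to a letter `x_σ` is `[ψ, x_σ] + [x_σ, t_σ(ψ)]`, and to `x_0` it is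
`[ψ, x_0]`; commutators of primitive series are primitive, and in the shuffle case letters have no
splittings. -/
theorem sLin_isCoder {ψ : NCSeries (XLetter Γ) k} (hψ : (shuffle (XLetter Γ)).IsPrimitive ψ) :
    (shuffle (XLetter Γ)).IsCoder (sLin ψ) := by
  refine isCoder_of_letters (sLin_isRaising hψ.apply_nil).isLocal
    (fun a f => sOp_letter_mul ψ f a) ?_ fun a => ?_
  · rw [sLin_apply, sOp_one]; exact hψ
  · have h1 := hψ.commutator (isPrimitive_letter (k := k) a)
    have h2 : (shuffle (XLetter Γ)).IsPrimitive
        (ψ * letter a - letter a * ψ + dLetter ψ a) := by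
      cases a with
      | none => simpa [dLetter] using h1
      | some σ => exact h1.add ((isPrimitive_letter _).commutator (isPrimitive_tSubst hψ σ))
    have h3 : (shuffle (XLetter Γ)).splits a = ∅ := rfl
    rw [h2, h3, Finset.sum_empty, add_zero]

/-- The antipode changes the sign of primitive elements. -/
theorem apply_reverse_of_isPrimitive {A : Type*} [Finite A] {f : NCSeries A k}
    (hf : (shuffle A).IsPrimitive f) (w : List A) :
    f w = -((-1) ^ w.length * f w.reverse) := by
  -- The coproduct of a primitive series vanishes at `(a u, b v)`, so the two ways of choosing the
  -- first letter are opposite. Each letter of `v` is thus moved in front of `a u` at the cost of a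
  -- sign, which reverses `v`.
  have key : ∀ (v u : List A) (a : A),
      (shuffle A).cop (shift a f) u v = (-1) ^ v.length * f (v.reverse ++ a :: u) := by
    intro v
    induction v with
    | nil => intro u a; simp
    | cons b v ih =>
      intro u a
      have h := hf.cop_apply (u := a :: u) (v := b :: v) (by simp) (by simp)
      have ho : (shuffle A).opShift a b f = 0 := rfl
      rw [cop_cons, ho, cop_zero, ih] at h
      change _ + _ + (0 : k) = 0 at h
      rw [List.length_cons, List.reverse_cons, List.append_assoc, pow_succ]
      change _ = _ * f (v.reverse ++ b :: a :: u)
      linear_combination h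
  cases w with
  | nil => rw [hf.apply_nil, List.reverse_nil, hf.apply_nil]; simp
  | cons a w =>
    have h := key w [] a
    rw [cop_nil_left, shift_apply] at h
    rw [h, List.reverse_cons, List.length_cons, pow_succ]
    ring

theorem cop_replicate {A : Type*} [Finite A] (f : NCSeries A k) (a : A) (n : ℕ) :
    (shuffle A).cop f [a] (List.replicate n a) = (n + 1) * f (List.replicate (n + 1) a) := by
  induction n generalizing f with
  | zero => rw [List.replicate_zero, cop_nil_right]; simp
  | succ n ih =>
    have ho : (shuffle A).opShift a a f = 0 := rfl
    rw [List.replicate_succ, cop_cons, ih, ho, cop_zero, cop_nil_left, shift_apply, shift_apply,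
      ← List.replicate_succ, ← List.replicate_succ]
    push_cast
    change _ + _ + (0 : k) = _
    ring

end ShufflePrimitive

/-! ### Low depth -/

section LowDepth

variable {Γ k : Type*} [CommGroup Γ] [CommRing k] [Algebra ℚ k]

theorem natCast_succ_mul_cancel {x : k} {n : ℕ} (h : ((n : k) + 1) * x = 0) : x = 0 := by
  have h1 : ((n : ℚ) + 1)⁻¹ * (n + 1) = 1 := inv_mul_cancel₀ (by positivity)
  have h2 : algebraMap ℚ k ((n : ℚ) + 1)⁻¹ * ((n : k) + 1) = 1 := by
    have := congrArg (algebraMap ℚ k) h1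
    simpa using this
  linear_combination algebraMap ℚ k ((n : ℚ) + 1)⁻¹ * h - x * h2

theorem eq_replicate_of_depth {w : List (XLetter Γ)} (hw : wordWt depthWt w < 1) :
    w = List.replicate w.length none := by
  induction w with
  | nil => rfl
  | cons a w ih =>
    cases a with
    | none =>
      rw [List.length_cons, List.replicate_succ, ← ih (by simpa [depthWt] using hw)]
    | some σ => simp [depthWt] at hw

variable [Fintype Γ]

/-- The words of depth zero are the powers of `x_0`. Shuffling `x_0` with `x_0^n` gives `(n + 1)
x_0^{n+1}`, so primitivity kills the coefficients of the powers beyond the first, `n + 1` being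
invertible. -/
theorem vanishBelow_depth_of_isPrimitive {ψ : NCSeries (XLetter Γ) k}
    (hψ : (shuffle (XLetter Γ)).IsPrimitive ψ) (h0 : ψ [none] = 0) :
    VanishBelow depthWt 1 ψ := fun w hw => by
  rw [eq_replicate_of_depth hw]
  rcases w.length with _ | _ | n
  · exact hψ.apply_nil
  · exact h0
  · refine natCast_succ_mul_cancel (n := n + 1) ?_
    have := cop_replicate ψ none (n + 1)
    rw [← Nat.cast_succ, Nat.cast_succ, ← this]
    exact hψ.cop_apply (by simp) (by simp)

variable {ψ : NCSeries (XLetter Γ) k}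

/-- `d_ψ` kills `x_0`, and replaces one `x_σ` by its bracket with a series of depth at least one.
Hence only the product `ψ v` matters for `s_ψ(v)` in depth one. -/
theorem vanishBelow_dOp (hψ : VanishBelow depthWt 1 ψ) (f : NCSeries (XLetter Γ) k) :
    VanishBelow depthWt 2 (dOp ψ f) := by
  refine vanishBelow_der (fun a => ?_) f
  cases a with
  | none => exact vanishBelow_zero _
  | some σ => exact vanishBelow_dLetter (fun _ _ => rfl) hψ (some σ)

theorem vanishBelow_sOp (hψ : VanishBelow depthWt 1 ψ) (f : NCSeries (XLetter Γ) k) :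
    VanishBelow depthWt 1 (sOp ψ f) :=
  (hψ.mul (vanishBelow_zero_left f)).add ((vanishBelow_dOp hψ f).mono one_le_two)

/-- In the product `ψ f`, the factor `ψ` has to use the only letter other than `x_0`, which is the
last one; `f` then contributes its constant term. -/
theorem sOp_apply_depth_one (hψ : VanishBelow depthWt 1 ψ) (f : NCSeries (XLetter Γ) k)
    {w : List (XLetter Γ)} (hw : wordWt depthWt w < 1) (σ : Γ) :
    sOp ψ f (w ++ [some σ]) = ψ (w ++ [some σ]) * f [] := by
  rw [sOp, add_apply, lastShift_mul_apply, (hψ.mul (vanishBelow_zero_left _)) w (by omega),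
    zero_add, vanishBelow_dOp hψ f, add_zero]
  rw [wordWt_append, wordWt_cons, wordWt_nil]
  simp only [depthWt]
  omega

/-- Only the terms `n = 0` and `n = 1` of the exponential contribute: after one application of `s_ψ`
the constant term is zero, hence the next applications give nothing in depth one. -/
theorem expS_apply_depth_one (hψ : VanishBelow depthWt 1 ψ) {Φ : NCSeries (XLetter Γ) k}
    (hΦ : Φ [] = 1) {w : List (XLetter Γ)} (hw : wordWt depthWt w < 1) (σ : Γ) :
    expS ψ Φ (w ++ [some σ]) = Φ (w ++ [some σ]) + ψ (w ++ [some σ]) := by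
  have hψ0 : ψ [] = 0 := hψ [] (by simp)
  have hlen : (w ++ [some σ]).length = w.length + 1 := by simp
  rw [expS, hlen, Finset.sum_range_succ', Finset.sum_range_succ', Finset.sum_eq_zero]
  · rw [Function.iterate_succ_apply', Function.iterate_zero, id, sOp_apply_depth_one hψ _ hw, hΦ]
    simp [add_comm]
  · intro n _
    rw [Function.iterate_succ_apply', Function.iterate_succ_apply', sOp_apply_depth_one hψ _ hw,
      sOp_nil _ _ hψ0, mul_zero, smul_zero]

theorem expS_apply_depth_zero (hψ : VanishBelow depthWt 1 ψ) (Φ : NCSeries (XLetter Γ) k)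
    {w : List (XLetter Γ)} (hw : wordWt depthWt w < 1) : expS ψ Φ w = Φ w := by
  rw [expS, Finset.sum_range_succ', Finset.sum_eq_zero]
  · simp
  · intro n _
    rw [Function.iterate_succ_apply', vanishBelow_sOp hψ _ w hw, smul_zero]

end LowDepth
end NCSeries

/-! ### Coderivations from pairs of sequences of primitive series -/

namespace NCSeries

open QuasiShuffle

theorem one_apply_of_ne_nil {A R : Type*} [Ring R] {w : List A} (hw : w ≠ []) :
    (1 : NCSeries A R) w = 0 := by
  cases w with
  | nil => exact absurd rfl hw
  | cons a w => rfl

/-! ### Primitivity for the stuffle: degree, antiautomorphism, derivation and pairs of sequences -/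

section Stuffle

variable {Γ k : Type*} [CommGroup Γ] [CommRing k]

/-- The product of the elements of `Γ` that occur in a word. -/
def deg (u : List (YLetter Γ)) : Γ := (u.map Prod.snd).prod

@[simp] theorem deg_nil : deg ([] : List (YLetter Γ)) = 1 := rfl

@[simp] theorem deg_cons (a : YLetter Γ) (u : List (YLetter Γ)) : deg (a :: u) = a.2 * deg u :=
  List.prod_cons

@[simp] theorem deg_append (u v : List (YLetter Γ)) : deg (u ++ v) = deg u * deg v := by
  simp [deg]

open Classical in
/-- The part of a series that is supported on the words of degree `g`. -/
noncomputable def degPart (g : Γ) (f : NCSeries (YLetter Γ) k) : NCSeries (YLetter Γ) k :=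
  fun u => if deg u = g then f u else 0

open Classical in
theorem degPart_apply (g : Γ) (f : NCSeries (YLetter Γ) k) (u : List (YLetter Γ)) :
    degPart g f u = if deg u = g then f u else 0 := rfl

/-- The derivation `y_{n,ν} ↦ (n - 1) y_{n-1,ν}`. -/
def stepDer : NCSeries (YLetter Γ) k → NCSeries (YLetter Γ) k
  | _, [] => 0
  | f, a :: u => ((a.1 : ℕ) : k) * f ((a.1 + 1, a.2) :: u) + stepDer (shift a f) u

@[simp] theorem stepDer_nil (f : NCSeries (YLetter Γ) k) : stepDer f [] = 0 := by rw [stepDer]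

theorem stepDer_cons (f : NCSeries (YLetter Γ) k) (a : YLetter Γ) (u : List (YLetter Γ)) :
    stepDer f (a :: u) =
      ((a.1 : ℕ) : k) * f ((a.1 + 1, a.2) :: u) + stepDer (shift a f) u := by
  rw [stepDer]

theorem shift_stepDer (f : NCSeries (YLetter Γ) k) (a : YLetter Γ) :
    shift a (stepDer f) =
      ((a.1 : ℕ) : k) • shift (a.1 + 1, a.2) f + stepDer (shift a f) := by
  ext u; exact stepDer_cons f a u

theorem stepDer_add (f g : NCSeries (YLetter Γ) k) :
    stepDer (f + g) = stepDer f + stepDer g := by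
  ext u
  induction u generalizing f g with
  | nil => simp
  | cons a u ih => simp only [stepDer_cons, add_apply, shift_add, ih]; ring

theorem stepDer_eq_zero {f : NCSeries (YLetter Γ) k}
    (hf : ∀ u v (n : ℕ+) (ν : Γ), f (u ++ (n + 1, ν) :: v) = 0) : stepDer f = 0 := by
  ext u
  induction u generalizing f with
  | nil => simp
  | cons a u ih =>
    rw [stepDer_cons, ih fun u v n ν => hf (a :: u) v n ν]
    have := hf [] u a.1 a.2
    rw [List.nil_append] at this
    rw [this]; simp

/-- The involution `y_{n,ν} ↦ y_{n,ν⁻¹}` combined with the reversal of words. -/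
def revInv (u : List (YLetter Γ)) : List (YLetter Γ) :=
  (u.map fun a => (a.1, a.2⁻¹)).reverse

@[simp] theorem revInv_nil : revInv ([] : List (YLetter Γ)) = [] := rfl

theorem revInv_cons (a : YLetter Γ) (u : List (YLetter Γ)) :
    revInv (a :: u) = revInv u ++ [(a.1, a.2⁻¹)] := by simp [revInv]

theorem deg_revInv (u : List (YLetter Γ)) : deg (revInv u) = (deg u)⁻¹ := by
  induction u with
  | nil => simp
  | cons a u ih => rw [revInv_cons, deg_append, ih]; simp

theorem revInv_eq_nil {u : List (YLetter Γ)} : revInv u = [] ↔ u = [] := by simp [revInv]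

variable [Fintype Γ]

theorem stuffle_opShift (a b : YLetter Γ) (f : NCSeries (YLetter Γ) k) :
    (stuffle Γ).opShift a b f = shift (a.1 + b.1, a.2 * b.2) f := rfl

theorem stuffle_wt (a : YLetter Γ) : (stuffle Γ).wt a = a.1 := rfl

theorem wordWt_revInv (u : List (YLetter Γ)) :
    wordWt (stuffle Γ).wt (revInv u) = wordWt (stuffle Γ).wt u := by
  induction u with
  | nil => rfl
  | cons a u ih =>
    rw [revInv_cons, wordWt_append, ih, wordWt_cons, wordWt_cons, wordWt_nil, add_zero, add_comm]
    rfl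

/-- The antiautomorphism `y_{n,ν} ↦ (-1)^n y_{n,ν⁻¹}`. -/
noncomputable def antiInv (f : NCSeries (YLetter Γ) k) : NCSeries (YLetter Γ) k :=
  fun u => (-1) ^ wordWt (stuffle Γ).wt u * f (revInv u)

theorem antiInv_apply (f : NCSeries (YLetter Γ) k) (u : List (YLetter Γ)) :
    antiInv f u = (-1) ^ wordWt (stuffle Γ).wt u * f (revInv u) := rfl

/-- Reversal exchanges the recursion on first letters with `cop_append`. Signs and inverses are
compatible with the product of letters, since weights add up and `Γ` is commutative. -/
theorem cop_antiInv (f : NCSeries (YLetter Γ) k) (u v : List (YLetter Γ)) :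
    (stuffle Γ).cop (antiInv f) u v =
      (-1) ^ (wordWt (stuffle Γ).wt u + wordWt (stuffle Γ).wt v) *
        (stuffle Γ).cop f (revInv u) (revInv v) := by
  have hs : ∀ a (f : NCSeries (YLetter Γ) k), shift a (antiInv f) =
      ((-1 : k) ^ (a.1 : ℕ)) • antiInv (lastShift (a.1, a.2⁻¹) f) := by
    intro a f
    ext u
    rw [shift_apply, antiInv_apply, smul_apply, antiInv_apply, revInv_cons, lastShift_apply,
      wordWt_cons, stuffle_wt, pow_add]
    ring
  induction hn : u.length + v.length using Nat.strong_induction_on generalizing f u v with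
  | _ n ih =>
    cases u with
    | nil => rw [cop_nil_left, antiInv_apply, revInv_nil, cop_nil_left]; simp
    | cons a u =>
      cases v with
      | nil => rw [cop_nil_right, antiInv_apply, revInv_nil, cop_nil_right]; simp
      | cons b v =>
        rw [cop_cons, stuffle_opShift, hs, hs, hs, cop_smul_apply, cop_smul_apply, cop_smul_apply,
          ih _ (by simp at hn ⊢; omega) _ _ _ rfl, ih _ (by simp at hn ⊢; omega) _ _ _ rfl,
          ih _ (by simp at hn ⊢; omega) _ _ _ rfl, revInv_cons, revInv_cons, cop_append,
          wordWt_cons, wordWt_cons, stuffle_wt, stuffle_wt]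
        have hop : (stuffle Γ).op (a.1, a.2⁻¹) (b.1, b.2⁻¹) =
            some (a.1 + b.1, (a.2 * b.2)⁻¹) := by rw [mul_inv]; rfl
        simp only [hop, Option.elim_some, PNat.add_coe]
        ring

theorem QuasiShuffle.IsPrimitive.antiInv {f : NCSeries (YLetter Γ) k} (hf : (stuffle Γ).IsPrimitive f) :
    (stuffle Γ).IsPrimitive (antiInv f) := by
  refine isPrimitive_of_cop_apply ?_ fun u v hu hv => ?_
  · rw [antiInv_apply, revInv_nil, hf.apply_nil, mul_zero]
  · rw [cop_antiInv, hf.cop_apply (by rwa [Ne, revInv_eq_nil]) (by rwa [Ne, revInv_eq_nil]),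
      mul_zero]

open Classical in
-- All three cases of the recursion preserve the product of the elements of `Γ`, by commutativity.
theorem cop_degPart (g : Γ) (f : NCSeries (YLetter Γ) k) (u v : List (YLetter Γ)) :
    (stuffle Γ).cop (degPart g f) u v =
      if deg u * deg v = g then (stuffle Γ).cop f u v else 0 := by
  have hs : ∀ a g (f : NCSeries (YLetter Γ) k), shift a (degPart g f) =
      degPart (a.2⁻¹ * g) (shift a f) := by
    intro a g f
    ext u
    rw [shift_apply, degPart_apply, degPart_apply, deg_cons, shift_apply]
    simp only [eq_inv_mul_iff_mul_eq]
  induction hn : u.length + v.length using Nat.strong_induction_on generalizing f u v g with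
  | _ n ih =>
    cases u with
    | nil => rw [cop_nil_left, cop_nil_left, degPart_apply, deg_nil, one_mul]
    | cons a u =>
      cases v with
      | nil => rw [cop_nil_right, cop_nil_right, degPart_apply, deg_nil, mul_one]
      | cons b v =>
        rw [cop_cons, stuffle_opShift, hs, hs, hs, ih _ (by simp at hn ⊢; omega) _ _ _ _ rfl,
          ih _ (by simp at hn ⊢; omega) _ _ _ _ rfl, ih _ (by simp at hn ⊢; omega) _ _ _ _ rfl,
          cop_cons, stuffle_opShift]
        simp only [eq_inv_mul_iff_mul_eq, deg_cons]
        have h1 : a.2 * (deg u * (b.2 * deg v)) = a.2 * deg u * (b.2 * deg v) := by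
          rw [mul_assoc]
        have h2 : b.2 * (a.2 * deg u * deg v) = a.2 * deg u * (b.2 * deg v) := by
          rw [mul_left_comm]
        have h3 : a.2 * b.2 * (deg u * deg v) = a.2 * deg u * (b.2 * deg v) := by
          rw [mul_mul_mul_comm]
        rw [h1, h2, h3]
        split_ifs <;> simp

/-- `stepDer` is a coderivation: on a letter obtained by merging indices `m` and `n` it has
coefficient `m + n`, the sum of its coefficients on the two merged letters. -/
theorem cop_stepDer (f : NCSeries (YLetter Γ) k) (u v : List (YLetter Γ)) :
    (stuffle Γ).cop (stepDer f) u v = stepDer (slice v ((stuffle Γ).cop f)) u +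
      stepDer ((stuffle Γ).cop f u) v := by
  induction hn : u.length + v.length using Nat.strong_induction_on generalizing f u v with
  | _ n ih =>
    cases u with
    | nil =>
      have : (stuffle Γ).cop f [] = f := by ext; simp
      rw [cop_nil_left, stepDer_nil, this, zero_add]
    | cons a u =>
      cases v with
      | nil =>
        have : slice [] ((stuffle Γ).cop f) = f := by ext; simp
        rw [cop_nil_right, stepDer_nil, this, add_zero]
      | cons b v =>
        have e1 : shift a (slice (b :: v) ((stuffle Γ).cop f)) =
            slice (b :: v) ((stuffle Γ).cop (shift a f)) +
              shift a (slice v ((stuffle Γ).cop (shift b f))) +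
              slice v ((stuffle Γ).cop (shift (a.1 + b.1, a.2 * b.2) f)) := by
          ext u; exact (stuffle Γ).cop_cons f a b u v
        have e2 : shift b ((stuffle Γ).cop f (a :: u)) =
            shift b ((stuffle Γ).cop (shift a f) u) +
              (stuffle Γ).cop (shift b f) (a :: u) +
              (stuffle Γ).cop (shift (a.1 + b.1, a.2 * b.2) f) u := by
          ext v; exact (stuffle Γ).cop_cons f a b u v
        rw [cop_cons, stuffle_opShift, shift_stepDer, shift_stepDer, shift_stepDer, cop_add,
          cop_add, cop_add]
        simp only [add_apply, cop_smul_apply]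
        rw [ih _ (by simp at hn ⊢; omega) _ _ _ rfl, ih _ (by simp at hn ⊢; omega) _ _ _ rfl,
          ih _ (by simp at hn ⊢; omega) _ _ _ rfl, stepDer_cons (slice (b :: v) _),
          stepDer_cons ((stuffle Γ).cop f (a :: u)), e1, e2]
        simp only [stepDer_add, add_apply, stepDer_cons, slice_apply, cop_cons, stuffle_opShift,
          PNat.add_coe, Nat.cast_add]
        have h1 : a.1 + 1 + b.1 = a.1 + b.1 + 1 := add_right_comm _ _ _
        have h2 : a.1 + (b.1 + 1) = a.1 + b.1 + 1 := (add_assoc _ _ _).symm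
        rw [h1, h2]
        ring

theorem stepDer_isPrimitive {f : NCSeries (YLetter Γ) k} (hf : (stuffle Γ).IsPrimitive f) :
    (stuffle Γ).IsPrimitive (stepDer f) := by
  have h0 : ∀ (f : NCSeries (YLetter Γ) k) (u : List (YLetter Γ)), (∀ v, v ≠ [] → f v = 0) →
      stepDer f u = 0 := by
    intro f u h
    induction u generalizing f with
    | nil => simp
    | cons a u ih => 
      rw [stepDer_cons, h _ (List.cons_ne_nil _ _), ih (shift a f) fun v _ => h _ (List.cons_ne_nil _ _)]
      simp
  refine isPrimitive_of_cop_apply (stepDer_nil f) fun u v hu hv => ?_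
  rw [cop_stepDer, h0 _ _ fun w hw => ?_, h0 _ _ fun w hw => ?_, add_zero]
  · exact hf.cop_apply hu hw
  · exact hf.cop_apply hw hv

/-- The series whose coefficient at `v y_{m,ν}` is that of `v` in `f_{j + m - n}`. -/
def lastTerm (f : ℕ → NCSeries (YLetter Γ) k) (n j : ℕ) : NCSeries (YLetter Γ) k := fun w =>
  match w.reverse with
  | [] => 0
  | b :: v => if n ≤ j + b.1 then f (j + b.1 - n) v.reverse else 0

/-- The series whose coefficient at `y_{m,ν} v` is that of `v` in `f_{j + m - n}`. -/
def firstTerm (f : ℕ → NCSeries (YLetter Γ) k) (n j : ℕ) : NCSeries (YLetter Γ) k := fun w =>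
  match w with
  | [] => 0
  | b :: v => if n ≤ j + b.1 then f (j + b.1 - n) v else 0

@[simp] theorem lastTerm_nil (f : ℕ → NCSeries (YLetter Γ) k) (n j : ℕ) :
    lastTerm f n j [] = 0 := rfl

@[simp] theorem firstTerm_nil (f : ℕ → NCSeries (YLetter Γ) k) (n j : ℕ) :
    firstTerm f n j [] = 0 := rfl

theorem lastTerm_append (f : ℕ → NCSeries (YLetter Γ) k) (n j : ℕ) (v : List (YLetter Γ))
    (b : YLetter Γ) : lastTerm f n j (v ++ [b]) =
      if n ≤ j + b.1 then f (j + b.1 - n) v else 0 := by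
  simp only [lastTerm, List.reverse_append, List.reverse_singleton, List.singleton_append,
    List.reverse_reverse]

theorem firstTerm_cons (f : ℕ → NCSeries (YLetter Γ) k) (n j : ℕ) (v : List (YLetter Γ))
    (b : YLetter Γ) : firstTerm f n j (b :: v) =
      if n ≤ j + b.1 then f (j + b.1 - n) v else 0 := rfl

theorem QuasiShuffle.IsPrimitive.cop_eq {f : NCSeries (YLetter Γ) k} (hf : (stuffle Γ).IsPrimitive f)
    (u v : List (YLetter Γ)) : (stuffle Γ).cop f u v =
      (if u = [] then f v else 0) + if v = [] then f u else 0 := by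
  rw [hf, add_apply, add_apply, tmul_apply, tmul_apply]
  congr 1
  · cases u <;> simp
  · cases v <;> simp

/-- The sequence `f_{j - n}`, which is extended by `0`. -/
def shiftSeq (f : ℕ → NCSeries (YLetter Γ) k) (n j : ℕ) : NCSeries (YLetter Γ) k :=
  if n ≤ j then f (j - n) else 0

theorem shiftSeq_apply (f : ℕ → NCSeries (YLetter Γ) k) (n j : ℕ) (u : List (YLetter Γ)) :
    shiftSeq f n j u = if n ≤ j then f (j - n) u else 0 := by
  unfold shiftSeq; split_ifs <;> rfl

theorem QuasiShuffle.IsPrimitive.shiftSeq {f : ℕ → NCSeries (YLetter Γ) k}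
    (hf : ∀ i, (stuffle Γ).IsPrimitive (f i)) (n j : ℕ) :
    (stuffle Γ).IsPrimitive (shiftSeq f n j) := by
  unfold NCSeries.shiftSeq
  split_ifs
  · exact hf _
  · exact isPrimitive_of_cop_apply rfl fun u v _ _ => by rw [cop_zero]; rfl

/-- The recursion on last letters reduces this to coproducts of the primitive `f i`, which vanish on
pairs of nonempty words. So one of the two words is a single letter: it either remains as the last
letter, which gives `shiftSeq`, or merges with the last letter of the other word, which gives
`lastTerm`. -/
theorem cop_lastTerm {f : ℕ → NCSeries (YLetter Γ) k} (hf : ∀ i, (stuffle Γ).IsPrimitive (f i))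
    (n : ℕ) {u v : List (YLetter Γ)} (hu : u ≠ []) (hv : v ≠ []) :
    (stuffle Γ).cop (lastTerm f n 0) u v =
      (if u.length = 1 then (shiftSeq f n (wordWt (stuffle Γ).wt u) +
        lastTerm f n (wordWt (stuffle Γ).wt u)) v else 0) +
      if v.length = 1 then (shiftSeq f n (wordWt (stuffle Γ).wt v) +
        lastTerm f n (wordWt (stuffle Γ).wt v)) u else 0 := by
  have hl : ∀ a, lastShift a (lastTerm f n 0) = shiftSeq f n a.1 := by
    intro a; ext u; rw [lastShift_apply, lastTerm_append, shiftSeq_apply, zero_add]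
  have hop : ∀ a b, (stuffle Γ).op a b = some (a.1 + b.1, a.2 * b.2) := fun _ _ => rfl
  have hnil : ∀ j, shiftSeq f n j [] = 0 := fun j => (IsPrimitive.shiftSeq hf n j).apply_nil
  rcases List.eq_nil_or_concat u with rfl | ⟨u, a, rfl⟩
  · exact absurd rfl hu
  rcases List.eq_nil_or_concat v with rfl | ⟨v, b, rfl⟩
  · exact absurd rfl hv
  rw [List.concat_eq_append, List.concat_eq_append, cop_append, hl, hl, hop]
  simp only [Option.elim_some, hl, fun j => (IsPrimitive.shiftSeq hf n j).cop_eq, List.length_append,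
    List.length_singleton, Nat.add_eq_right, List.length_eq_zero_iff, add_apply,
    lastTerm_append, ← shiftSeq_apply, PNat.add_coe]
  by_cases h1 : u = [] <;> by_cases h2 : v = []
  · subst h1 h2
    simp [hnil, stuffle_wt]
  · subst h1
    simp [h2, stuffle_wt]
  · subst h2
    simp [h1, stuffle_wt, add_comm]
  · simp [h1, h2]

/-- Mirror image of `cop_lastTerm`, by the recursion on first letters. -/
theorem cop_firstTerm {f : ℕ → NCSeries (YLetter Γ) k} (hf : ∀ i, (stuffle Γ).IsPrimitive (f i))
    (n : ℕ) {u v : List (YLetter Γ)} (hu : u ≠ []) (hv : v ≠ []) :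
    (stuffle Γ).cop (firstTerm f n 0) u v =
      (if u.length = 1 then (shiftSeq f n (wordWt (stuffle Γ).wt u) +
        firstTerm f n (wordWt (stuffle Γ).wt u)) v else 0) +
      if v.length = 1 then (shiftSeq f n (wordWt (stuffle Γ).wt v) +
        firstTerm f n (wordWt (stuffle Γ).wt v)) u else 0 := by
  have hl : ∀ a, shift a (firstTerm f n 0) = shiftSeq f n a.1 := by
    intro a; ext u; rw [shift_apply, firstTerm_cons, shiftSeq_apply, zero_add]
  have hnil : ∀ j, shiftSeq f n j [] = 0 := fun j => (IsPrimitive.shiftSeq hf n j).apply_nil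
  obtain ⟨a, u, rfl⟩ := List.exists_cons_of_ne_nil hu
  obtain ⟨b, v, rfl⟩ := List.exists_cons_of_ne_nil hv
  rw [cop_cons, stuffle_opShift, hl, hl, hl]
  simp only [fun j => (IsPrimitive.shiftSeq hf n j).cop_eq, List.length_cons,
    Nat.add_eq_right, List.length_eq_zero_iff, add_apply,
    firstTerm_cons, ← shiftSeq_apply, PNat.add_coe]
  by_cases h1 : u = [] <;> by_cases h2 : v = []
  · subst h1 h2
    simp [hnil, stuffle_wt]
  · subst h1
    simp [h2, stuffle_wt]
  · subst h2
    simp [h1, stuffle_wt, add_comm]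
  · simp [h1, h2]

/-- The values on the letters `y_{n,ν}` of the derivation attached to two sequences. -/
noncomputable def pairValue (f g : ℕ → NCSeries (YLetter Γ) k) (a : YLetter Γ) :
    NCSeries (YLetter Γ) k :=
  degPart a.2 (lastTerm f a.1 0 + firstTerm g a.1 0)

/-- The defect of the derivation attached to two sequences from being a coderivation. -/
noncomputable def pairDefect (f g : ℕ → NCSeries (YLetter Γ) k) (n j : ℕ) :
    NCSeries (YLetter Γ) k :=
  shiftSeq f n j + lastTerm f n j + (shiftSeq g n j + firstTerm g n j)

open Classical in
theorem cop_pairValue {f g : ℕ → NCSeries (YLetter Γ) k}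
    (hf : ∀ i, (stuffle Γ).IsPrimitive (f i)) (hg : ∀ i, (stuffle Γ).IsPrimitive (g i))
    (a : YLetter Γ) {u v : List (YLetter Γ)} (hu : u ≠ []) (hv : v ≠ []) :
    (stuffle Γ).cop (pairValue f g a) u v = if deg u * deg v = a.2 then
      (if u.length = 1 then pairDefect f g a.1 (wordWt (stuffle Γ).wt u) v else 0) +
        (if v.length = 1 then pairDefect f g a.1 (wordWt (stuffle Γ).wt v) u else 0) else 0 := by
  rw [pairValue, cop_degPart, cop_add, add_apply, add_apply, cop_lastTerm hf _ hu hv,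
    cop_firstTerm hg _ hu hv]
  congr 1
  by_cases h1 : u.length = 1 <;> by_cases h2 : v.length = 1 <;>
    simp only [h1, h2, if_true, if_false, pairDefect, add_apply] <;> ring

/-- For `n ≤ j` the defect only depends on `j - n`, so one may take `n = 1`. Its coefficients in
length at least two are then coefficients of the coproduct of the value on `y_{1,1}`, which is zero;
those in length one cancel by `hfg`. -/
theorem pairDefect_eq_zero {f g : ℕ → NCSeries (YLetter Γ) k}
    (hf : ∀ i, (stuffle Γ).IsPrimitive (f i)) (hg : ∀ i, (stuffle Γ).IsPrimitive (g i))
    (hfg : ∀ i a, f i [a] + g i [a] = 0) (h1 : pairValue f g (1, 1) = 0) {n j : ℕ} (hnj : n ≤ j) :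
    pairDefect f g n j = 0 := by
  obtain ⟨i, rfl⟩ := Nat.exists_eq_add_of_le hnj
  have e1 : ∀ f : ℕ → NCSeries (YLetter Γ) k, shiftSeq f n (n + i) = f i := fun f => by
    ext w; rw [shiftSeq_apply, if_pos hnj, Nat.add_sub_cancel_left]
  have e1' : ∀ f : ℕ → NCSeries (YLetter Γ) k, shiftSeq f 1 (i + 1) = f i := fun f => by
    ext w; rw [shiftSeq_apply, if_pos (by omega), Nat.add_sub_cancel]
  have hd : pairDefect f g n (n + i) = pairDefect f g 1 (i + 1) := by
    have e3 : lastTerm f n (n + i) = lastTerm f 1 (i + 1) := by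
      ext w
      rcases List.eq_nil_or_concat w with rfl | ⟨w, b, rfl⟩
      · rfl
      · rw [List.concat_eq_append, lastTerm_append, lastTerm_append, if_pos (by omega),
          if_pos (by omega), show n + i + (b.1 : ℕ) - n = i + 1 + b.1 - 1 by omega]
    have e4 : firstTerm g n (n + i) = firstTerm g 1 (i + 1) := by
      ext w
      cases w with
      | nil => rfl
      | cons b w =>
        rw [firstTerm_cons, firstTerm_cons, if_pos (by omega), if_pos (by omega),
          show n + i + (b.1 : ℕ) - n = i + 1 + b.1 - 1 by omega]
    rw [pairDefect, pairDefect, e1, e1, e1', e1', e3, e4]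
  rw [hd]
  ext w
  rcases w with _ | ⟨a, _ | ⟨b, w⟩⟩
  · simp only [pairDefect, add_apply, e1', lastTerm_nil, firstTerm_nil, (hf _).apply_nil,
      (hg _).apply_nil, zero_apply, add_zero]
  · have h2 : lastTerm f 1 (i + 1) [a] = 0 := by
      have := lastTerm_append f 1 (i + 1) [] a
      rw [List.nil_append] at this
      rw [this, (hf _).apply_nil, ite_self]
    have h3 : firstTerm g 1 (i + 1) [a] = 0 := by
      rw [firstTerm_cons, (hg _).apply_nil, ite_self]
    simp only [pairDefect, add_apply, e1', h2, h3, add_zero, zero_apply, hfg]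
  -- The auxiliary letter has weight `i + 1`, so that the formula produces the wanted defect, and an
  -- element of `Γ` that brings the total degree to that of `y_{1,1}`.
  · have h := cop_pairValue hf hg (1, 1) (u := [(i.succPNat, (deg (a :: b :: w))⁻¹)])
      (v := a :: b :: w) (by simp) (by simp)
    rw [h1, cop_zero, deg_cons (i.succPNat, _), deg_nil, mul_one, inv_mul_cancel, if_pos rfl,
      if_pos (List.length_singleton), if_neg (by simp), add_zero, wordWt_cons, wordWt_nil,
      stuffle_wt, Nat.succPNat_coe, add_zero] at h
    exact h.symm

/-- In this range the defect is no obstruction: up to the restriction of the degree, it is the value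
on a letter of index `n - j`, as the splittings of `y_{n,ν}` require. -/
theorem pairDefect_of_lt (f g : ℕ → NCSeries (YLetter Γ) k) {n j : ℕ} (hnj : j < n) :
    pairDefect f g n j = lastTerm f (n - j) 0 + firstTerm g (n - j) 0 := by
  have e1 : ∀ f : ℕ → NCSeries (YLetter Γ) k, shiftSeq f n j = 0 := fun f => by
    rw [shiftSeq, if_neg (by omega)]
  have e3 : lastTerm f n j = lastTerm f (n - j) 0 := by
    ext w
    rcases List.eq_nil_or_concat w with rfl | ⟨w, b, rfl⟩
    · rfl
    · rw [List.concat_eq_append, lastTerm_append, lastTerm_append]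
      by_cases h : n ≤ j + b.1
      · rw [if_pos h, if_pos (by omega), show j + (b.1 : ℕ) - n = 0 + b.1 - (n - j) by omega]
      · rw [if_neg h, if_neg (by omega)]
  have e4 : firstTerm g n j = firstTerm g (n - j) 0 := by
    ext w
    cases w with
    | nil => rfl
    | cons b w =>
      rw [firstTerm_cons, firstTerm_cons]
      by_cases h : n ≤ j + b.1
      · rw [if_pos h, if_pos (by omega), show j + (b.1 : ℕ) - n = 0 + b.1 - (n - j) by omega]
      · rw [if_neg h, if_neg (by omega)]
  rw [pairDefect, e1, e1, e3, e4, zero_add, zero_add]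

theorem pairValue_nil (f g : ℕ → NCSeries (YLetter Γ) k) (a : YLetter Γ) :
    pairValue f g a [] = 0 := by
  rw [pairValue, degPart_apply, add_apply, lastTerm_nil, firstTerm_nil, add_zero, ite_self]

open Classical in
/-- The sum over the factorizations of `a` with a given second factor. -/
theorem sum_splits_mul_letter (φ : YLetter Γ → k) (a : YLetter Γ) (v : List (YLetter Γ))
    {x : k} (hx : ∀ b, v = [b] → ∀ c, (stuffle Γ).op c b = some a → φ c = x)
    (hx0 : (∀ b, v = [b] → ∀ c, (stuffle Γ).op c b ≠ some a) → x = 0) :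
    ∑ p ∈ (stuffle Γ).splits a, φ p.1 * (letter p.2 : NCSeries (YLetter Γ) k) v = x := by
  by_cases h : ∃ b c, v = [b] ∧ (stuffle Γ).op c b = some a
  · obtain ⟨b, c, rfl, hc⟩ := h
    rw [Finset.sum_eq_single_of_mem (c, b) ((stuffle Γ).mem_splits.2 hc), hx b rfl c hc]
    · simp [letter]
    · rintro ⟨p, q⟩ hp hne
      rw [mem_splits] at hp
      rw [letter, if_neg, mul_zero]
      intro hbq
      simp only [List.cons.injEq, and_true] at hbq
      subst hbq
      apply hne
      have h1 := Option.some.inj (hp.trans hc.symm)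
      simp only [Prod.mk.injEq, add_left_inj, mul_left_inj] at h1
      simp only [Prod.mk.injEq, and_true]
      exact Prod.ext h1.1 h1.2
  · rw [Finset.sum_eq_zero, hx0]
    · intro b hb c hc; exact h ⟨b, c, hb, hc⟩
    · rintro ⟨p, q⟩ hp
      rw [mem_splits] at hp
      rw [letter, if_neg, mul_zero]
      intro hv
      exact h ⟨q, p, hv, hp⟩

theorem stuffle_op_comm (a b : YLetter Γ) : (stuffle Γ).op a b = (stuffle Γ).op b a := by
  change some (a.1 + b.1, a.2 * b.2) = some (b.1 + a.1, b.2 * a.2)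
  rw [add_comm, mul_comm]

/-- At a pair of nonempty words both sides are supported where one word is a single letter. If its
index is smaller than that of `a`, the defect is the value on the complementary letter; otherwise
there is no splitting and the defect vanishes. -/
theorem cop_pairValue_eq {f g : ℕ → NCSeries (YLetter Γ) k}
    (hf : ∀ i, (stuffle Γ).IsPrimitive (f i)) (hg : ∀ i, (stuffle Γ).IsPrimitive (g i))
    (hfg : ∀ i a, f i [a] + g i [a] = 0) (h1 : pairValue f g (1, 1) = 0) (a : YLetter Γ) :
    (stuffle Γ).cop (pairValue f g a) = tmul 1 (pairValue f g a) + tmul (pairValue f g a) 1 +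
      ∑ p ∈ (stuffle Γ).splits a, (tmul (pairValue f g p.1) (letter p.2) +
        tmul (letter p.1) (pairValue f g p.2)) := by
  classical
  have key : ∀ u v : List (YLetter Γ), v ≠ [] →
      ∑ p ∈ (stuffle Γ).splits a, pairValue f g p.1 u * (letter p.2 : NCSeries _ k) v =
        if deg u * deg v = a.2 then
          (if v.length = 1 then pairDefect f g a.1 (wordWt (stuffle Γ).wt v) u else 0) else 0 := by
    intro u v hv
    refine sum_splits_mul_letter (fun c => pairValue f g c u) a v ?_ ?_
    · rintro b rfl c hc
      have hc' : (c.1 + b.1, c.2 * b.2) = a := Option.some.inj hc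
      subst hc'
      have h2 : ((c.1 + b.1 : ℕ+) : ℕ) - b.1 = c.1 := by rw [PNat.add_coe]; omega
      rw [List.length_singleton, if_pos rfl, wordWt_cons, wordWt_nil, add_zero, stuffle_wt,
        pairDefect_of_lt _ _ (by rw [PNat.add_coe]; have := c.1.pos; omega), pairValue,
        degPart_apply, h2]
      simp
    · intro h
      by_cases hl : v.length = 1
      · obtain ⟨b, rfl⟩ := List.length_eq_one_iff.1 hl
        rw [wordWt_cons, wordWt_nil, add_zero, stuffle_wt]
        -- If `b` has smaller index than `a`, the letter with index `a.1 - b.1` and element `a.2 *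
        -- b.2⁻¹` completes it to a splitting of `a`, against `h`. Only the vanishing of the defect
        -- remains to be used.
        by_cases hb : (a.1 : ℕ) ≤ b.1
        · rw [pairDefect_eq_zero hf hg hfg h1 hb]; simp
        · exact absurd (congrArg some (Prod.ext (PNat.eq (by
              rw [PNat.add_coe, Nat.toPNat'_coe, if_pos (by omega)]; omega)) (by simp) :
              (((a.1 : ℕ) - b.1).toPNat' + b.1, a.2 * b.2⁻¹ * b.2) = a))
              (h b rfl (((a.1 : ℕ) - b.1).toPNat', a.2 * b.2⁻¹))
      · rw [if_neg hl, ite_self]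
  have key' : ∀ u v : List (YLetter Γ), u ≠ [] →
      ∑ p ∈ (stuffle Γ).splits a, (letter p.1 : NCSeries _ k) u * pairValue f g p.2 v =
        if deg u * deg v = a.2 then
          (if u.length = 1 then pairDefect f g a.1 (wordWt (stuffle Γ).wt u) v else 0) else 0 := by
    intro u v hu
    rw [mul_comm (deg u), ← key v u hu]
    refine Finset.sum_bij' (fun p _ => p.swap) (fun p _ => p.swap) ?_ ?_ ?_ ?_ ?_
    · rintro p hp; rw [mem_splits] at hp ⊢; rw [stuffle_op_comm] at hp; exact hp
    · rintro p hp; rw [mem_splits] at hp ⊢; rw [stuffle_op_comm] at hp; exact hp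
    · simp
    · simp
    · rintro p -; exact mul_comm _ _
  ext u v
  simp only [add_apply, sum_apply, tmul_apply, Finset.sum_add_distrib]
  by_cases hu : u = []
  · subst hu
    rw [cop_nil_left, pairValue_nil, one_nil, Finset.sum_eq_zero, Finset.sum_eq_zero]
    · ring
    · intro p _; rw [letter_nil, zero_mul]
    · intro p _; rw [pairValue_nil, zero_mul]
  by_cases hv : v = []
  · subst hv
    rw [cop_nil_right, pairValue_nil, one_nil, Finset.sum_eq_zero, Finset.sum_eq_zero]
    · ring
    · intro p _; rw [pairValue_nil, mul_zero]
    · intro p _; rw [letter_nil, mul_zero]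
  rw [cop_pairValue hf hg a hu hv, key u v hv, key' u v hu, one_apply_of_ne_nil hu,
    one_apply_of_ne_nil hv]
  split_ifs <;> ring

end Stuffle
end NCSeries

/-! ### The words in `Y` as words in `X` -/

namespace NCSeries

open QuasiShuffle

section Words

variable {Γ k : Type*} [CommGroup Γ] [CommRing k]

/-- Multiplication of the indices of a word by an element of `Γ`. -/
def mulWord (c : Γ) (w : List (XLetter Γ)) : List (XLetter Γ) := w.map (Option.map (c * ·))

@[simp] theorem mulWord_nil (c : Γ) : mulWord c ([] : List (XLetter Γ)) = [] := rfl

@[simp] theorem mulWord_some (c σ : Γ) (w : List (XLetter Γ)) :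
    mulWord c (some σ :: w) = some (c * σ) :: mulWord c w := rfl

@[simp] theorem mulWord_append (c : Γ) (u v : List (XLetter Γ)) :
    mulWord c (u ++ v) = mulWord c u ++ mulWord c v := List.map_append

@[simp] theorem mulWord_replicate (c : Γ) (n : ℕ) :
    mulWord c (List.replicate n none) = List.replicate n none := by
  simp [mulWord]

@[simp] theorem mulWord_mulWord (c d : Γ) (w : List (XLetter Γ)) :
    mulWord c (mulWord d w) = mulWord (c * d) w := by
  rw [mulWord, mulWord, mulWord, List.map_map]
  congr 1
  funext x
  cases x <;> simp [mul_assoc]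

@[simp] theorem mulWord_one (w : List (XLetter Γ)) : mulWord 1 w = w := by
  have : (Option.map ((1 : Γ) * ·)) = id := by
    funext x; cases x <;> simp
  rw [mulWord, this, List.map_id]

@[simp] theorem mulWord_length (c : Γ) (w : List (XLetter Γ)) :
    (mulWord c w).length = w.length := List.length_map _

theorem tSubst_apply (σ : Γ) (f : NCSeries (XLetter Γ) k) (w : List (XLetter Γ)) :
    tSubst σ f w = f (mulWord σ⁻¹ w) := rfl

/-- The word in the `x_σ` that corresponds to a word in the `y_{n,ν}` under `q`. -/
def toX (u : List (YLetter Γ)) : List (XLetter Γ) :=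
  (pWord 1 u).flatMap fun y => yWord y.1 y.2

theorem flatMap_pWord (c : Γ) (u : List (YLetter Γ)) :
    (pWord c u).flatMap (fun y => yWord y.1 y.2) = mulWord c (toX u) := by
  induction u generalizing c with
  | nil => rfl
  | cons a u ih =>
    rw [toX, pWord, pWord, List.flatMap_cons, List.flatMap_cons, ih, ih, mulWord_append,
      mulWord_mulWord, one_mul]
    congr 1
    simp [yWord]

@[simp] theorem toX_nil : toX ([] : List (YLetter Γ)) = [] := rfl

theorem toX_cons (a : YLetter Γ) (u : List (YLetter Γ)) :
    toX (a :: u) = List.replicate ((a.1 : ℕ) - 1) none ++ some a.2 :: mulWord a.2 (toX u) := by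
  rw [toX, pWord, List.flatMap_cons, flatMap_pWord, one_mul]
  simp [yWord]

theorem toX_append (u v : List (YLetter Γ)) : toX (u ++ v) = toX u ++ mulWord (deg u) (toX v) := by
  induction u with
  | nil => simp
  | cons a u ih => rw [List.cons_append, toX_cons, toX_cons, ih]; simp

theorem toX_singleton (a : YLetter Γ) :
    toX [a] = List.replicate ((a.1 : ℕ) - 1) none ++ [some a.2] := by
  rw [toX_cons, toX_nil, mulWord_nil]

theorem toX_append_singleton (u : List (YLetter Γ)) (a : YLetter Γ) :
    toX (u ++ [a]) = toX u ++ List.replicate ((a.1 : ℕ) - 1) none ++ [some (deg u * a.2)] := by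
  rw [toX_append, toX_singleton]; simp

theorem toX_eq_nil {u : List (YLetter Γ)} : toX u = [] ↔ u = [] := by
  cases u with
  | nil => simp
  | cons a u => simp [toX_cons]

theorem toX_ne_append_none (u : List (YLetter Γ)) (v : List (XLetter Γ)) :
    toX u ≠ v ++ [none] := by
  rcases List.eq_nil_or_concat u with rfl | ⟨u, a, rfl⟩
  · simp
  · rw [List.concat_eq_append, toX_append_singleton]
    intro h
    have := List.append_inj_right' h rfl
    simp at this

theorem replicate_none_append_inj {m n : ℕ} {σ τ : Γ} {v w : List (XLetter Γ)}
    (h : List.replicate m none ++ some σ :: v = List.replicate n none ++ some τ :: w) :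
    m = n ∧ σ = τ ∧ v = w := by
  induction m generalizing n with
  | zero =>
    cases n with
    | zero => simpa using h
    | succ n => simp [List.replicate_succ] at h
  | succ m ih =>
    cases n with
    | zero => simp [List.replicate_succ] at h
    | succ n =>
      simp only [List.replicate_succ, List.cons_append, List.cons.injEq, true_and] at h
      simpa using ih h

theorem mulWord_injective (c : Γ) : Function.Injective (mulWord c) := by
  intro v w h
  have := congrArg (mulWord c⁻¹) h
  simpa using this

theorem toX_injective : Function.Injective (toX : List (YLetter Γ) → List (XLetter Γ)) := by
  intro u
  induction u with
  | nil => intro v h; exact (toX_eq_nil.1 h.symm).symm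
  | cons a u ih =>
    intro v h
    cases v with
    | nil => exact toX_eq_nil.1 h
    | cons b v =>
      rw [toX_cons, toX_cons] at h
      obtain ⟨h1, h2, h3⟩ := replicate_none_append_inj h
      rw [h2] at h3
      rw [ih (mulWord_injective _ h3)]
      congr 1
      have := a.1.pos
      have := b.1.pos
      exact Prod.ext (PNat.eq (by omega)) h2

theorem exists_toX_or (w : List (XLetter Γ)) : (∃ u, toX u = w) ∨ ∃ v, w = v ++ [none] := by
  induction hn : w.length using Nat.strong_induction_on generalizing w with
  | _ n ih =>
    cases w with
    | nil => exact Or.inl ⟨[], rfl⟩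
    | cons a w =>
      cases a with
      | none =>
        rcases ih _ (by simp at hn; omega) w rfl with ⟨u, rfl⟩ | ⟨v, rfl⟩
        · cases u with
          | nil => exact Or.inr ⟨[], rfl⟩
          | cons b u =>
            refine Or.inl ⟨(b.1 + 1, b.2) :: u, ?_⟩
            rw [toX_cons, toX_cons]
            have := b.1.pos
            rw [PNat.add_coe, PNat.one_coe, Nat.add_sub_cancel, ← List.cons_append,
              ← List.replicate_succ, Nat.sub_add_cancel this]
        · exact Or.inr ⟨none :: v, rfl⟩
      | some σ =>
        rcases ih _ (by simp at hn; omega) (mulWord σ⁻¹ w) (mulWord_length _ _) with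
          ⟨u, hu⟩ | ⟨v, hv⟩
        · refine Or.inl ⟨(1, σ) :: u, ?_⟩
          rw [toX_cons, hu]; simp
        · refine Or.inr ⟨some σ :: mulWord σ v, ?_⟩
          have := congrArg (mulWord σ) hv
          simp only [mulWord_append, mulWord_mulWord, mul_inv_cancel, mulWord_one] at this
          rw [this]
          rfl

end Words

/-! ### The map `q π_Y` and its multiplicativity -/

section Projection

variable {Γ k : Type*} [CommGroup Γ] [CommRing k]

/-- The map `q π_Y`, as a linear map. -/
def qPi : NCSeries (XLetter Γ) k →ₗ[k] NCSeries (YLetter Γ) k where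
  toFun f := qMap (piY f)
  map_add' _ _ := rfl
  map_smul' _ _ := rfl

theorem qPi_apply (f : NCSeries (XLetter Γ) k) (u : List (YLetter Γ)) : qPi f u = f (toX u) := rfl

open Classical in
/-- The section of `q π_Y` whose values are supported on the words that do not end in `x_0`. -/
noncomputable def qSec : NCSeries (YLetter Γ) k →ₗ[k] NCSeries (XLetter Γ) k where
  toFun g w := if h : ∃ u, toX u = w then g h.choose else 0
  map_add' f g := by
    ext w
    change (if h : ∃ u, toX u = w then (f + g) h.choose else 0) =
      (if h : ∃ u, toX u = w then f h.choose else 0) + if h : ∃ u, toX u = w then g h.choose else 0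
    split_ifs <;> simp
  map_smul' c f := by
    ext w
    change (if h : ∃ u, toX u = w then (c • f) h.choose else 0) =
      c * (if h : ∃ u, toX u = w then f h.choose else 0)
    split_ifs
    · rfl
    · simp

open Classical in
theorem qSec_apply (g : NCSeries (YLetter Γ) k) (w : List (XLetter Γ)) :
    qSec g w = if h : ∃ u, toX u = w then g h.choose else 0 := rfl

theorem qPi_qSec (g : NCSeries (YLetter Γ) k) : qPi (qSec g) = g := by
  ext u
  have h : ∃ v, toX v = toX u := ⟨u, rfl⟩
  rw [qPi_apply, qSec_apply, dif_pos h, toX_injective h.choose_spec]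

theorem qPi_mul_letter_none (f : NCSeries (XLetter Γ) k) : qPi (f * letter none) = 0 := by
  classical
  ext u
  rw [qPi_apply]
  rcases List.eq_nil_or_concat (toX u) with h | ⟨w, b, h⟩
  · rw [h, mul_letter_nil]; rfl
  · rw [h, List.concat_eq_append, mul_letter_append, if_neg]
    · rfl
    · rintro rfl
      exact toX_ne_append_none u w (by rw [h, List.concat_eq_append])

/-- Together with `qPi_mul_letter_none`, this identifies the kernel of `qPi` with `k⟨⟨X⟩⟩ x_0`. -/
theorem eq_mul_letter_none {f : NCSeries (XLetter Γ) k} (hf : qPi f = 0) :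
    f = lastShift none f * letter none := by
  classical
  ext w
  rcases exists_toX_or w with ⟨u, rfl⟩ | ⟨v, rfl⟩
  · have h1 := congrFun hf u
    have h2 := congrFun (qPi_mul_letter_none (lastShift none f)) u
    rw [qPi_apply] at h1 h2
    exact h1.trans h2.symm
  · rw [mul_letter_append, if_pos rfl, lastShift_apply]

/-- The left shift by a word. -/
def shiftWord (u : List (XLetter Γ)) (f : NCSeries (XLetter Γ) k) : NCSeries (XLetter Γ) k :=
  fun w => f (u ++ w)

/-- As no word of `f` ends in `x_0`, a factorization of `x_0^n x_σ w` that contributes has a left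
factor which is empty or contains the whole block `x_0^n x_σ`. -/
theorem mul_apply_replicate_append (f g : NCSeries (XLetter Γ) k)
    (hf : ∀ w, f (w ++ [none]) = 0) (n : ℕ) (σ : Γ) (w : List (XLetter Γ)) :
    (f * g) (List.replicate n none ++ some σ :: w) =
      f [] * g (List.replicate n none ++ some σ :: w) +
        (shiftWord (List.replicate n none ++ [some σ]) f * g) w := by
  induction n generalizing f with
  | zero => exact mul_cons f g (some σ) w
  | succ n ih =>
    have h0 : shift none f [] = 0 := hf []
    rw [List.replicate_succ, List.cons_append, mul_cons, ih (shift none f) fun w => hf (none :: w),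
      h0, zero_mul, zero_add]
    rfl

/-- Multiplicativity of `q π_Y` for a first factor all of whose words end in `x_ν`. -/
theorem qPi_mul_tSubst (f g : NCSeries (XLetter Γ) k) (ν : Γ) (h0 : ∀ w, f (w ++ [none]) = 0)
    (h1 : ∀ w σ, σ ≠ ν → f (w ++ [some σ]) = 0) (h2 : ν ≠ 1 → f [] = 0) :
    qPi (f * tSubst ν g) = qPi f * qPi g := by
  ext u
  induction u generalizing f ν with
  | nil =>
    rw [qPi_apply, mul_nil, toX_nil, mul_nil]
    rfl
  | cons a u ih =>
    obtain ⟨n, μ⟩ := a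
    set s := List.replicate ((n : ℕ) - 1) none ++ [some μ] with hs
    -- `q` only sees ratios of consecutive indices. After the first block is removed, all indices
    -- are divided by `μ`, and the last index `ν` becomes `μ⁻¹ ν`. The continuation may now have a
    -- constant term, but only if `ν = μ`, which is why the hypothesis on `f []` excludes index `1`.
    have hh := ih (tSubst μ⁻¹ (shiftWord s f)) (μ⁻¹ * ν) (fun w => ?_) (fun w σ hσ => ?_)
      (fun hne => ?_)
    · rw [qPi_apply, toX_cons, mul_apply_replicate_append f _ h0, mul_cons]
      congr 1
      · by_cases hν : ν = 1
        · subst hν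
          rw [tSubst_apply, inv_one, mulWord_one, ← toX_cons (n, μ)]
          rfl
        · rw [h2 hν, zero_mul, qPi_apply, toX_nil, h2 hν, zero_mul]
      · have e1 : ∀ F : NCSeries (XLetter Γ) k, F (mulWord μ (toX u)) = qPi (tSubst μ⁻¹ F) u := by
          intro F; rw [qPi_apply, tSubst_apply, inv_inv]
        have e2 : qPi (tSubst μ⁻¹ (shiftWord s f)) = shift (n, μ) (qPi f) := by
          ext v
          rw [shift_apply, qPi_apply, qPi_apply, toX_cons, tSubst_apply, inv_inv, shiftWord, hs,
            List.append_assoc]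
          rfl
        refine (e1 _).trans ?_
        rw [tSubst_mul, tSubst_tSubst, hh, e2]
    · rw [tSubst_apply, mulWord_append, shiftWord, ← List.append_assoc]
      exact h0 _
    · rw [tSubst_apply, mulWord_append, shiftWord, ← List.append_assoc, inv_inv]
      exact h1 _ _ fun h => hσ (eq_inv_mul_iff_mul_eq.2 h)
    · rw [tSubst_apply, mulWord_nil, shiftWord, List.append_nil]
      exact h1 _ _ fun h => hne (by rw [h, inv_mul_cancel])

theorem qPi_mul_letter_mul_tSubst (f g : NCSeries (XLetter Γ) k) (ν : Γ) :
    qPi (f * letter (some ν) * tSubst ν g) = qPi (f * letter (some ν)) * qPi g := by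
  classical
  refine qPi_mul_tSubst _ _ _ (fun w => ?_) (fun w σ hσ => ?_) fun _ => mul_letter_nil _ _
  · rw [mul_letter_append, if_neg (by simp)]
  · rw [mul_letter_append, if_neg (by simpa using hσ)]

open Classical in
theorem mul_pow_letter_none_apply (f : NCSeries (XLetter Γ) k) (m i : ℕ)
    (u : List (YLetter Γ)) : (f * letter none ^ m : NCSeries (XLetter Γ) k) (toX u ++ List.replicate i none) =
      if m ≤ i then f (toX u ++ List.replicate (i - m) none) else 0 := by
  induction m generalizing i with
  | zero => simp
  | succ m ih =>
    rw [pow_succ, ← mul_assoc]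
    cases i with
    | zero =>
      rw [if_neg (by omega), List.replicate_zero, List.append_nil]
      exact congrFun (qPi_mul_letter_none (f * letter none ^ m)) u
    | succ i =>
      rw [List.replicate_succ', ← List.append_assoc, mul_letter_append, if_pos rfl, ih]
      simp only [Nat.add_le_add_iff_right, Nat.add_sub_add_right]

theorem pow_letter_none_mul_apply (f : NCSeries (XLetter Γ) k) (m i : ℕ) (σ : Γ)
    (w : List (XLetter Γ)) : (letter none ^ m * f : NCSeries (XLetter Γ) k) (List.replicate i none ++ some σ :: w) =
      if m ≤ i then f (List.replicate (i - m) none ++ some σ :: w) else 0 := by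
  classical
  induction m generalizing i with
  | zero => simp
  | succ m ih =>
    rw [pow_succ', mul_assoc]
    cases i with
    | zero => rw [List.replicate_zero, List.nil_append, letter_mul_cons, if_neg (by simp)]; simp
    | succ i =>
      rw [List.replicate_succ, List.cons_append, letter_mul_cons, if_pos rfl, ih]
      simp only [Nat.add_le_add_iff_right, Nat.add_sub_add_right]

/-- The series `y_{n,ν}` in the `x_σ`. -/
theorem qPi_yLetter (n : ℕ+) (ν : Γ) :
    qPi (letter none ^ ((n : ℕ) - 1) * letter (some ν) : NCSeries (XLetter Γ) k) =
      letter (n, ν) := by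
  classical
  ext u
  rw [qPi_apply]
  cases u with
  | nil => rw [toX_nil, mul_letter_nil, letter_nil]
  | cons a u =>
    have hn := n.pos
    have ha := a.1.pos
    rw [toX_cons, pow_letter_none_mul_apply]
    by_cases h : (n : ℕ) - 1 ≤ (a.1 : ℕ) - 1
    · rw [if_pos h]
      by_cases h' : (a.1 : ℕ) = n
      · obtain ⟨m, μ⟩ := a
        obtain rfl : m = n := PNat.eq h'
        rw [Nat.sub_self, List.replicate_zero, List.nil_append]
        simp only [letter, List.cons.injEq, Option.some.injEq, Prod.mk.injEq, true_and]
        congr 2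
        rw [eq_iff_iff]
        constructor
        · intro h; cases u with
          | nil => rfl
          | cons b u => simp [toX_cons] at h
        · rintro rfl; rfl
      · have e : (a.1 : ℕ) - 1 - (n - 1) = (a.1 - n - 1) + 1 := by omega
        rw [e, List.replicate_succ, List.cons_append]
        rw [letter, letter, if_neg (by simp), if_neg]
        simp only [List.cons.injEq, not_and]
        rintro rfl
        exact absurd rfl h'
    · rw [if_neg h, letter, if_neg]
      simp only [List.cons.injEq, not_and]
      rintro rfl
      exact absurd le_rfl h

end Projection
end NCSeries

/-! ### The action of `s_ψ` on the side of `Y` -/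

namespace NCSeries

open QuasiShuffle

/-! ### Series in a single letter -/

section PowLetter

variable {A k : Type*} [CommRing k]

theorem word_replicate (a : A) (n : ℕ) :
    (word (List.replicate n a) : NCSeries A k) = letter a ^ n := by
  simp [word]

open Classical in
theorem letter_pow_apply (a : A) (n : ℕ) (w : List A) :
    (letter a ^ n : NCSeries A k) w = if w = List.replicate n a then 1 else 0 := by
  rw [← word_replicate, word_apply]

open Classical in
/-- A series in one letter commutes with this letter. -/
theorem mul_letter_comm_of_support {f : NCSeries A k} {a : A}
    (hf : ∀ w, w ≠ List.replicate w.length a → f w = 0) : f * letter a = letter a * f := by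
  have hl : ∀ u, (letter a * f : NCSeries A k) u =
      if u ≠ [] ∧ u = List.replicate u.length a then f (List.replicate (u.length - 1) a) else 0 := by
    intro u
    cases u with
    | nil => simp
    | cons b v =>
      rw [letter_mul_cons]
      by_cases hb : b = a
      · subst hb
        rw [if_pos rfl]
        by_cases hv : v = List.replicate v.length b
        · have h2 : b :: v = List.replicate (b :: v).length b := by
            rw [List.length_cons, List.replicate_succ, ← hv]
          rw [if_pos ⟨by simp, h2⟩, List.length_cons, Nat.add_sub_cancel, ← hv]
        · rw [hf v hv, if_neg]
          rintro ⟨-, h⟩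
          rw [List.length_cons, List.replicate_succ, List.cons.injEq] at h
          exact hv h.2
      · rw [if_neg hb, if_neg]
        rintro ⟨-, h⟩
        rw [List.length_cons, List.replicate_succ, List.cons.injEq] at h
        exact hb h.1
  have hr : ∀ u, (f * letter a : NCSeries A k) u =
      if u ≠ [] ∧ u = List.replicate u.length a then f (List.replicate (u.length - 1) a) else 0 := by
    intro u
    rcases List.eq_nil_or_concat u with rfl | ⟨v, b, rfl⟩
    · simp
    · rw [List.concat_eq_append, mul_letter_append]
      have hlen : (v ++ [b]).length = v.length + 1 := by simp
      by_cases hb : b = a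
      · subst hb
        rw [if_pos rfl]
        by_cases hv : v = List.replicate v.length b
        · have h2 : v ++ [b] = List.replicate (v ++ [b]).length b := by
            rw [hlen, List.replicate_succ', ← hv]
          rw [if_pos ⟨by simp, h2⟩, hlen, Nat.add_sub_cancel, ← hv]
        · rw [hf v hv, if_neg]
          rintro ⟨-, h⟩
          rw [hlen, List.replicate_succ'] at h
          exact hv (List.append_inj_left' h rfl)
      · rw [if_neg hb, if_neg]
        rintro ⟨-, h⟩
        rw [hlen, List.replicate_succ'] at h
        have := List.append_inj_right' h rfl
        simp at this
        exact hb this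
  ext u
  rw [hl, hr]

end PowLetter

/-! ### The correction series, a series in `y_{1,1}` -/

section Correction

variable {Γ k : Type*} [CommGroup Γ] [CommRing k] [Algebra ℚ k]

open Classical in
theorem corrSum_apply (f : NCSeries (XLetter Γ) k) (w : List (YLetter Γ)) :
    corrSum f w = if 2 ≤ w.length ∧ w = List.replicate w.length (1, 1) then
      ((-1 : ℚ) ^ (w.length - 1) / w.length) •
        f (List.replicate (w.length - 1) none ++ [some 1]) else 0 := by
  have hy : (yLetter 1 1 : NCSeries (YLetter Γ) k) = letter (1, 1) := by
    rw [yLetter, dif_pos one_pos]; rfl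
  have hterm : ∀ n, n ≠ w.length → (letter ((1 : ℕ+), (1 : Γ)) ^ n : NCSeries _ k) w = 0 := by
    intro n hn
    rw [letter_pow_apply, if_neg]
    intro h
    apply hn
    rw [h, List.length_replicate]
  rw [corrSum, hy]
  by_cases h2 : 2 ≤ w.length
  · rw [Finset.sum_eq_single_of_mem w.length (by simp [h2]), letter_pow_apply]
    · by_cases h : w = List.replicate w.length (1, 1)
      · rw [if_pos h, if_pos ⟨h2, h⟩, mul_one, piY]
        congr 2
        rw [List.flatMap_singleton, yWord, Nat.toPNat'_coe, if_pos (by omega)]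
      · rw [if_neg h, if_neg fun h' => h h'.2, mul_zero, smul_zero]
    · intro n _ hn; rw [hterm n hn, mul_zero, smul_zero]
  · rw [if_neg fun h => h2 h.1, Finset.sum_eq_zero]
    intro n hn
    rw [hterm n (by simp at hn; omega), mul_zero, smul_zero]

theorem corrSum_of_ne {f : NCSeries (XLetter Γ) k} {w : List (YLetter Γ)}
    (h : w ≠ List.replicate w.length (1, 1)) : corrSum f w = 0 := by
  rw [corrSum_apply, if_neg fun h' => h h'.2]

theorem corrSum_of_lt {f : NCSeries (XLetter Γ) k} {w : List (YLetter Γ)}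
    (h : w.length < 2) : corrSum f w = 0 := by
  rw [corrSum_apply, if_neg fun h' => by omega]

theorem corrSum_nil (f : NCSeries (XLetter Γ) k) : corrSum f [] = 0 := corrSum_of_lt (by simp)

theorem corrSum_congr {f g : NCSeries (XLetter Γ) k}
    (h : ∀ n, f (List.replicate n none ++ [some 1]) = g (List.replicate n none ++ [some 1])) :
    corrSum f = corrSum g := by
  ext w; rw [corrSum_apply, corrSum_apply, h]

theorem corrSum_add (f g : NCSeries (XLetter Γ) k) :
    corrSum (f + g) = corrSum f + corrSum g := by
  ext w
  rw [add_apply, corrSum_apply, corrSum_apply, corrSum_apply]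
  split_ifs
  · rw [add_apply, smul_add]
  · rw [add_zero]

theorem corrSum_smul (c : k) (f : NCSeries (XLetter Γ) k) :
    corrSum (c • f) = c • corrSum f := by
  ext w
  rw [smul_apply, corrSum_apply, corrSum_apply]
  split_ifs
  · rw [smul_apply, mul_smul_comm]
  · rw [mul_zero]

theorem corrSum_zero : corrSum (0 : NCSeries (XLetter Γ) k) = 0 := by
  ext w
  rw [corrSum_apply]
  split_ifs
  · rw [zero_apply, smul_zero]; rfl
  · rfl

theorem corrSum_deg {f : NCSeries (XLetter Γ) k} {w : List (YLetter Γ)} (h : deg w ≠ 1) :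
    corrSum f w = 0 := by
  refine corrSum_of_ne fun hw => h ?_
  rw [hw, deg, List.map_replicate]
  simp

theorem corrSum_mul_letter (f : NCSeries (XLetter Γ) k) :
    corrSum f * letter (1, 1) = letter (1, 1) * corrSum f :=
  mul_letter_comm_of_support fun _ h => corrSum_of_ne h

/-- `stepDer` reads coefficients at words with a letter of index at least two, whereas the
correction is supported on powers of `y_{1,1}`. -/
theorem stepDer_corrSum (f : NCSeries (XLetter Γ) k) : stepDer (corrSum f) = 0 := by
  refine stepDer_eq_zero fun u v n ν => corrSum_of_ne fun h => ?_
  have hm : ((n + 1, ν) : YLetter Γ) ∈ List.replicate (u ++ (n + 1, ν) :: v).length (1, 1) := by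
    rw [← h]; simp
  have := congrArg (fun y => ((Prod.fst y : ℕ+) : ℕ)) (List.eq_of_mem_replicate hm)
  simp at this

end Correction

/-! ### The operators induced by `s_ψ` on series in `Y` -/

section StarOperator

variable {Γ k : Type*} [CommGroup Γ] [Fintype Γ] [CommRing k]

theorem length_toX (u : List (YLetter Γ)) : (toX u).length = wordWt (stuffle Γ).wt u := by
  induction u with
  | nil => rfl
  | cons a u ih =>
    have := a.1.pos
    rw [toX_cons, wordWt_cons, stuffle_wt, ← ih]
    simp
    omega

theorem qPi_isLocal : IsLocal (fun _ => 1) (stuffle Γ).wt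
    (qPi : NCSeries (XLetter Γ) k →ₗ[k] NCSeries (YLetter Γ) k) := fun n f hf u hu => by
  rw [qPi_apply]
  exact hf _ (by rwa [wordWt_one, length_toX])

theorem qSec_isLocal : IsLocal (stuffle Γ).wt (fun _ => 1)
    (qSec : NCSeries (YLetter Γ) k →ₗ[k] NCSeries (XLetter Γ) k) := fun n f hf w hw => by
  rw [qSec_apply]
  split_ifs with h
  · exact hf _ (by rwa [← length_toX, h.choose_spec, ← wordWt_one])
  · rfl

theorem sOp_mul_letter_none (ψ f : NCSeries (XLetter Γ) k) :
    sOp ψ (f * letter none) = sOp ψ f * letter none := by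
  have : dLetter ψ none = 0 := rfl
  rw [sOp, dOp_mul, dOp_letter, this, sOp]
  noncomm_ring

/-- The operator on the series in the `y_{n,ν}` that corresponds to `s_ψ`. -/
noncomputable def yOp (ψ : NCSeries (XLetter Γ) k) :
    NCSeries (YLetter Γ) k →ₗ[k] NCSeries (YLetter Γ) k :=
  qPi ∘ₗ sLin ψ ∘ₗ qSec

/-- `s_ψ` commutes with right multiplication by `x_0` because `d_ψ(x_0) = 0`. It therefore preserves
the kernel of `qPi`, and the choice of the section in `yOp` does not matter. -/
theorem qPi_sOp (ψ f : NCSeries (XLetter Γ) k) : qPi (sOp ψ f) = yOp ψ (qPi f) := by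
  have h : qPi (f - qSec (qPi f)) = 0 := by rw [map_sub, qPi_qSec, sub_self]
  have h2 := eq_mul_letter_none h
  have h3 : qPi (sOp ψ (f - qSec (qPi f))) = 0 := by
    rw [h2, sOp_mul_letter_none, qPi_mul_letter_none]
  rw [sOp_sub, map_sub, sub_eq_zero] at h3
  exact h3

theorem yOp_isRaising {ψ : NCSeries (XLetter Γ) k} (hψ : ψ [] = 0) :
    IsRaising (stuffle Γ).wt (yOp ψ) := fun n f hf =>
  qPi_isLocal _ _ (sLin_isRaising hψ n _ (qSec_isLocal n f hf))

theorem qPi_one : qPi (1 : NCSeries (XLetter Γ) k) = 1 := by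
  ext u
  rw [qPi_apply]
  cases u with
  | nil => rfl
  | cons a u =>
    rw [one_apply_of_ne_nil (by rw [Ne, toX_eq_nil]; simp), one_cons]

theorem yOp_one (ψ : NCSeries (XLetter Γ) k) : yOp ψ 1 = qPi ψ := by
  rw [← qPi_one, ← qPi_sOp, sOp_one]

theorem dOp_pow_letter_none (ψ : NCSeries (XLetter Γ) k) (m : ℕ) :
    dOp ψ (letter none ^ m) = 0 := by
  induction m with
  | zero =>
    have := dOp_mul ψ 1 1
    simpa using this
  | succ m ih =>
    have : dLetter ψ none = 0 := rfl
    rw [pow_succ, dOp_mul, ih, dOp_letter, this]; simp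

/-- Of the two terms of `d_ψ(x_ν)`, the one starting with `x_ν` combines with `d_ψ(t_ν(f)) =
t_ν(d_ψ(f))` to give `t_ν(s_ψ(f))`. The other one joins `ψ x_0^m` in the value on the letter. -/
theorem sOp_yLetter_mul (ψ f : NCSeries (XLetter Γ) k) (m : ℕ) (ν : Γ) :
    sOp ψ (letter none ^ m * letter (some ν) * tSubst ν f) =
      (ψ * letter none ^ m - letter none ^ m * tSubst ν ψ) * letter (some ν) * tSubst ν f +
        letter none ^ m * letter (some ν) * tSubst ν (sOp ψ f) := by
  have h : dLetter ψ (some ν) = letter (some ν) * tSubst ν ψ - tSubst ν ψ * letter (some ν) := rfl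
  rw [sOp, dOp_mul, dOp_mul, dOp_pow_letter_none, dOp_letter, h, ← tSubst_dOp, sOp, tSubst_add,
    tSubst_mul]
  noncomm_ring

theorem yOp_letter_mul (ψ : NCSeries (XLetter Γ) k) (a : YLetter Γ) (f : NCSeries (YLetter Γ) k) :
    yOp ψ (letter a * f) = qPi ((ψ * letter none ^ ((a.1 : ℕ) - 1) -
      letter none ^ ((a.1 : ℕ) - 1) * tSubst a.2 ψ) * letter (some a.2)) * f +
        letter a * yOp ψ f := by
  have h : letter a * f = qPi (letter none ^ ((a.1 : ℕ) - 1) * letter (some a.2) *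
      tSubst a.2 (qSec f)) := by
    rw [qPi_mul_letter_mul_tSubst, qPi_yLetter, qPi_qSec]
  rw [h, ← qPi_sOp, sOp_yLetter_mul, map_add, qPi_mul_letter_mul_tSubst,
    qPi_mul_letter_mul_tSubst, qPi_yLetter, qPi_qSec, qPi_sOp, qPi_qSec]

theorem tSubst_one (f : NCSeries (XLetter Γ) k) : tSubst 1 f = f := by
  ext w; rw [tSubst_apply, inv_one, mulWord_one]

/-- The value attached to `y_{1,1} = x_1` is `(ψ - t_1(ψ)) x_1 = 0`. This is what makes corrections
commute with `yOp`. -/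
theorem yOp_letter_one_mul (ψ : NCSeries (XLetter Γ) k) (f : NCSeries (YLetter Γ) k) :
    yOp ψ (letter (1, 1) * f) = letter (1, 1) * yOp ψ f := by
  rw [yOp_letter_mul]
  simp [tSubst_one]

variable [Algebra ℚ k]

/-- An operator that commutes with left multiplication by `y_{1,1}` commutes with that by its
powers, and by locality with that by the correction, a series in `y_{1,1}` alone. -/
theorem commute_lmulOp_corrSum {T : NCSeries (YLetter Γ) k →ₗ[k] NCSeries (YLetter Γ) k}
    (hT : IsLocal (stuffle Γ).wt (stuffle Γ).wt T)
    (h1 : ∀ f, T (letter (1, 1) * f) = letter (1, 1) * T f) (Φ : NCSeries (XLetter Γ) k) :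
    Commute (lmulOp (corrSum Φ)) T := by
  refine LinearMap.ext fun f => ?_
  change corrSum Φ * T f = T (corrSum Φ * f)
  ext w
  obtain ⟨r, hr, h⟩ := exists_truncation ((stuffle Γ).finite_wt (wordWt (stuffle Γ).wt w + 1))
    (corrSum Φ)
  have hpow : ∀ n, T (letter (1, 1) ^ n * f) = letter (1, 1) ^ n * T f := by
    intro n
    induction n with
    | zero => simp
    | succ n ih => rw [pow_succ', mul_assoc, h1, ih, mul_assoc]
  have hterm : ∀ u, T ((corrSum Φ u • word u) * f) = (corrSum Φ u • word u) * T f := by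
    intro u
    by_cases hu : u = List.replicate u.length (1, 1)
    · rw [smul_mul, smul_mul, map_smul, hu, word_replicate, hpow]
    · rw [corrSum_of_ne hu]; simp
  have h2 : (r * T f) w = 0 :=
    hr.mul (vanishBelow_zero_left _) w (by omega)
  have h3 : T (r * f) w = 0 :=
    hT _ _ (hr.mul (vanishBelow_zero_left _)) w (by omega)
  rw [h, add_mul, add_mul, map_add, Finset.sum_mul, Finset.sum_mul, map_sum, add_apply, add_apply,
    h2, h3, Finset.sum_congr rfl fun u _ => hterm u]

theorem commute_yOp_corrSum {ψ : NCSeries (XLetter Γ) k} (hψ : ψ [] = 0)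
    (Φ : NCSeries (XLetter Γ) k) : Commute (lmulOp (corrSum Φ)) (yOp ψ) :=
  commute_lmulOp_corrSum (yOp_isRaising hψ).isLocal (yOp_letter_one_mul ψ) Φ

theorem corrSum_mul_comm (Φ ψ : NCSeries (XLetter Γ) k) :
    corrSum Φ * corrSum ψ = corrSum ψ * corrSum Φ := by
  have h := commute_lmulOp_corrSum (T := lmulOp (corrSum ψ))
    (lmulOp_isRaising (vanishBelow_one_of_nil (fun a => a.1.pos) (corrSum_nil ψ))).isLocal
    (fun f => by
      rw [lmulOp_apply, lmulOp_apply, ← mul_assoc, ← mul_assoc, corrSum_mul_letter]) Φ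
  have h2 := LinearMap.congr_fun h 1
  simpa [lmulOp_apply] using h2

theorem commute_lmulOp_corrSum_corrSum (Φ ψ : NCSeries (XLetter Γ) k) :
    Commute (lmulOp (corrSum Φ)) (lmulOp (corrSum ψ)) :=
  LinearMap.ext fun f => by
    change corrSum Φ * (corrSum ψ * f) = corrSum ψ * (corrSum Φ * f)
    rw [← mul_assoc, ← mul_assoc, corrSum_mul_comm]

/-- The operator that maps `1` to `ψ_*` and corresponds to `s_ψ`. -/
noncomputable def starOp (ψ : NCSeries (XLetter Γ) k) :
    NCSeries (YLetter Γ) k →ₗ[k] NCSeries (YLetter Γ) k :=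
  lmulOp (corrSum ψ) + yOp ψ

theorem starOp_apply (ψ : NCSeries (XLetter Γ) k) (f : NCSeries (YLetter Γ) k) :
    starOp ψ f = corrSum ψ * f + yOp ψ f := rfl

theorem lmulOp_corrSum_isRaising (ψ : NCSeries (XLetter Γ) k) :
    IsRaising (stuffle Γ).wt (lmulOp (corrSum ψ)) :=
  lmulOp_isRaising (vanishBelow_one_of_nil (fun a => a.1.pos) (corrSum_nil ψ))

theorem starOp_isRaising {ψ : NCSeries (XLetter Γ) k} (hψ : ψ [] = 0) :
    IsRaising (stuffle Γ).wt (starOp ψ) :=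
  (lmulOp_corrSum_isRaising ψ).add (yOp_isRaising hψ)

theorem starOp_one (ψ : NCSeries (XLetter Γ) k) : starOp ψ 1 = starLie ψ := by
  rw [starOp_apply, yOp_one, mul_one, add_comm]; rfl

/-- The values on letters of the derivation `v ↦ starOp ψ v - v ψ_*`. -/
noncomputable def starValue (ψ : NCSeries (XLetter Γ) k) (a : YLetter Γ) :
    NCSeries (YLetter Γ) k :=
  qPi ((ψ * letter none ^ ((a.1 : ℕ) - 1) -
      letter none ^ ((a.1 : ℕ) - 1) * tSubst a.2 ψ) * letter (some a.2)) +
    (corrSum ψ * letter a - letter a * corrSum ψ)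

theorem starOp_letter_mul (ψ : NCSeries (XLetter Γ) k) (a : YLetter Γ)
    (f : NCSeries (YLetter Γ) k) :
    starOp ψ (letter a * f) = starValue ψ a * f + letter a * starOp ψ f := by
  rw [starOp_apply, starOp_apply, yOp_letter_mul, starValue]
  noncomm_ring

theorem starValue_one (ψ : NCSeries (XLetter Γ) k) : starValue ψ (1, 1) = 0 := by
  rw [starValue, corrSum_mul_letter]
  simp [tSubst_one]

/-! ### The sequences attached to an element of `dmr_0` -/

/-- The series `u ↦ (ψ | u x_0^i)` in the `y_{n,ν}`, corrected for `i = 0`. -/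
noncomputable def coefSeq (ψ : NCSeries (XLetter Γ) k) (i : ℕ) : NCSeries (YLetter Γ) k :=
  fun u => ψ (toX u ++ List.replicate i none) + if i = 0 then corrSum ψ u else 0

theorem coefSeq_apply (ψ : NCSeries (XLetter Γ) k) (i : ℕ) (u : List (YLetter Γ)) :
    coefSeq ψ i u = ψ (toX u ++ List.replicate i none) + if i = 0 then corrSum ψ u else 0 := rfl

theorem coefSeq_zero (ψ : NCSeries (XLetter Γ) k) : coefSeq ψ 0 = starLie ψ := by
  ext u
  rw [coefSeq_apply, if_pos rfl, List.replicate_zero, List.append_nil]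
  rfl

/-- The image of `coefSeq` under the antiautomorphism `y_{n,ν} ↦ (-1)^n y_{n,ν⁻¹}`, up to sign. -/
noncomputable def antiCoefSeq (ψ : NCSeries (XLetter Γ) k) (i : ℕ) : NCSeries (YLetter Γ) k :=
  ((-1 : k) ^ i) • antiInv (coefSeq ψ i)

/-- The letter `x_0` is inserted at one of the `m + 1` places of the initial block, all giving the
same word, or after `x_σ`. -/
theorem cop_none_replicate_append (f : NCSeries (XLetter Γ) k) (m : ℕ) (σ : Γ)
    (w : List (XLetter Γ)) :
    (shuffle (XLetter Γ)).cop f [none] (List.replicate m none ++ some σ :: w) =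
      (m + 1) * f (List.replicate (m + 1) none ++ some σ :: w) +
        (shuffle (XLetter Γ)).cop (shiftWord (List.replicate m none ++ [some σ]) f) [none] w := by
  have ho : ∀ a b (f : NCSeries (XLetter Γ) k), (shuffle (XLetter Γ)).opShift a b f = 0 :=
    fun _ _ _ => rfl
  induction m generalizing f with
  | zero =>
    rw [List.replicate_zero, List.nil_append, cop_cons, ho, cop_zero, cop_nil_left]
    simp only [zero_apply, add_zero, shift_apply, Nat.cast_zero, zero_add, one_mul]
    rfl
  | succ m ih =>
    rw [List.replicate_succ, List.cons_append, cop_cons, ho, cop_zero, cop_nil_left, ih]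
    simp only [zero_apply, add_zero, shift_apply]
    have : shiftWord (List.replicate m none ++ [some σ]) (shift none f) =
        shiftWord (none :: List.replicate m none ++ [some σ]) f := rfl
    rw [this]
    simp only [List.replicate_succ, List.cons_append]
    push_cast
    ring

/-- The series in the `y_{n,ν}` with coefficients `(f | p(u) x_0^i)`, the indices being multiplied
by `c`. -/
def pullToX (c : Γ) (i : ℕ) (f : NCSeries (XLetter Γ) k) : NCSeries (YLetter Γ) k :=
  fun u => f (mulWord c (toX u) ++ List.replicate i none)

theorem pullToX_apply (c : Γ) (i : ℕ) (f : NCSeries (XLetter Γ) k) (u : List (YLetter Γ)) :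
    pullToX c i f u = f (mulWord c (toX u) ++ List.replicate i none) := rfl

/-- Inserting `x_0` into the block of a letter `y_{n,ν}` gives `y_{n+1,ν}` in `n` ways, which is the
coefficient in `stepDer`; inserting it into the final `x_0^i` gives `x_0^{i+1}` in `i + 1` ways. -/
theorem cop_none_toX (c : Γ) (i : ℕ) (f : NCSeries (XLetter Γ) k) (u : List (YLetter Γ)) :
    (shuffle (XLetter Γ)).cop f [none] (mulWord c (toX u) ++ List.replicate i none) =
      stepDer (pullToX c i f) u +
        (i + 1) * f (mulWord c (toX u) ++ List.replicate (i + 1) none) := by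
  induction u generalizing c f with
  | nil =>
    rw [toX_nil, mulWord_nil, List.nil_append, List.nil_append, cop_replicate, stepDer_nil,
      zero_add]
  | cons a u ih =>
    have ha := a.1.pos
    have e : ∀ l, mulWord c (toX (a :: u)) ++ l = List.replicate ((a.1 : ℕ) - 1) none ++
        some (c * a.2) :: (mulWord (c * a.2) (toX u) ++ l) := by
      intro l
      rw [toX_cons, mulWord_append, mulWord_replicate, mulWord_some, mulWord_mulWord,
        List.append_assoc]
      rfl
    have e' : mulWord c (toX ((a.1 + 1, a.2) :: u)) ++ List.replicate i none =
        List.replicate ((a.1 : ℕ) - 1 + 1) none ++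
        some (c * a.2) :: (mulWord (c * a.2) (toX u) ++ List.replicate i none) := by
      rw [toX_cons, mulWord_append, mulWord_replicate, mulWord_some, mulWord_mulWord,
        List.append_assoc, PNat.add_coe, PNat.one_coe, Nat.add_sub_cancel, Nat.sub_add_cancel ha]
      rfl
    have hc : (((a.1 : ℕ) - 1 : ℕ) : k) + 1 = ((a.1 : ℕ) : k) := by
      rw [← Nat.cast_succ, Nat.succ_eq_add_one, Nat.sub_add_cancel ha]
    have hsh : shift a (pullToX c i f) = pullToX (c * a.2) i
        (shiftWord (List.replicate ((a.1 : ℕ) - 1) none ++ [some (c * a.2)]) f) := by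
      ext v
      change f (mulWord c (toX (a :: v)) ++ List.replicate i none) = f _
      congr 1
      rw [toX_cons, mulWord_append, mulWord_replicate, mulWord_some, mulWord_mulWord]
      simp
    rw [e, cop_none_replicate_append, ih, hc, stepDer_cons, hsh, pullToX_apply, e, add_assoc, e']
    congr 2
    rw [shiftWord, List.append_assoc]
    rfl

variable {ψ : NCSeries (XLetter Γ) k}

/-- For a primitive `ψ` with `(ψ | x_0) = 0`, the insertions of `x_0` into any word have total
coefficient zero. The correction present for `i = 0` is killed by `stepDer`. -/
theorem coefSeq_succ (hψ : (shuffle (XLetter Γ)).IsPrimitive ψ) (h0 : ψ [none] = 0) (i : ℕ)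
    (u : List (YLetter Γ)) :
    ((i : k) + 1) * coefSeq ψ (i + 1) u = -stepDer (coefSeq ψ i) u := by
  have h1 := cop_none_toX 1 i ψ u
  have h2 : (shuffle (XLetter Γ)).cop ψ [none] (mulWord 1 (toX u) ++ List.replicate i none) = 0 := by
    by_cases h : mulWord 1 (toX u) ++ List.replicate i none = []
    · rw [h, cop_nil_right, h0]
    · exact hψ.cop_apply (by simp) h
  have h3 : coefSeq ψ i = pullToX 1 i ψ + if i = 0 then corrSum ψ else 0 := by
    ext v
    rw [add_apply, pullToX_apply, mulWord_one, coefSeq_apply]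
    congr 1
    split_ifs <;> rfl
  have h4 : stepDer (if i = 0 then corrSum ψ else 0) = (0 : NCSeries (YLetter Γ) k) := by
    split_ifs
    · exact stepDer_corrSum ψ
    · exact stepDer_eq_zero fun _ _ _ _ => rfl
  rw [h3, stepDer_add, h4, add_zero, coefSeq_apply, if_neg (Nat.succ_ne_zero i), add_zero]
  rw [h2, mulWord_one] at h1
  linear_combination -h1

theorem coefSeq_isPrimitive (hψ : (shuffle (XLetter Γ)).IsPrimitive ψ) (h0 : ψ [none] = 0)
    (hs : (stuffle Γ).IsPrimitive (starLie ψ)) (i : ℕ) :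
    (stuffle Γ).IsPrimitive (coefSeq ψ i) := by
  induction i with
  | zero => rwa [coefSeq_zero]
  | succ i ih =>
    have h : ((i : k) + 1) • coefSeq ψ (i + 1) = (-1 : k) • stepDer (coefSeq ψ i) := by
      ext u
      rw [smul_apply, smul_apply, coefSeq_succ hψ h0]
      ring
    have hp : (stuffle Γ).IsPrimitive (((i : k) + 1) • coefSeq ψ (i + 1)) := by
      rw [h]; exact (stepDer_isPrimitive ih).smul _
    refine isPrimitive_of_cop_apply ?_ fun u v hu hv => natCast_succ_mul_cancel (n := i) ?_
    · exact natCast_succ_mul_cancel (n := i) hp.apply_nil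
    · rw [← cop_smul_apply]; exact hp.cop_apply hu hv

/-- In length one the recursion passes from `(i, n + 1)` to `(i + 1, n)`, where `n` is the index of
the letter. It preserves the sign `(-1)^{i+n}`, so the parity condition propagates from `i = 0`. -/
theorem coefSeq_add_antiCoefSeq (hψ : (shuffle (XLetter Γ)).IsPrimitive ψ) (h0 : ψ [none] = 0)
    (hpar : LengthOneParity Γ k ψ) (i : ℕ) (a : YLetter Γ) :
    coefSeq ψ i [a] + antiCoefSeq ψ i [a] = 0 := by
  have hanti : ∀ i (a : YLetter Γ), antiCoefSeq ψ i [a] =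
      (-1) ^ i * (-1) ^ (a.1 : ℕ) * coefSeq ψ i [(a.1, a.2⁻¹)] := by
    intro i a
    rw [antiCoefSeq, smul_apply, antiInv_apply, revInv_cons, revInv_nil, List.nil_append,
      wordWt_cons, wordWt_nil, stuffle_wt, add_zero, mul_assoc]
  induction i generalizing a with
  | zero =>
    rw [hanti, coefSeq_zero, pow_zero, one_mul]
    exact hpar a.1 a.2
  | succ i ih =>
    have hstep : ∀ a : YLetter Γ, ((i : k) + 1) * coefSeq ψ (i + 1) [a] =
        -(((a.1 : ℕ) : k) * coefSeq ψ i [(a.1 + 1, a.2)]) := by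
      intro a
      rw [coefSeq_succ hψ h0, stepDer_cons, stepDer_nil, add_zero]
    have h1 := ih (a.1 + 1, a.2)
    rw [hanti, PNat.add_coe, PNat.one_coe] at h1
    have h2 := hstep a
    have h3 := hstep (a.1, a.2⁻¹)
    refine natCast_succ_mul_cancel (n := i) ?_
    rw [hanti]
    rw [pow_succ] at h1 ⊢
    linear_combination h2 + (-1) ^ i * -1 * (-1) ^ (a.1 : ℕ) * h3 - ((a.1 : ℕ) : k) * h1

/-- For `ν = 1` and the even index `n + 1`, the parity condition says that twice the coefficient is
zero. It is needed for the even terms of the correction and for `(ψ | x_0 x_1)`. -/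
theorem apply_even_of_parity (hpar : LengthOneParity Γ k ψ) {n : ℕ} (hn : Odd n) :
    ψ (List.replicate n none ++ [some 1]) = 0 := by
  have h := hpar n.succPNat 1
  have h1 : starLie ψ [(n.succPNat, (1 : Γ))] = ψ (List.replicate n none ++ [some 1]) := by
    change ψ (toX [(n.succPNat, (1 : Γ))]) + corrSum ψ [(n.succPNat, (1 : Γ))] = _
    rw [corrSum_of_lt (by simp), add_zero, toX_singleton, Nat.succPNat_coe, Nat.succ_sub_one]
  rw [inv_one, h1, Nat.succPNat_coe, (Nat.succ_eq_add_one n ▸ hn.add_one : Even n.succ).neg_one_pow]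
    at h
  refine natCast_succ_mul_cancel (n := 1) ?_
  rw [Nat.cast_one]
  linear_combination h

/-- The correction is supported on powers of `y_{1,1}`, which the antiautomorphism multiplies by
`(-1)^n`; its coefficients at even powers vanish by parity. -/
theorem antiInv_corrSum (hpar : LengthOneParity Γ k ψ) :
    antiInv (corrSum ψ) = -corrSum ψ := by
  ext u
  rw [antiInv_apply, neg_apply]
  have hrep : ∀ n, revInv (List.replicate n ((1 : ℕ+), (1 : Γ))) = List.replicate n (1, 1) := by
    intro n; simp [revInv]
  have hinv : ∀ u : List (YLetter Γ), revInv (revInv u) = u := by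
    intro u
    simp [revInv, List.map_reverse, Function.comp_def]
  by_cases hu : u = List.replicate u.length (1, 1)
  · have hrev : revInv u = u := by rw [hu, hrep]
    rw [hrev]
    have hwt : wordWt (stuffle Γ).wt u = u.length := by
      conv_lhs => rw [hu]
      rw [wordWt, List.map_replicate]
      simp [stuffle_wt]
    rw [hwt]
    rcases Nat.even_or_odd u.length with he | ho
    · have : corrSum ψ u = 0 := by
        rw [corrSum_apply]
        split_ifs with h
        · rw [apply_even_of_parity hpar, smul_zero]
          obtain ⟨m, hm⟩ := he
          exact ⟨m - 1, by omega⟩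
        · rfl
      rw [this]; simp
    · rw [ho.neg_one_pow]; ring
  · have hu' : revInv u ≠ List.replicate (revInv u).length (1, 1) := by
      intro h
      apply hu
      have h2 := congrArg revInv h
      rw [hinv, hrep] at h2
      conv_lhs => rw [h2]
      simp [revInv]
    rw [corrSum_of_ne hu, corrSum_of_ne hu']; simp

theorem antiCoefSeq_apply (hpar : LengthOneParity Γ k ψ) (i : ℕ) (u : List (YLetter Γ)) :
    antiCoefSeq ψ i u = (-1) ^ (wordWt (stuffle Γ).wt u + i) *
      ψ (toX (revInv u) ++ List.replicate i none) - if i = 0 then corrSum ψ u else 0 := by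
  have h := congrFun (antiInv_corrSum hpar) u
  rw [antiInv_apply, neg_apply] at h
  rw [antiCoefSeq, smul_apply, antiInv_apply, coefSeq_apply, pow_add]
  by_cases hi : i = 0
  · subst hi
    rw [if_pos rfl, if_pos rfl]
    linear_combination h
  · rw [if_neg hi, if_neg hi]; ring

/-- Read backwards without its last letter, the word has its blocks in the opposite order, the
initial `x_0^i` comes last, and the indices relative to the last letter are inverted ratios. This
prepares for the shuffle antipode. -/
theorem replicate_append_toX_eq_reverse (u : List (YLetter Γ)) (i : ℕ) (μ : Γ) :
    List.replicate i none ++ some μ :: mulWord μ (toX u) =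
      (mulWord (μ * deg u) (toX (revInv u) ++ List.replicate i none)).reverse ++
        [some (μ * deg u)] := by
  induction u generalizing i μ with
  | nil => simp
  | cons a u ih =>
    have h1 : μ * (a.2 * deg u) * ((deg u)⁻¹ * a.2⁻¹) = μ := by
      rw [mul_assoc, mul_assoc, mul_inv_cancel_left, mul_inv_cancel, mul_one]
    rw [toX_cons, mulWord_append, mulWord_replicate, mulWord_some, mulWord_mulWord, ih,
      revInv_cons, toX_append_singleton, deg_revInv, deg_cons]
    simp only [mulWord_append, mulWord_replicate, mulWord_some, h1, List.reverse_append,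
      List.reverse_replicate, List.append_assoc, mul_assoc, List.reverse_cons, List.cons_append, List.nil_append]

/-- In `ψ x_0^{n-1} x_ν`, the coefficient at `v y_{m,μ}` involves `ψ` at `v` followed by
`x_0^{m-n}`. In `x_0^{n-1} t_ν(ψ) x_ν`, the first block is `y_{m,μ}`, and the antipode rewrites the
coefficient of `t_ν(ψ)` with this block at the end. The final `x_ν` imposes the degree `ν`, because
the last index of `toX u` is `deg u`. -/
theorem starValue_eq_pairValue (hψ : (shuffle (XLetter Γ)).IsPrimitive ψ)
    (hpar : LengthOneParity Γ k ψ) (a : YLetter Γ) :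
    starValue ψ a = pairValue (coefSeq ψ) (antiCoefSeq ψ) a := by
  classical
  obtain ⟨n, ν⟩ := a
  have hn := n.pos
  have hL : qPi (ψ * letter none ^ ((n : ℕ) - 1) * letter (some ν)) + corrSum ψ * letter (n, ν) =
      degPart ν (lastTerm (coefSeq ψ) n 0) := by
    ext u
    rw [add_apply, qPi_apply, degPart_apply]
    rcases List.eq_nil_or_concat u with rfl | ⟨v, b, rfl⟩
    · rw [toX_nil, mul_letter_nil, mul_letter_nil, lastTerm_nil, ite_self, add_zero]
    have hb := b.1.pos
    rw [List.concat_eq_append, toX_append_singleton, mul_letter_append, mul_letter_append,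
      mul_pow_letter_none_apply, lastTerm_append, deg_append, deg_cons, deg_nil, mul_one, zero_add]
    simp only [Option.some.injEq]
    by_cases hd : deg v * b.2 = ν
    · rw [if_pos hd, if_pos hd]
      by_cases hnb : (n : ℕ) ≤ b.1
      · rw [if_pos (by omega), if_pos hnb, coefSeq_apply,
          show (b.1 : ℕ) - 1 - (n - 1) = b.1 - n by omega]
        congr 1
        -- The correction sits in degree `1`. In that degree, `b = (n, ν)` holds exactly when the
        -- index of the sequence is `0`, so the commutator term in `starValue` matches the
        -- correction built into `coefSeq`.
        by_cases hv : deg v = 1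
        · have : b = (n, ν) ↔ (b.1 : ℕ) - n = 0 := by
            rw [hv, one_mul] at hd
            constructor
            · rintro rfl; simp
            · intro h; exact Prod.ext (PNat.eq (by change (b.1 : ℕ) = n; omega)) hd
          simp only [this]
        · rw [corrSum_deg hv, ite_self, ite_self]
      · have hne : ¬ (b = (n, ν)) := by
          rintro rfl
          exact hnb le_rfl
        rw [if_neg hne, if_neg hnb, add_zero, if_neg]
        omega
    · rw [if_neg hd, if_neg hd, zero_add]
      by_cases hv : deg v = 1
      · rw [if_neg]
        rintro rfl
        exact hd (by rw [hv, one_mul])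
      · rw [corrSum_deg hv, ite_self]
  have hF : -qPi (letter none ^ ((n : ℕ) - 1) * (tSubst ν ψ * letter (some ν))) -
      letter (n, ν) * corrSum ψ = degPart ν (firstTerm (antiCoefSeq ψ) n 0) := by
    ext u
    rw [sub_apply, neg_apply, qPi_apply, degPart_apply]
    cases u with
    | nil =>
      rw [toX_nil, firstTerm_nil, ite_self, mul_nil, mul_nil (tSubst ν ψ), mul_nil (letter (n, ν)),
        letter_nil, letter_nil, mul_zero, mul_zero, zero_mul, sub_zero, neg_zero]
    | cons b v =>
      have hb := b.1.pos
      rw [toX_cons, pow_letter_none_mul_apply, letter_mul_cons, firstTerm_cons, deg_cons, zero_add,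
        replicate_append_toX_eq_reverse, mul_letter_append]
      simp only [Option.some.injEq]
      by_cases hd : b.2 * deg v = ν
      · rw [if_pos hd, if_pos hd, hd, apply_reverse_of_isPrimitive (isPrimitive_tSubst hψ ν),
          List.reverse_reverse, tSubst_apply, mulWord_mulWord, inv_mul_cancel, mulWord_one]
        by_cases hnb : (n : ℕ) ≤ b.1
        · rw [if_pos (by omega), if_pos hnb, antiCoefSeq_apply hpar,
            show (b.1 : ℕ) - 1 - (n - 1) = b.1 - n by omega, List.length_reverse, mulWord_length,
            List.length_append, List.length_replicate, length_toX, wordWt_revInv, neg_neg]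
          congr 1
          by_cases hv : deg v = 1
          · have : b = (n, ν) ↔ (b.1 : ℕ) - n = 0 := by
              rw [hv, mul_one] at hd
              constructor
              · rintro rfl; simp
              · intro h; exact Prod.ext (PNat.eq (by change (b.1 : ℕ) = n; omega)) hd
            simp only [this]
          · rw [corrSum_deg hv, ite_self, ite_self]
        · have hne : ¬ (b = (n, ν)) := by
            rintro rfl
            exact hnb le_rfl
          rw [if_neg hne, if_neg hnb, sub_zero, neg_eq_zero, if_neg]
          omega
      · rw [if_neg hd, if_neg hd, ite_self, neg_zero, zero_sub, neg_eq_zero]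
        by_cases hv : deg v = 1
        · rw [if_neg]
          rintro rfl
          exact hd (by rw [hv, mul_one])
        · rw [corrSum_deg hv, ite_self]
  have hadd : pairValue (coefSeq ψ) (antiCoefSeq ψ) (n, ν) =
      degPart ν (lastTerm (coefSeq ψ) n 0) + degPart ν (firstTerm (antiCoefSeq ψ) n 0) := by
    ext u
    rw [pairValue, add_apply, degPart_apply, degPart_apply, degPart_apply]
    split_ifs
    · rfl
    · rw [add_zero]
  rw [hadd, ← hL, ← hF, starValue, sub_mul, map_sub, mul_assoc (letter none ^ _)]
  abel

/-- For `ψ` in `dmr_0`, the operator that corresponds to `s_ψ` is a coderivation for `Δ_*`. -/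
theorem starOp_isCoder (hψ : (shuffle (XLetter Γ)).IsPrimitive ψ) (h0 : ψ [none] = 0)
    (hs : (stuffle Γ).IsPrimitive (starLie ψ)) (hpar : LengthOneParity Γ k ψ) :
    (stuffle Γ).IsCoder (starOp ψ) := by
  refine isCoder_of_letters (starOp_isRaising hψ.apply_nil).isLocal
    (starOp_letter_mul ψ) ?_ fun a => ?_
  · rw [starOp_one]; exact hs
  · have hp := coefSeq_isPrimitive hψ h0 hs
    have h1 : pairValue (coefSeq ψ) (antiCoefSeq ψ) (1, 1) = 0 := by
      rw [← starValue_eq_pairValue hψ hpar, starValue_one]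
    simp only [starValue_eq_pairValue hψ hpar]
    exact cop_pairValue_eq hp (fun i => (hp i).antiInv.smul _)
      (coefSeq_add_antiCoefSeq hψ h0 hpar) h1 a

end StarOperator
end NCSeries

/-! ### The Lie algebra `dmr_0` and its action on `DMR` -/

namespace NCSeries

open QuasiShuffle

section TangentSpace

variable {Γ k : Type*} [CommGroup Γ] [Fintype Γ] [CommRing k] [Algebra ℚ k]
  {φ ψ Φ : NCSeries (XLetter Γ) k}

theorem mem_dmr_iff : ψ ∈ dmr Γ k ↔ ψ [none] = 0 ∧ ψ [some 1] = 0 ∧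
    (shuffle (XLetter Γ)).IsPrimitive ψ ∧ (stuffle Γ).IsPrimitive (starLie ψ) := by
  change _ ∧ _ ∧ _ ∧ _ ↔ _
  rw [coprodX_eq_cop, coprodY_eq_cop]
  rfl

theorem mem_DMR_iff : Φ ∈ DMR Γ k ↔ Φ [] = 1 ∧ Φ [none] = 0 ∧ Φ [some 1] = 0 ∧
    (shuffle (XLetter Γ)).cop Φ = tmul Φ Φ ∧
    (stuffle Γ).cop (starGroup Φ) = tmul (starGroup Φ) (starGroup Φ) := by
  change _ ∧ _ ∧ _ ∧ _ ∧ _ ↔ _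
  rw [coprodX_eq_cop, coprodY_eq_cop]

theorem starLie_eq (ψ : NCSeries (XLetter Γ) k) : starLie ψ = qPi ψ + corrSum ψ := rfl

theorem starLie_add (φ ψ : NCSeries (XLetter Γ) k) :
    starLie (φ + ψ) = starLie φ + starLie ψ := by
  rw [starLie_eq, map_add, corrSum_add, starLie_eq, starLie_eq]; abel

theorem starLie_smul (c : k) (ψ : NCSeries (XLetter Γ) k) :
    starLie (c • ψ) = c • starLie ψ := by
  rw [starLie_eq, map_smul, corrSum_smul, starLie_eq, smul_add]

theorem vanishBelow_of_mem_dmr (hψ : ψ ∈ dmr Γ k) : VanishBelow depthWt 1 ψ := by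
  obtain ⟨h0, -, hp, -⟩ := mem_dmr_iff.1 hψ
  exact vanishBelow_depth_of_isPrimitive hp h0

theorem apply_nil_of_mem_dmr (hψ : ψ ∈ dmr Γ k) : ψ [] = 0 :=
  (mem_dmr_iff.1 hψ).2.2.1.apply_nil

theorem zero_mem_dmr0 : (0 : NCSeries (XLetter Γ) k) ∈ dmr0 Γ k := by
  have h : starLie (0 : NCSeries (XLetter Γ) k) = 0 := by
    rw [starLie_eq, map_zero, corrSum_zero, add_zero]
  have hz : ∀ {A : Type _} (Q : QuasiShuffle A), Q.IsPrimitive (0 : NCSeries A k) := by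
    intro A Q
    refine isPrimitive_of_cop_apply rfl fun u v _ _ => ?_
    rw [cop_zero]; rfl
  refine ⟨mem_dmr_iff.2 ⟨rfl, rfl, hz _, h ▸ hz _⟩, fun n ν => ?_⟩
  rw [h, zero_apply, zero_apply, mul_zero, add_zero]

theorem add_mem_dmr0 (hφ : φ ∈ dmr0 Γ k) (hψ : ψ ∈ dmr0 Γ k) : φ + ψ ∈ dmr0 Γ k := by
  obtain ⟨a0, a1, ap, as⟩ := mem_dmr_iff.1 hφ.1
  obtain ⟨b0, b1, bp, bs⟩ := mem_dmr_iff.1 hψ.1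
  refine ⟨mem_dmr_iff.2 ⟨by rw [add_apply, a0, b0, add_zero], by rw [add_apply, a1, b1, add_zero],
    ap.add bp, starLie_add φ ψ ▸ as.add bs⟩, fun n ν => ?_⟩
  rw [starLie_add, add_apply, add_apply]
  linear_combination hφ.2 n ν + hψ.2 n ν

theorem smul_mem_dmr0 (c : k) (hψ : ψ ∈ dmr0 Γ k) : c • ψ ∈ dmr0 Γ k := by
  obtain ⟨b0, b1, bp, bs⟩ := mem_dmr_iff.1 hψ.1
  refine ⟨mem_dmr_iff.2 ⟨by rw [smul_apply, b0, mul_zero], by rw [smul_apply, b1, mul_zero],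
    bp.smul c, starLie_smul c ψ ▸ bs.smul c⟩, fun n ν => ?_⟩
  rw [starLie_smul, smul_apply, smul_apply]
  linear_combination c * hψ.2 n ν

theorem wordWt_depth_replicate (n : ℕ) :
    wordWt depthWt (List.replicate n (none : XLetter Γ)) < 1 := by
  simp [wordWt, depthWt]

theorem starLie_singleton (ψ : NCSeries (XLetter Γ) k) (n : ℕ+) (ν : Γ) :
    starLie ψ [(n, ν)] = ψ (List.replicate ((n : ℕ) - 1) none ++ [some ν]) := by
  rw [starLie_eq, add_apply, corrSum_of_lt (by simp), add_zero, qPi_apply, toX_singleton]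

/-- The Ihara bracket has no terms of depth one. -/
theorem bracket_apply_depth_one (hφ : φ ∈ dmr Γ k) (hψ : ψ ∈ dmr Γ k) (n : ℕ) (σ : Γ) :
    (sOp φ ψ - sOp ψ φ) (List.replicate n none ++ [some σ]) = 0 := by
  rw [sub_apply, sOp_apply_depth_one (vanishBelow_of_mem_dmr hφ) _ (wordWt_depth_replicate n),
    sOp_apply_depth_one (vanishBelow_of_mem_dmr hψ) _ (wordWt_depth_replicate n),
    apply_nil_of_mem_dmr hφ, apply_nil_of_mem_dmr hψ, mul_zero, mul_zero, sub_zero]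

theorem corrSum_bracket (hφ : φ ∈ dmr Γ k) (hψ : ψ ∈ dmr Γ k) :
    corrSum (sOp φ ψ - sOp ψ φ) = 0 := by
  rw [← corrSum_zero]
  exact corrSum_congr fun n => bracket_apply_depth_one hφ hψ n 1

/-- The bracket has no correction of its own. On the right, corrections commute with each other and
with `yOp`, so every term involving one is symmetric in `φ` and `ψ` and cancels. -/
theorem starLie_bracket (hφ : φ ∈ dmr Γ k) (hψ : ψ ∈ dmr Γ k) :
    starLie (sOp φ ψ - sOp ψ φ) = starOp φ (starOp ψ 1) - starOp ψ (starOp φ 1) := by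
  have h : ∀ {χ : NCSeries (XLetter Γ) k}, χ ∈ dmr Γ k → ∀ η : NCSeries (XLetter Γ) k,
      yOp χ (corrSum η) = corrSum η * qPi χ := by
    intro χ hχ η
    have := LinearMap.congr_fun (commute_yOp_corrSum (apply_nil_of_mem_dmr hχ) η) 1
    change corrSum η * yOp χ 1 = yOp χ (corrSum η * 1) at this
    rw [mul_one, yOp_one] at this
    exact this.symm
  rw [starOp_one, starOp_one, starOp_apply, starOp_apply, starLie_eq, corrSum_bracket hφ hψ,
    map_sub, qPi_sOp, qPi_sOp, starLie_eq, starLie_eq, map_add, map_add, h hφ, h hψ, mul_add,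
    mul_add, corrSum_mul_comm φ ψ]
  abel

/-- Both primitivity conditions come from commutators of coderivations applied to `1`; the
conditions on coefficients hold because the bracket has no terms of depth at most one. -/
theorem bracket_mem_dmr0 (hφ : φ ∈ dmr0 Γ k) (hψ : ψ ∈ dmr0 Γ k) :
    sOp φ ψ - sOp ψ φ ∈ dmr0 Γ k := by
  obtain ⟨a0, a1, ap, as⟩ := mem_dmr_iff.1 hφ.1
  obtain ⟨b0, b1, bp, bs⟩ := mem_dmr_iff.1 hψ.1
  have hd := bracket_apply_depth_one hφ.1 hψ.1
  refine ⟨mem_dmr_iff.2 ⟨?_, hd 0 1, ?_, ?_⟩, fun n ν => ?_⟩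
  · exact ((vanishBelow_sOp (vanishBelow_of_mem_dmr hφ.1) ψ).sub
      (vanishBelow_sOp (vanishBelow_of_mem_dmr hψ.1) φ)) _ (wordWt_depth_replicate 1)
  · have h := (sLin_isCoder ap).cop_commutator_one (sLin_isCoder bp)
      (by have e : sLin φ 1 = φ := sOp_one φ; rw [e]; exact ap)
      (by have e : sLin ψ 1 = ψ := sOp_one ψ; rw [e]; exact bp)
    change (shuffle (XLetter Γ)).IsPrimitive (sOp φ (sOp ψ 1) - sOp ψ (sOp φ 1)) at h
    rwa [sOp_one, sOp_one] at h
  · rw [starLie_bracket hφ.1 hψ.1]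
    exact (starOp_isCoder ap a0 as hφ.2).cop_commutator_one (starOp_isCoder bp b0 bs hψ.2)
      (by rw [starOp_one]; exact as) (by rw [starOp_one]; exact bs)
  · rw [starLie_singleton, starLie_singleton, hd, hd, mul_zero, add_zero]

theorem corrSum_expS (hψ : ψ ∈ dmr Γ k) (hΦ : Φ [] = 1) :
    corrSum (expS ψ Φ) = corrSum ψ + corrSum Φ := by
  rw [add_comm, ← corrSum_add]
  exact corrSum_congr fun n =>
    expS_apply_depth_one (vanishBelow_of_mem_dmr hψ) hΦ (wordWt_depth_replicate n) 1

theorem starGroup_eq_expOp (Φ : NCSeries (XLetter Γ) k) :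
    starGroup Φ = expOp (stuffle Γ).wt (lmulOp (corrSum Φ)) (qPi Φ) :=
  exp_mul_eq_expOp (fun a => a.1.pos) (corrSum_nil Φ) _

/-- Both sides are products of exponentials of commuting operators with the same sum of exponents:
the two corrections and `yOp ψ`. -/
theorem starGroup_expS (hψ : ψ ∈ dmr Γ k) (hΦ : Φ [] = 1) :
    starGroup (expS ψ Φ) = expOp (stuffle Γ).wt (starOp ψ) (starGroup Φ) := by
  have h0 := apply_nil_of_mem_dmr hψ
  have hl : lmulOp (corrSum ψ + corrSum Φ) = lmulOp (corrSum ψ) + lmulOp (corrSum Φ) :=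
    LinearMap.ext fun f => add_mul _ _ f
  have hy := commute_yOp_corrSum h0
  rw [starGroup_eq_expOp, starGroup_eq_expOp, corrSum_expS hψ hΦ, expS_eq_expOp,
    map_expOp qPi_isLocal (sLin_isRaising h0) (qPi_sOp ψ), hl,
    ← expOp_add ((lmulOp_corrSum_isRaising ψ).add (lmulOp_corrSum_isRaising Φ)) (yOp_isRaising h0)
      ((hy ψ).add_left (hy Φ)),
    ← expOp_add (starOp_isRaising h0) (lmulOp_corrSum_isRaising Φ)
      ((commute_lmulOp_corrSum_corrSum ψ Φ).add_left (hy Φ).symm), starOp]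
  congr 1
  abel

theorem expS_mem_DMR (hψ : ψ ∈ dmr0 Γ k) (hΦ : Φ ∈ DMR Γ k) : expS ψ Φ ∈ DMR Γ k := by
  obtain ⟨a0, a1, ap, as⟩ := mem_dmr_iff.1 hψ.1
  obtain ⟨bn, b0, b1, bp, bs⟩ := mem_DMR_iff.1 hΦ
  have hd := vanishBelow_of_mem_dmr hψ.1
  refine mem_DMR_iff.2 ⟨?_, ?_, ?_, ?_, ?_⟩
  · exact (expS_apply_depth_zero hd Φ (wordWt_depth_replicate 0)).trans bn
  · exact (expS_apply_depth_zero hd Φ (wordWt_depth_replicate 1)).trans b0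
  · have := expS_apply_depth_one hd bn (wordWt_depth_replicate 0) 1
    rw [List.replicate_zero, List.nil_append, a1, b1, add_zero] at this
    exact this
  · rw [expS_eq_expOp]
    exact (sLin_isCoder ap).cop_expOp (sLin_isRaising ap.apply_nil) bp
  · rw [starGroup_expS hψ.1 bn]
    exact (starOp_isCoder ap a0 as hψ.2).cop_expOp (starOp_isRaising ap.apply_nil) bs

theorem apply_inv_of_parity (hpar : LengthOneParity Γ k ψ) (σ : Γ) :
    ψ [some σ] = ψ [some σ⁻¹] := by
  have h := hpar 1 σ
  rw [starLie_singleton, starLie_singleton, PNat.one_coe, pow_one] at h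
  change ψ [some σ] + -1 * ψ [some σ⁻¹] = 0 at h
  linear_combination h

/-- The exponential adds to these depth-one coefficients those of `ψ`. By parity `(ψ | x_0 x_1) =
0`, and the coefficients of `ψ` at `x_σ` and `x_{σ⁻¹}` agree, so they cancel in the difference. -/
theorem alphaCoeff_expS (ι : Γ →* ℂˣ) (hι : Function.Injective ι) (hψ : ψ ∈ dmr0 Γ k)
    (hΦ : Φ ∈ DMR Γ k) : alphaCoeff ι hι (expS ψ Φ) = alphaCoeff ι hι Φ := by
  have hd := vanishBelow_of_mem_dmr hψ.1
  have h1 := fun n σ => expS_apply_depth_one hd (mem_DMR_iff.1 hΦ).1 (wordWt_depth_replicate n) σ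
  have h2 : ψ [none, some 1] = 0 := apply_even_of_parity hψ.2 odd_one
  have h3 : expS ψ Φ [none, some 1] = Φ [none, some 1] + ψ [none, some 1] := h1 1 1
  have h4 : ∀ σ, expS ψ Φ [some σ] = Φ [some σ] + ψ [some σ] := h1 0
  rw [alphaCoeff, alphaCoeff, h3, h4, h4, h2, add_zero, apply_inv_of_parity hψ.2]
  congr 2
  abel

end TangentSpace
end NCSeries

/-! ### Substitutions that are linear in the letters -/

namespace NCSeries

open QuasiShuffle

section LinearSubstitution

variable {A B k : Type*} [CommRing k] [Fintype A]

/-- The algebra morphism `a ↦ ∑ b, m a b • b`, as a function of the coefficients. -/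
def linSubstFun (m : A → B → k) : NCSeries A k → NCSeries B k
  | f, [] => f []
  | f, b :: v => ∑ a, m a b * linSubstFun m (shift a f) v

theorem linSubstFun_cons (m : A → B → k) (f : NCSeries A k) (b : B) (v : List B) :
    linSubstFun m f (b :: v) = ∑ a, m a b * linSubstFun m (shift a f) v := by
  rw [linSubstFun]

/-- The algebra morphism `a ↦ ∑ b, m a b • b`. -/
def linSubst (m : A → B → k) : NCSeries A k →ₗ[k] NCSeries B k where
  toFun := linSubstFun m
  map_add' f g := by
    ext v
    induction v generalizing f g with
    | nil => rfl
    | cons b v ih =>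
      rw [add_apply, linSubstFun_cons, linSubstFun_cons, linSubstFun_cons,
        ← Finset.sum_add_distrib]
      refine Finset.sum_congr rfl fun a _ => ?_
      rw [shift_add, ih, add_apply, mul_add]
  map_smul' c f := by
    ext v
    induction v generalizing f with
    | nil => rfl
    | cons b v ih =>
      rw [RingHom.id_apply, smul_apply, linSubstFun_cons, linSubstFun_cons, Finset.mul_sum]
      refine Finset.sum_congr rfl fun a _ => ?_
      rw [shift_smul, ih, RingHom.id_apply, smul_apply, mul_left_comm]

variable (m : A → B → k)

@[simp] theorem linSubst_nil (f : NCSeries A k) : linSubst m f [] = f [] := by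
  change linSubstFun m f [] = _
  rw [linSubstFun]

theorem shift_linSubst (f : NCSeries A k) (b : B) :
    shift b (linSubst m f) = ∑ a, m a b • linSubst m (shift a f) := by
  ext v
  rw [sum_apply]
  exact linSubstFun_cons m f b v

theorem linSubst_cons (f : NCSeries A k) (b : B) (v : List B) :
    linSubst m f (b :: v) = ∑ a, m a b * linSubst m (shift a f) v :=
  linSubstFun_cons m f b v

theorem linSubst_isLocal : IsLocal (fun _ => 1) (fun _ => 1) (linSubst m) := by
  intro n f hf v hv
  induction v generalizing n f with
  | nil => rw [linSubst_nil]; exact hf [] hv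
  | cons b v ih =>
    rw [linSubst_cons]
    refine Finset.sum_eq_zero fun a _ => ?_
    rw [wordWt_cons] at hv
    rw [ih (n - 1) (shift a f) (hf.shift a) (by omega), mul_zero]

theorem linSubst_mul (f g : NCSeries A k) :
    linSubst m (f * g) = linSubst m f * linSubst m g := by
  ext v
  induction v generalizing f g with
  | nil => rw [linSubst_nil, mul_nil, mul_nil, linSubst_nil, linSubst_nil]
  | cons b v ih =>
    rw [mul_cons, linSubst_nil, linSubst_cons, linSubst_cons, shift_linSubst, Finset.sum_mul,
      sum_apply, Finset.mul_sum, ← Finset.sum_add_distrib]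
    refine Finset.sum_congr rfl fun a _ => ?_
    rw [shift_mul, map_add, map_smul, add_apply, smul_apply, ih, smul_mul, smul_apply]
    ring

theorem linSubst_one : linSubst m 1 = 1 := by
  ext v
  cases v with
  | nil => rw [linSubst_nil]; rfl
  | cons b v =>
    rw [linSubst_cons, one_cons]
    exact Finset.sum_eq_zero fun a _ => by rw [shift_one, map_zero, zero_apply, mul_zero]

theorem linSubst_letter [Fintype B] (a : A) :
    linSubst m (letter a) = ∑ b, m a b • letter b := by
  classical
  ext v
  rw [sum_apply]
  cases v with
  | nil =>
    rw [linSubst_nil, letter_nil]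
    exact (Finset.sum_eq_zero fun b _ => by rw [smul_apply, letter_nil, mul_zero]).symm
  | cons b v =>
    rw [linSubst_cons, Finset.sum_eq_single a, Finset.sum_eq_single b, smul_apply, shift_letter,
      if_pos rfl, linSubst_one, ← shift_apply b (letter b), shift_letter, if_pos rfl]
    · intro c _ hc
      rw [smul_apply, ← shift_apply b (letter c), shift_letter, if_neg hc.symm, zero_apply,
        mul_zero]
    · simp
    · intro c _ hc
      rw [shift_letter, if_neg hc, map_zero, zero_apply, mul_zero]
    · simp

/-- It suffices to intertwine the two derivations on letters, since `linSubst m` is multiplicative.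
-/
theorem linSubst_der [Fintype B] {δ : A → NCSeries A k} {δ' : B → NCSeries B k}
    (h : ∀ a, linSubst m (δ a) = ∑ b, m a b • δ' b) (f : NCSeries A k) :
    linSubst m (der δ f) = der δ' (linSubst m f) := by
  have key : ∀ f : NCSeries A k, linSubst m (∑ a, δ a * shift a f) =
      ∑ b, δ' b * shift b (linSubst m f) := by
    intro f
    have h1 : ∀ b, δ' b * shift b (linSubst m f) =
        ∑ a, (m a b • δ' b) * linSubst m (shift a f) := by
      intro b
      rw [shift_linSubst, Finset.mul_sum]
      exact Finset.sum_congr rfl fun a _ => by rw [mul_smul', smul_mul]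
    rw [map_sum, Finset.sum_congr rfl fun b _ => h1 b, Finset.sum_comm]
    refine Finset.sum_congr rfl fun a _ => ?_
    rw [linSubst_mul, h, Finset.sum_mul]
  ext v
  induction v generalizing f with
  | nil => rw [linSubst_nil, der_nil, der_nil, ← key, linSubst_nil]
  | cons b v ih =>
    have h2 : der δ' (shift b (linSubst m f)) = ∑ a, m a b • der δ' (linSubst m (shift a f)) := by
      rw [shift_linSubst, der_sum]
      exact Finset.sum_congr rfl fun a _ => der_smul _ _ _
    rw [der_cons, ← key, linSubst_cons, linSubst_cons, h2, sum_apply, ← Finset.sum_add_distrib]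
    refine Finset.sum_congr rfl fun a _ => ?_
    rw [shift_der, map_add, add_apply, ih, smul_apply, mul_add]

/-- A substitution whose values on letters are homogeneous of degree one is linear in the
letters. -/
theorem subst_eq_linSubst {θ : A → NCSeries B k} (hθ : ∀ a w, w.length ≠ 1 → θ a w = 0)
    (f : NCSeries A k) : subst θ f = linSubst (fun a b => θ a [b]) f := by
  have hn : ∀ a, θ a [] = 0 := fun a => hθ a [] (by simp)
  have hc : ∀ a (g : NCSeries B k) b v, (θ a * g) (b :: v) = θ a [b] * g v := by
    intro a g b v
    rw [mul_cons, hn, zero_mul, zero_add]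
    have : shift b (θ a) = θ a [b] • 1 := by
      ext w
      rw [smul_apply, shift_apply]
      cases w with
      | nil => rw [one_nil, mul_one]
      | cons c w => rw [one_cons, mul_zero]; exact hθ _ _ (by simp)
    rw [this, smul_mul, one_mul, smul_apply]
  have hlen : ∀ (w : List A) (v : List B), w.length ≠ v.length → (w.map θ).prod v = 0 := by
    intro w
    induction w with
    | nil =>
      intro v hv
      rw [List.map_nil, List.prod_nil, one_apply_of_ne_nil]
      rintro rfl
      exact hv rfl
    | cons a w ih =>
      intro v hv
      rw [List.map_cons, List.prod_cons]
      cases v with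
      | nil => rw [mul_nil, hn, zero_mul]
      | cons b v => rw [hc, ih v (by simpa using hv), mul_zero]
  ext v
  induction v generalizing f with
  | nil =>
    rw [linSubst_nil, subst, finsum_eq_single _ []]
    · simp
    · intro w hw
      rw [hlen w [] (by simpa using hw), mul_zero]
  | cons b v ih =>
    have hinj : Function.Injective fun p : A × List A => p.1 :: p.2 := by
      rintro ⟨a, w⟩ ⟨a', w'⟩ h
      simpa using h
    have hsupp : ∀ w, w ∉ Set.range (fun p : A × List A => p.1 :: p.2) →
        f w * (w.map θ).prod (b :: v) = 0 := by
      intro w hw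
      cases w with
      | nil => rw [hlen [] _ (by simp), mul_zero]
      | cons a w => exact absurd ⟨(a, w), rfl⟩ hw
    have hfin : (Function.support fun p : A × List A =>
        f (p.1 :: p.2) * ((p.1 :: p.2).map θ).prod (b :: v)).Finite := by
      refine ((List.finite_length_eq A (v.length + 1)).preimage hinj.injOn).subset ?_
      intro p hp
      by_contra h
      refine hp ?_
      change f (p.1 :: p.2) * ((p.1 :: p.2).map θ).prod (b :: v) = 0
      rw [hlen _ _ (by simpa using h), mul_zero]
    -- Only nonempty words contribute, so the sum is taken over pairs of a first letter and a tail,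
    -- and then split.
    rw [subst, linSubst_cons, ← finsum_mem_univ, ← finsum_mem_inter_support_eq' _
      (Set.range fun p : A × List A => p.1 :: p.2) Set.univ, finsum_mem_range hinj,
      finsum_curry _ hfin, finsum_eq_sum_of_fintype]
    · refine Finset.sum_congr rfl fun a _ => ?_
      rw [← ih, subst, mul_finsum']
      · refine finsum_congr fun w => ?_
        rw [List.map_cons, List.prod_cons, hc, shift_apply]
        ring
      · refine (List.finite_length_eq A v.length).subset fun w hw => ?_
        by_contra h
        refine hw ?_
        change shift a f w * (w.map θ).prod v = 0
        rw [hlen _ _ h, mul_zero]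
    · intro w hw
      refine ⟨fun _ => Set.mem_univ _, fun _ => ?_⟩
      by_contra h
      exact hw (hsupp w h)

end LinearSubstitution

/-! ### Substitutions compatible with the operators `s_ψ` -/

section Equivariance

variable {Γ Γ' k : Type*} [CommGroup Γ] [Fintype Γ] [CommGroup Γ'] [CommRing k]
  {m : XLetter Γ → XLetter Γ' → k}

theorem linSubst_tSubst {σ : Γ} {τ : Γ'}
    (h : ∀ a b, m (a.map (σ * ·)) b = m a (b.map (τ⁻¹ * ·))) (f : NCSeries (XLetter Γ) k) :
    linSubst m (tSubst σ f) = tSubst τ (linSubst m f) := by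
  ext v
  induction v generalizing f with
  | nil => rw [linSubst_nil]; exact (linSubst_nil m f).symm
  | cons b v ih =>
    have h1 : tSubst τ (linSubst m f) (b :: v) = ∑ a, m a (b.map (τ⁻¹ * ·)) *
        tSubst τ (linSubst m (shift a f)) v := linSubst_cons _ _ _ _
    rw [h1, linSubst_cons]
    symm
    refine Fintype.sum_equiv (Equiv.optionCongr (Equiv.mulLeft σ)) _ _ fun a => ?_
    have h2 : shift (Equiv.optionCongr (Equiv.mulLeft σ) a) (tSubst σ f) =
        tSubst σ (shift a f) := by
      ext w
      cases a <;> simp [tSubst]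
    rw [h2, ih, ← h]
    rfl

variable [Fintype Γ']

/-- The last condition on `m` says that the substitution intertwines `t_σ` with `t_τ` whenever `x_τ`
occurs in the image of `x_σ`. It then maps `[x_σ, t_σ(ψ)]` to the corresponding combination of
brackets, as is needed for both `p^d_*` and `i_d^*`. -/
theorem linSubst_sOp (h0 : ∀ τ, m none (some τ) = 0) (h1 : ∀ σ, m (some σ) none = 0)
    (h : ∀ σ τ, m (some σ) (some τ) ≠ 0 → ∀ ν μ,
      m (some (σ * ν)) (some μ) = m (some ν) (some (τ⁻¹ * μ)))
    (ψ f : NCSeries (XLetter Γ) k) :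
    linSubst m (sOp ψ f) = sOp (linSubst m ψ) (linSubst m f) := by
  rw [sOp, sOp, map_add, linSubst_mul, dOp, dOp]
  congr 1
  refine linSubst_der m (fun a => ?_) f
  cases a with
  | none =>
    rw [Fintype.sum_option]
    simp [dLetter, h0]
  | some σ =>
    rw [Fintype.sum_option, h1, zero_smul, zero_add, dLetter, map_sub, linSubst_mul, linSubst_mul,
      linSubst_letter, Fintype.sum_option, h1, zero_smul, zero_add, Finset.sum_mul,
      Finset.mul_sum, ← Finset.sum_sub_distrib]
    refine Finset.sum_congr rfl fun τ _ => ?_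
    rw [smul_mul, mul_smul', ← smul_sub]
    by_cases hm : m (some σ) (some τ) = 0
    · rw [hm, zero_smul, zero_smul]
    · rw [linSubst_tSubst (τ := τ)]
      · rfl
      · rintro (_ | ν) (_ | μ)
        · rfl
        · exact (h0 _).trans (h0 _).symm
        · exact (h1 _).trans (h1 _).symm
        · exact h σ τ hm ν μ

end Equivariance

/-! ### Terms in `x_1` under brackets and exponentials -/

section DistributionTransfer

variable {Γ Γ' k : Type*} [CommGroup Γ] [Fintype Γ] [CommGroup Γ'] [Fintype Γ'] [CommRing k]

/-- The derivation attached to `x_1` is zero, since `[x_σ, t_σ(x_1)] = [x_σ, x_σ]`. -/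
theorem letter_one_sOp (f : NCSeries (XLetter Γ) k) :
    sOp (letter (some 1)) f = letter (some 1) * f := by
  have h : dLetter (letter (some 1) : NCSeries (XLetter Γ) k) = fun _ => 0 := by
    funext a
    cases a with
    | none => rfl
    | some σ => rw [dLetter, tSubst_letter, mul_one, sub_self]
  have h2 : ∀ n, VanishBelow (fun _ => 1) n (der (fun _ : XLetter Γ => 0) f) := fun n =>
    vanishBelow_der (fun _ => vanishBelow_zero n) f
  have h3 : der (fun _ : XLetter Γ => 0) f = 0 := by
    ext w
    exact h2 _ w (Nat.lt_succ_self _)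
  rw [sOp, dOp, h, h3, add_zero]

/-- Since `d_ψ(x_1) = [x_1, ψ]`, the terms `ψ x_1` and `d_ψ(x_1)` add up to `x_1 ψ`. -/
theorem sOp_letter_one_mul (ψ f : NCSeries (XLetter Γ) k) :
    sOp ψ (letter (some 1) * f) = letter (some 1) * sOp ψ f := by
  have h : dLetter ψ (some 1) = letter (some 1) * ψ - ψ * letter (some 1) := by
    rw [dLetter, tSubst_one]
  rw [sOp, dOp_mul, dOp_letter, h, sOp]
  noncomm_ring

theorem sOp_letter_one (ψ : NCSeries (XLetter Γ) k) :
    sOp ψ (letter (some 1)) = letter (some 1) * ψ := by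
  have h := sOp_letter_one_mul ψ 1
  rwa [mul_one, sOp_one] at h

variable {P I : NCSeries (XLetter Γ) k →ₗ[k] NCSeries (XLetter Γ') k}

/-- The cross terms `b x_1 I(φ)`, `a x_1 I(ψ)` and `a b x_1 x_1` occur in both halves of the bracket
and cancel. -/
theorem map_bracket_eq_of_distribution (hP : ∀ ψ f, P (sOp ψ f) = sOp (P ψ) (P f))
    (hI : ∀ ψ f, I (sOp ψ f) = sOp (I ψ) (I f)) {φ ψ : NCSeries (XLetter Γ) k} {a b : k}
    (hφ : P φ = I φ + a • letter (some 1)) (hψ : P ψ = I ψ + b • letter (some 1)) :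
    P (sOp φ ψ - sOp ψ φ) = I (sOp φ ψ - sOp ψ φ) := by
  rw [map_sub, map_sub, hP, hP, hI, hI, hφ, hψ]
  simp only [sOp_add, add_sOp, sOp_smul, smul_sOp, sOp_letter_one, letter_one_sOp, mul_add,
    smul_add, mul_smul', smul_comm a b]
  abel

/-- `s_{P(ψ)}` is the sum of `s_{I(ψ)}` and left multiplication by `a x_1`. These commute with each
other and with left multiplication by `b x_1`, so the exponentials can be regrouped. -/
theorem map_expS_eq_of_distribution [Algebra ℚ k]
    (hP1 : IsLocal (fun _ => 1) (fun _ => 1) P) (hI1 : IsLocal (fun _ => 1) (fun _ => 1) I)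
    (hP : ∀ ψ f, P (sOp ψ f) = sOp (P ψ) (P f))
    (hI : ∀ ψ f, I (sOp ψ f) = sOp (I ψ) (I f)) {ψ Φ : NCSeries (XLetter Γ) k} {a b : k}
    (h0 : ψ [] = 0) (hI0 : I ψ [] = 0) (hψ : P ψ = I ψ + a • letter (some 1))
    (hΦ : P Φ = NCSeries.exp (b • letter (some 1)) * I Φ) :
    P (expS ψ Φ) = NCSeries.exp ((b + a) • letter (some 1)) * I (expS ψ Φ) := by
  have hc : ∀ c : k, (c • letter (some 1) : NCSeries (XLetter Γ') k) [] = 0 := fun c => by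
    rw [smul_apply, letter_nil, mul_zero]
  have hr : ∀ c : k, IsRaising (fun _ => 1)
      (lmulOp (c • letter (some 1) : NCSeries (XLetter Γ') k)) := fun c =>
    lmulOp_isRaising (vanishBelow_one_of_nil (by simp) (hc c))
  have hcomm : ∀ c : k, Commute (sLin (I ψ)) (lmulOp (c • letter (some 1))) := fun c =>
    LinearMap.ext fun f => by
      change sOp (I ψ) ((c • letter (some 1)) * f) = (c • letter (some 1)) * sOp (I ψ) f
      rw [smul_mul, sOp_smul, sOp_letter_one_mul, smul_mul]
  have hcomm2 : ∀ c d : k, Commute (lmulOp (c • letter (some 1) : NCSeries (XLetter Γ') k))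
      (lmulOp (d • letter (some 1))) := fun c d =>
    LinearMap.ext fun f => by
      change (c • letter (some 1)) * ((d • letter (some 1)) * f) =
        (d • letter (some 1)) * ((c • letter (some 1)) * f)
      simp only [smul_mul, mul_smul']
      rw [smul_comm]
  have hs : sLin (P ψ) = sLin (I ψ) + lmulOp (a • letter (some 1)) := LinearMap.ext fun f => by
    change sOp (P ψ) f = sOp (I ψ) f + (a • letter (some 1)) * f
    rw [hψ, add_sOp, smul_sOp, letter_one_sOp, smul_mul]
  have hl : lmulOp ((b + a) • letter (some 1) : NCSeries (XLetter Γ') k) =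
      lmulOp (a • letter (some 1)) + lmulOp (b • letter (some 1)) := LinearMap.ext fun f => by
    change _ * f = _ * f + _ * f
    rw [add_smul, add_mul, add_comm]
  have hrI := sLin_isRaising hI0
  rw [expS_eq_expOp, map_expOp (T := sLin (P ψ)) hP1 (sLin_isRaising h0) (hP ψ),
    map_expOp (T := sLin (I ψ)) hI1 (sLin_isRaising h0) (hI ψ), hΦ, exp_mul_eq_expOp (fun _ => one_pos) (hc b),
    exp_mul_eq_expOp (fun _ => one_pos) (hc _), hs, hl,
    ← expOp_add (hrI.add (hr a)) (hr b) ((hcomm b).add_left (hcomm2 a b)),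
    ← expOp_add ((hr a).add (hr b)) hrI ((hcomm a).symm.add_left (hcomm b).symm)]
  congr 1
  abel

end DistributionTransfer
end NCSeries

/-! ### Distribution -/

namespace NCSeries

open QuasiShuffle

section Distribution

variable {Γ k : Type*} [CommGroup Γ] [CommRing k]

theorem letter_apply_of_length_ne {A : Type*} (a : A) {w : List A} (hw : w.length ≠ 1) :
    (letter a : NCSeries A k) w = 0 := by
  rw [letter, if_neg]
  rintro rfl
  exact hw rfl

open Classical in
theorem letter_singleton {A : Type*} (a b : A) :
    (letter a : NCSeries A k) [b] = if b = a then 1 else 0 := by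
  rw [letter]
  simp

theorem pushLetter_apply_of_length_ne {Γ' : Type*} [CommGroup Γ'] (φ : Γ →* Γ') (a : XLetter Γ)
    (w : List (XLetter Γ')) (hw : w.length ≠ 1) : (pushLetter φ a : NCSeries _ k) w = 0 := by
  cases a with
  | none => rw [pushLetter, smul_apply, letter_apply_of_length_ne _ hw, mul_zero]
  | some σ => rw [pushLetter, letter_apply_of_length_ne _ hw]

open Classical in
theorem pullLetter_subtype_some (H : Subgroup Γ) (σ : Γ) :
    (pullLetter H.subtype (some σ) : NCSeries (XLetter H) k) =
      if h : σ ∈ H then letter (some ⟨σ, h⟩) else 0 := by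
  rw [pullLetter]
  split_ifs with h
  · rw [finsum_eq_single _ ⟨σ, h⟩]
    · simp
    · intro τ hτ
      rw [finsum_eq_if, if_neg]
      intro h'
      exact hτ (Subtype.ext h')
  · refine finsum_eq_zero_of_forall_eq_zero fun τ => ?_
    rw [finsum_eq_if, if_neg]
    intro h'
    exact h (h' ▸ τ.2)

theorem pullLetter_apply_of_length_ne (H : Subgroup Γ) (a : XLetter Γ)
    (w : List (XLetter H)) (hw : w.length ≠ 1) :
    (pullLetter H.subtype a : NCSeries _ k) w = 0 := by
  cases a with
  | none => rw [pullLetter, letter_apply_of_length_ne _ hw]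
  | some σ =>
    rw [pullLetter_subtype_some]
    split_ifs
    · rw [letter_apply_of_length_ne _ hw]
    · rfl

variable [Fintype Γ] (d : ℕ)

/-- `p^d_*` as a linear map. -/
noncomputable def pushPowLin : NCSeries (XLetter Γ) k →ₗ[k] NCSeries (XLetter (powSubgroup Γ d)) k :=
  linSubst fun a b => pushLetter (powMonoidHom d : Γ →* Γ).rangeRestrict a [b]

/-- `i_d^*` as a linear map. -/
noncomputable def pullInclLin :
    NCSeries (XLetter Γ) k →ₗ[k] NCSeries (XLetter (powSubgroup Γ d)) k :=
  linSubst fun a b => pullLetter (powSubgroup Γ d).subtype a [b]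

theorem pushPow_eq (f : NCSeries (XLetter Γ) k) : pushPow d f = pushPowLin d f :=
  subst_eq_linSubst (pushLetter_apply_of_length_ne _) f

theorem pullIncl_eq (f : NCSeries (XLetter Γ) k) : pullIncl d f = pullInclLin d f :=
  subst_eq_linSubst (pullLetter_apply_of_length_ne _) f

variable [Fintype (powSubgroup Γ d)]

theorem pushPowLin_sOp (ψ f : NCSeries (XLetter Γ) k) :
    pushPowLin d (sOp ψ f) = sOp (pushPowLin d ψ) (pushPowLin d f) := by
  classical
  have hs : ∀ (σ : Γ) (τ : powSubgroup Γ d),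
      (pushLetter (powMonoidHom d : Γ →* Γ).rangeRestrict (some σ) : NCSeries _ k) [some τ] =
        if τ = (powMonoidHom d : Γ →* Γ).rangeRestrict σ then 1 else 0 := by
    intro σ τ
    rw [pushLetter, letter_singleton]
    simp
  refine linSubst_sOp (fun τ => ?_) (fun σ => ?_) (fun σ τ h ν μ => ?_) ψ f
  · rw [pushLetter, smul_apply, letter_singleton, if_neg (by simp), mul_zero]
  · rw [pushLetter, letter_singleton, if_neg (by simp)]
  · rw [hs] at h
    have hτ : τ = (powMonoidHom d : Γ →* Γ).rangeRestrict σ := by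
      by_contra h'
      exact h (if_neg h')
    rw [hs, hs, map_mul, ← hτ]
    simp only [inv_mul_eq_iff_eq_mul]

theorem pullInclLin_sOp (ψ f : NCSeries (XLetter Γ) k) :
    pullInclLin d (sOp ψ f) = sOp (pullInclLin d ψ) (pullInclLin d f) := by
  classical
  have hs : ∀ (σ : Γ) (τ : powSubgroup Γ d),
      (pullLetter (powSubgroup Γ d).subtype (some σ) : NCSeries _ k) [some τ] =
        if σ = τ then 1 else 0 := by
    intro σ τ
    rw [pullLetter_subtype_some]
    by_cases h : σ ∈ powSubgroup Γ d
    · rw [dif_pos h, letter_singleton]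
      simp only [Option.some.injEq, Subtype.ext_iff, eq_comm]
    · rw [dif_neg h, if_neg, zero_apply]
      rintro rfl
      exact h τ.2
  refine linSubst_sOp (fun τ => ?_) (fun σ => ?_) (fun σ τ h ν μ => ?_) ψ f
  · rw [pullLetter, letter_singleton, if_neg (by simp)]
  · rw [pullLetter_subtype_some]
    split_ifs
    · rw [letter_singleton, if_neg (by simp)]
    · rfl
  · rw [hs] at h
    have hσ : σ = τ := by
      by_contra h'
      exact h (if_neg h')
    rw [hs, hs, hσ]
    simp only [Subgroup.coe_mul, Subgroup.coe_inv, eq_inv_mul_iff_mul_eq]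

end Distribution

/-! ### The distribution relations for brackets and exponentials -/

section DistributionRelations

variable {Γ k : Type*} [CommGroup Γ] [Fintype Γ] [CommRing k] (d : ℕ)

open Classical in
theorem distTerm_congr {f g : NCSeries (XLetter Γ) k} (h : ∀ σ, f [some σ] = g [some σ]) :
    distTerm d f = distTerm d g := by
  rw [distTerm, distTerm, Finset.sum_congr rfl fun σ _ => h σ]

theorem distTerm_zero : distTerm d (0 : NCSeries (XLetter Γ) k) = 0 := by
  rw [distTerm, Finset.sum_congr rfl fun σ _ => zero_apply [some σ], Finset.sum_const_zero,
    zero_smul]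

theorem distTerm_add (f g : NCSeries (XLetter Γ) k) :
    distTerm d (f + g) = distTerm d f + distTerm d g := by
  rw [distTerm, distTerm, distTerm, ← add_smul, ← Finset.sum_add_distrib]
  rfl

theorem distTerm_smul (c : k) (f : NCSeries (XLetter Γ) k) :
    distTerm d (c • f) = c • distTerm d f := by
  rw [distTerm, distTerm, smul_smul, Finset.mul_sum]
  rfl

variable [Algebra ℚ k] {φ ψ Φ : NCSeries (XLetter Γ) k}

theorem mem_dmrd0_iff : ψ ∈ dmrd0 Γ k ↔ ψ ∈ dmr0 Γ k ∧ ∀ d : ℕ, d ∣ Fintype.card Γ →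
    pushPowLin d ψ = pullInclLin d ψ + distTerm d ψ := by
  simp only [← pushPow_eq, ← pullIncl_eq]
  exact and_right_comm

theorem zero_mem_dmrd0 : (0 : NCSeries (XLetter Γ) k) ∈ dmrd0 Γ k :=
  mem_dmrd0_iff.2 ⟨zero_mem_dmr0, fun d _ => by
    rw [map_zero, map_zero, distTerm_zero, add_zero]⟩

theorem add_mem_dmrd0 (hφ : φ ∈ dmrd0 Γ k) (hψ : ψ ∈ dmrd0 Γ k) : φ + ψ ∈ dmrd0 Γ k := by
  obtain ⟨hφ0, hφd⟩ := mem_dmrd0_iff.1 hφ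
  obtain ⟨hψ0, hψd⟩ := mem_dmrd0_iff.1 hψ
  refine mem_dmrd0_iff.2 ⟨add_mem_dmr0 hφ0 hψ0, fun d hd => ?_⟩
  rw [map_add, map_add, distTerm_add, hφd d hd, hψd d hd]
  abel

theorem smul_mem_dmrd0 (c : k) (hψ : ψ ∈ dmrd0 Γ k) : c • ψ ∈ dmrd0 Γ k := by
  obtain ⟨hψ0, hψd⟩ := mem_dmrd0_iff.1 hψ
  refine mem_dmrd0_iff.2 ⟨smul_mem_dmr0 c hψ0, fun d hd => ?_⟩
  rw [map_smul, map_smul, distTerm_smul, hψd d hd, smul_add]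

/-- The bracket has no terms of depth one, so its relation has no term in `x_1` and only the
equality of the two images is left. -/
theorem bracket_mem_dmrd0 (hφ : φ ∈ dmrd0 Γ k) (hψ : ψ ∈ dmrd0 Γ k) :
    sOp φ ψ - sOp ψ φ ∈ dmrd0 Γ k := by
  obtain ⟨hφ0, hφd⟩ := mem_dmrd0_iff.1 hφ
  obtain ⟨hψ0, hψd⟩ := mem_dmrd0_iff.1 hψ
  refine mem_dmrd0_iff.2 ⟨bracket_mem_dmr0 hφ0 hψ0, fun d hd => ?_⟩
  have := Fintype.ofFinite (powSubgroup Γ d)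
  rw [distTerm_congr d (g := 0) (bracket_apply_depth_one hφ0.1 hψ0.1 0), distTerm_zero, add_zero]
  exact map_bracket_eq_of_distribution (pushPowLin_sOp d) (pullInclLin_sOp d) (hφd d hd)
    (hψd d hd)

/-- The exponential adds the coefficients of `ψ` at the letters `x_σ` to those of `Φ`, which matches
the sum `b + a` in the transfer of the relation. -/
theorem expS_mem_DMRD (hψ : ψ ∈ dmrd0 Γ k) (hΦ : Φ ∈ DMRD Γ k) : expS ψ Φ ∈ DMRD Γ k := by
  obtain ⟨hψ0, hψd⟩ := mem_dmrd0_iff.1 hψ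
  refine ⟨expS_mem_DMR hψ0 hΦ.1, fun d hd => ?_⟩
  have := Fintype.ofFinite (powSubgroup Γ d)
  have h0 := apply_nil_of_mem_dmr hψ0.1
  have h1 : distTerm d (expS ψ Φ) = distTerm d (Φ + ψ) := distTerm_congr d
    (expS_apply_depth_one (vanishBelow_of_mem_dmr hψ0.1) (mem_DMR_iff.1 hΦ.1).1
      (wordWt_depth_replicate 0))
  have h2 := hΦ.2 d hd
  rw [pushPow_eq, pullIncl_eq] at h2
  rw [pushPow_eq, pullIncl_eq, h1, distTerm_add, distTerm, distTerm, ← add_smul]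
  exact map_expS_eq_of_distribution (linSubst_isLocal _) (linSubst_isLocal _) (pushPowLin_sOp d)
    (pullInclLin_sOp d) h0 ((linSubst_nil _ _).trans h0) (hψd d hd) h2

end DistributionRelations
end NCSeries

/-! ### The Lie subalgebras and the theorem -/

section Main

open NCSeries

variable (Γ k : Type*) [CommGroup Γ] [Fintype Γ] [CommRing k] [Algebra ℚ k]

/-- `dmr_0(k)` as a Lie subalgebra of `mt(k)`. -/
def dmr0LieSubalgebra : LieSubalgebra k (mtLie Γ k) where
  carrier := {ψ | ψ.1 ∈ dmr0 Γ k}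
  zero_mem' := zero_mem_dmr0
  add_mem' := add_mem_dmr0
  smul_mem' c _ := smul_mem_dmr0 c
  lie_mem' := bracket_mem_dmr0

/-- `dmrd_0(k)` as a Lie subalgebra of `mt(k)`. -/
def dmrd0LieSubalgebra : LieSubalgebra k (mtLie Γ k) where
  carrier := {ψ | ψ.1 ∈ dmrd0 Γ k}
  zero_mem' := zero_mem_dmrd0
  add_mem' := add_mem_dmrd0
  smul_mem' c _ := smul_mem_dmrd0 c
  lie_mem' := bracket_mem_dmrd0

end Main

open NCSeries in
theorem proposition4p1 (Γ : Type*) [CommGroup Γ] [Fintype Γ]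
    (k : Type*) [CommRing k] [Algebra ℚ k] :
    (∃ L : LieSubalgebra k (mtLie Γ k), Subtype.val '' (L : Set (mtLie Γ k)) = dmr0 Γ k) ∧
    (∃ L : LieSubalgebra k (mtLie Γ k), Subtype.val '' (L : Set (mtLie Γ k)) = dmrd0 Γ k) ∧
    (∀ ψ ∈ dmr0 Γ k, ∀ Φ ∈ DMR Γ k, expS ψ Φ ∈ DMR Γ k) ∧
    (∀ ψ ∈ dmrd0 Γ k, ∀ Φ ∈ DMRD Γ k, expS ψ Φ ∈ DMRD Γ k) ∧
    (∀ (ι : Γ →* ℂˣ) (hι : Function.Injective ι), ∀ ψ ∈ dmr0 Γ k, ∀ Φ ∈ DMR Γ k,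
      alphaCoeff ι hι (expS ψ Φ) = alphaCoeff ι hι Φ) := by
  refine ⟨⟨dmr0LieSubalgebra Γ k, ?_⟩, ⟨dmrd0LieSubalgebra Γ k, ?_⟩,
    fun ψ hψ Φ hΦ => expS_mem_DMR hψ hΦ, fun ψ hψ Φ hΦ => expS_mem_DMRD hψ hΦ,
    fun ι hι ψ hψ Φ hΦ => alphaCoeff_expS ι hι hψ hΦ⟩
  · ext ψ
    exact ⟨fun ⟨_, h, e⟩ => e ▸ h, fun h => ⟨⟨ψ, apply_nil_of_mem_dmr h.1⟩, h, rfl⟩⟩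
  · ext ψ
    exact ⟨fun ⟨_, h, e⟩ => e ▸ h, fun h => ⟨⟨ψ, apply_nil_of_mem_dmr h.1.1⟩, h, rfl⟩⟩
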